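/- Let $B$ be a connected smooth manifold of dimension $n$, let $\mathcal G$ be a connected abelian Lie group of dimension $N \ge 1$, and let $\pi : M \to B$ be a twisted principal $\mathcal G$-bundle, i.e. a smooth fiber bundle with fiber $\mathcal G$ and structure group $\mathcal G \rtimes \operatorname{Aut}(\mathcal G)_\delta$, where $\operatorname{Aut}(\mathcal G)_\delta$ is the automorphism group with the discrete topology. Thus the transition maps are locally of the form $(b,x) \mapsto f(b)\,\gamma(x)$, with $f$ smooth and $\gamma$ an automorphism of $\mathcal G$ that is locally independent of $b$. The differentials of the automorphisms $\gamma$ define a flat vector bundle $e$ on $B$ whose fiber is the Lie algebra of $\mathcal G$; suppose that its holonomy lies in $\det^{-1}(\pm 1)$. Let $\overline g$ be a Riemannian metric on $M$ for which the local $\mathcal G$-actions, given by translations of the fibers in the local trivializations, are isometric. In local coordinates $b^\alpha$ on $B$ and linear coordinates $x^I$ on the fibers, write $$\overline g = \sum_{I,J=1}^N G_{IJ}\,(dx^I + A^I)(dx^J + A^J) + \sum_{\alpha,\beta=1}^n g_{\alpha\beta}\, db^\alpha db^\beta ,$$ where $g_B = (g_{\alpha\beta})$ is the metric on $B$ that makes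 $\pi$ a Riemannian submersion, $G = (G_{IJ})$ is a Euclidean inner product on $e$, and $A^I = A^I_\alpha\, db^\alpha$. Put $F^I_{\alpha\beta} = \partial_\alpha A^I_\beta - \partial_\beta A^I_\alpha$ and $|F|^2 = g^{\alpha\gamma} g^{\beta\delta} G_{IJ} F^I_{\alpha\beta} F^J_{\gamma\delta}$. Let $\det G : B \to (0,\infty)$ be the determinant of $G$ in a parallel frame of $e$; by the holonomy assumption it is globally defined, up to a constant positive factor. Commas denote partial derivatives on $B$, and semicolons denote covariant derivatives with respect to $g_B$, so that $G_{IJ;\alpha\beta} = \partial_\alpha\partial_\beta G_{IJ} - \Gamma^\sigma_{\alpha\beta}\, \partial_\sigma G_{IJ}$. Suppose that $\operatorname{Ric}(\overline g) = \lambda \overline g$ for some $\lambda \in \mathbb R$. Then $$\triangle \sqrt{\det G} = \left( \tfrac14 |F|^2 - \lambda N \right) \sqrt{\det G} \quad \text{on } B .$$ If, moreover, $(B, g_B)$ is parabolic (every nonnegative $C^2$ function $f$ on $B$ that is bounded above and satisfies $\triangle f \ge 0$ is constant), $\lambda \le 0$, and $\det G$ is bounded above, then 1. $\det G$ is constant,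 2. $F = 0$, 3. $\lambda = 0$, and 4. $g^{\alpha\beta} G_{IJ;\alpha\beta} - g^{\alpha\beta} G^{KL} G_{IK,\alpha} G_{LJ,\beta} = 0$ for all $I, J$. (After normalizing $\det G = 1$, the last equation is the local equation for a harmonic map from $B$ to $\operatorname{SL}(N,\mathbb R)/\operatorname{SO}(N)$.) -/

import Mathlib

open Set Filter Topology Bundle
open scoped Manifold ContDiff

noncomputable section

namespace TwistedBundle

/-- The model space with coordinates indexed by `ι`. -/
abbrev Coord (ι : Type) [Fintype ι] : Type := EuclideanSpace ℝ ι

section Coordinates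

variable {ι : Type} [Fintype ι] [DecidableEq ι]

/-- The partial derivative `∂_i u` of a function on the model space. -/
def pd (i : ι) (u : Coord ι → ℝ) (y : Coord ι) : ℝ :=
  fderiv ℝ u y (EuclideanSpace.single i (1 : ℝ))

/-- The Christoffel symbols `Γ^k_{ij}` of a metric given by its matrix of coefficients. -/
def christoffel (g : Coord ι → Matrix ι ι ℝ) (k i j : ι) (y : Coord ι) : ℝ :=
  (1 / 2) * ∑ l, (g y)⁻¹ k l *
    (pd i (fun z => g z j l) y + pd j (fun z => g z i l) y - pd l (fun z => g z i j) y)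

/-- The Ricci tensor `R_{ij}`, with the sign for which round spheres are positive. -/
def ricci (g : Coord ι → Matrix ι ι ℝ) (i j : ι) (y : Coord ι) : ℝ :=
  (∑ k, pd k (christoffel g k i j) y) - (∑ k, pd j (christoffel g k i k) y)
    + (∑ k, ∑ l, christoffel g k k l y * christoffel g l i j y)
    - ∑ k, ∑ l, christoffel g k j l y * christoffel g l i k y

/-- The second covariant derivative
`u_{;ij} = ∂_i ∂_j u - Γ^k_{ij} ∂_k u` of a function. -/
def hess (g : Coord ι → Matrix ι ι ℝ) (u : Coord ι → ℝ) (i j : ι) (y : Coord ι) : ℝ :=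
  pd i (pd j u) y - ∑ k, christoffel g k i j y * pd k u y

/-- The Laplace-Beltrami operator `g^{ij} u_{;ij}`. -/
def coordLaplacian (g : Coord ι → Matrix ι ι ℝ) (u : Coord ι → ℝ) (y : Coord ι) : ℝ :=
  ∑ i, ∑ j, (g y)⁻¹ i j * hess g u i j y

end Coordinates

section Manifolds

variable {ι : Type} [Fintype ι] [DecidableEq ι]
variable {X : Type*} [TopologicalSpace X] [ChartedSpace (Coord ι) X]

/-- The smooth charts of a manifold. -/
abbrev charts (ι : Type) [Fintype ι] (X : Type*) [TopologicalSpace X]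
    [ChartedSpace (Coord ι) X] : Set (OpenPartialHomeomorph X (Coord ι)) :=
  IsManifold.maximalAtlas 𝓘(ℝ, Coord ι) ∞ X

/-- The coordinate vector field `∂_i` of the chart `φ`, at the point with coordinates `y`. -/
def coordVec (φ : OpenPartialHomeomorph X (Coord ι)) (y : Coord ι) (i : ι) :
    TangentSpace 𝓘(ℝ, Coord ι) (φ.symm y) :=
  mfderiv 𝓘(ℝ, Coord ι) 𝓘(ℝ, Coord ι) φ.symm y (EuclideanSpace.single i (1 : ℝ) : Coord ι)

variable [IsManifold 𝓘(ℝ, Coord ι) ∞ X]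

/-- Smooth Riemannian metrics on a manifold. -/
abbrev Metric (ι : Type) [Fintype ι] (X : Type*) [TopologicalSpace X]
    [ChartedSpace (Coord ι) X] [IsManifold 𝓘(ℝ, Coord ι) ∞ X] :=
  ContMDiffRiemannianMetric 𝓘(ℝ, Coord ι) ∞ (Coord ι)
    (fun x : X => TangentSpace 𝓘(ℝ, Coord ι) x)

/-- The coefficients `g_{ij}` of a Riemannian metric in the chart `φ`. -/
def metricCoeff (g : Metric ι X) (φ : OpenPartialHomeomorph X (Coord ι)) (y : Coord ι) :
    Matrix ι ι ℝ :=
  fun i j => g.inner (φ.symm y) (coordVec φ y i) (coordVec φ y j)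

/-- The Einstein equation `Ric(g) = lam g`. -/
def IsEinstein (g : Metric ι X) (lam : ℝ) : Prop :=
  ∀ φ ∈ charts ι X, ∀ y ∈ φ.target, ∀ i j,
    ricci (metricCoeff g φ) i j y = lam * metricCoeff g φ y i j

/-- `Δ f ≥ 0` for the metric `g`. -/
def IsSubharmonic (g : Metric ι X) (f : X → ℝ) : Prop :=
  ∀ φ ∈ charts ι X, ∀ y ∈ φ.target,
    0 ≤ coordLaplacian (metricCoeff g φ) (fun z => f (φ.symm z)) y

/-- Parabolicity of a connected Riemannian manifold: nonnegative bounded `C²` functions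
with `Δ f ≥ 0` are constant. -/
def IsParabolic (g : Metric ι X) : Prop :=
  ∀ f : X → ℝ, ContMDiff 𝓘(ℝ, Coord ι) 𝓘(ℝ, ℝ) 2 f → (∀ x, 0 ≤ f x) →
    BddAbove (range f) → IsSubharmonic g f → ∃ c, ∀ x, f x = c

end Manifolds

section Bundles

variable {n N : ℕ}
variable {B : Type*} [TopologicalSpace B] [ChartedSpace (Coord (Fin n)) B]
variable {M : Type*} [TopologicalSpace M] [ChartedSpace (Coord (Fin n ⊕ Fin N)) M]
variable {𝒢 : Type*} [CommGroup 𝒢] [TopologicalSpace 𝒢] [ChartedSpace (Coord (Fin N)) 𝒢]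
variable {proj : M → B}

/-- The transition map between two local trivializations, on the fiber over `b`. -/
def transition (e e' : Trivialization 𝒢 proj) (b : B) (x : 𝒢) : 𝒢 :=
  (e' (e.toOpenPartialHomeomorph.symm (b, x))).2

variable (𝒢) (proj) in
/-- A twisted principal `𝒢`-bundle `proj : M → B`, i.e. a smooth fiber bundle with fiber `𝒢` and
structure group `𝒢 ⋊ Aut(𝒢)_δ`: it has smooth local trivializations whose transition maps are,
locally in the base, of the form `(b, x) ↦ f b * γ x` with `γ` an automorphism of `𝒢` that does
not depend on `b`. (The maps `f` and `γ` are then automatically smooth.) -/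
structure TwistedPrincipalBundle where
  /-- the local trivializations of the bundle -/
  atlas : Set (Trivialization 𝒢 proj)
  exists_mem_baseSet : ∀ b : B, ∃ e ∈ atlas, b ∈ e.baseSet
  contMDiffOn : ∀ e ∈ atlas, ContMDiffOn 𝓘(ℝ, Coord (Fin n ⊕ Fin N))
    (𝓘(ℝ, Coord (Fin n)).prod 𝓘(ℝ, Coord (Fin N))) ∞ e e.source
  contMDiffOn_symm : ∀ e ∈ atlas, ContMDiffOn
    (𝓘(ℝ, Coord (Fin n)).prod 𝓘(ℝ, Coord (Fin N))) 𝓘(ℝ, Coord (Fin n ⊕ Fin N)) ∞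
    e.toOpenPartialHomeomorph.symm e.target
  exists_transition : ∀ e ∈ atlas, ∀ e' ∈ atlas, ∀ b₀ ∈ e.baseSet ∩ e'.baseSet,
    ∃ (f : B → 𝒢) (γ : 𝒢 ≃ₜ* 𝒢), ∀ᶠ b in 𝓝 b₀, ∀ x, transition e e' b x = f b * γ x

/-- The differential at the identity of the automorphism `γ` of `𝒢` in the transition map
`x ↦ f b * γ x` between two trivializations. These are the (locally constant) transition functions
of the flat vector bundle with fiber the Lie algebra of `𝒢`. The Lie algebra, being the tangent
space at the identity, is identified with the model space of `𝒢`. -/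
def transitionDeriv (e e' : Trivialization 𝒢 proj) (b : B) :
    Coord (Fin N) →L[ℝ] Coord (Fin N) :=
  mfderiv 𝓘(ℝ, Coord (Fin N)) 𝓘(ℝ, Coord (Fin N))
    (fun x : 𝒢 => (transition e e' b 1)⁻¹ * transition e e' b x) (1 : 𝒢)

/-- The local action of `h ∈ 𝒢` on `M` defined by the local trivialization `e`. -/
def localAct (e : Trivialization 𝒢 proj) (h : 𝒢) (p : M) : M :=
  e.toOpenPartialHomeomorph.symm (proj p, h * (e p).2)

/-- The local section of `M` defined by the local trivialization `e`. -/
def localSection (e : Trivialization 𝒢 proj) (b : B) : M :=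
  e.toOpenPartialHomeomorph.symm (b, 1)

/-- The vertical vector, at the point `localSection e b`, which the local action induces from the
element `w` of the Lie algebra of `𝒢`. -/
def vertVec (e : Trivialization 𝒢 proj) (b : B) (w : Coord (Fin N)) :
    TangentSpace 𝓘(ℝ, Coord (Fin n ⊕ Fin N)) (localSection e b) :=
  mfderiv 𝓘(ℝ, Coord (Fin N)) 𝓘(ℝ, Coord (Fin n ⊕ Fin N))
    (fun h : 𝒢 => e.toOpenPartialHomeomorph.symm (b, h)) (1 : 𝒢) w

namespace TwistedPrincipalBundle

variable (P : TwistedPrincipalBundle (n := n) (N := N) 𝒢 proj)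

/-- Parallel transport for the flat vector bundle with fiber the Lie algebra of `𝒢`. The statement
`P.Transport e b e' b' L` says that along some path from `b` to `b'` the parallel transport, when
written in the trivializations `e` at `b` and `e'` at `b'`, is `L`. -/
inductive Transport (e : Trivialization 𝒢 proj) (b : B) :
    Trivialization 𝒢 proj → B → (Coord (Fin N) →L[ℝ] Coord (Fin N)) → Prop
  | refl (he : e ∈ P.atlas) (hb : b ∈ e.baseSet) :
      Transport e b e b (ContinuousLinearMap.id ℝ _)
  | move {e' : Trivialization 𝒢 proj} {b' b'' : B} {L : Coord (Fin N) →L[ℝ] Coord (Fin N)}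
      (h : Transport e b e' b' L) (hb : JoinedIn e'.baseSet b' b'') : Transport e b e' b'' L
  | change {e' e'' : Trivialization 𝒢 proj} {b' : B} {L : Coord (Fin N) →L[ℝ] Coord (Fin N)}
      (h : Transport e b e' b' L) (he : e'' ∈ P.atlas) (hb : b' ∈ e''.baseSet) :
      Transport e b e'' b' ((transitionDeriv e' e'' b').comp L)

/-- The holonomy of the flat vector bundle lies in `det⁻¹(±1)`. -/
def HolonomyDetPmOne : Prop :=
  ∀ (e : Trivialization 𝒢 proj) (b : B) (L : Coord (Fin N) →L[ℝ] Coord (Fin N)),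
    P.Transport e b e b L → |LinearMap.det (L : Coord (Fin N) →ₗ[ℝ] Coord (Fin N))| = 1

variable [IsManifold 𝓘(ℝ, Coord (Fin n)) ∞ B] [IsManifold 𝓘(ℝ, Coord (Fin n ⊕ Fin N)) ∞ M]

/-- The local `𝒢`-actions are isometric. -/
def IsInvariantMetric (gM : Metric (Fin n ⊕ Fin N) M) : Prop :=
  ∀ e ∈ P.atlas, ∀ (h : 𝒢), ∀ p ∈ e.source,
    ∀ u w : TangentSpace 𝓘(ℝ, Coord (Fin n ⊕ Fin N)) p,
      gM.inner (localAct e h p)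
        (mfderiv 𝓘(ℝ, Coord (Fin n ⊕ Fin N)) 𝓘(ℝ, Coord (Fin n ⊕ Fin N)) (localAct e h) p u)
        (mfderiv 𝓘(ℝ, Coord (Fin n ⊕ Fin N)) 𝓘(ℝ, Coord (Fin n ⊕ Fin N)) (localAct e h) p w)
      = gM.inner p u w

end TwistedPrincipalBundle

variable [IsManifold 𝓘(ℝ, Coord (Fin n)) ∞ B] [IsManifold 𝓘(ℝ, Coord (Fin n ⊕ Fin N)) ∞ M]

/-- `proj` is a Riemannian submersion: on vectors that are orthogonal to the fibers, the metric of `M`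
is the pullback of the metric of `B`. -/
def IsRiemannianSubmersion (proj : M → B) (gM : Metric (Fin n ⊕ Fin N) M)
    (gB : Metric (Fin n) B) : Prop :=
  ∀ (p : M) (u w : TangentSpace 𝓘(ℝ, Coord (Fin n ⊕ Fin N)) p),
    (∀ z : TangentSpace 𝓘(ℝ, Coord (Fin n ⊕ Fin N)) p,
      mfderiv 𝓘(ℝ, Coord (Fin n ⊕ Fin N)) 𝓘(ℝ, Coord (Fin n)) proj p z = 0 →
        gM.inner p u z = 0 ∧ gM.inner p w z = 0) →
    gM.inner p u w = gB.inner (proj p)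
      (mfderiv 𝓘(ℝ, Coord (Fin n ⊕ Fin N)) 𝓘(ℝ, Coord (Fin n)) proj p u)
      (mfderiv 𝓘(ℝ, Coord (Fin n ⊕ Fin N)) 𝓘(ℝ, Coord (Fin n)) proj p w)

/-- The fiberwise inner product `G` on the Lie algebra of `𝒢`, in the trivialization `e`. -/
def fiberInner (gM : Metric (Fin n ⊕ Fin N) M) (e : Trivialization 𝒢 proj) (b : B)
    (w w' : Coord (Fin N)) : ℝ :=
  gM.inner (localSection e b) (vertVec e b w) (vertVec e b w')

/-- The matrix `G_{IJ}` in the chart `φ` of `B`, the trivialization `e` and the basis `v` of the Lie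
algebra of `𝒢`. -/
def matG (gM : Metric (Fin n ⊕ Fin N) M) (e : Trivialization 𝒢 proj)
    (v : Module.Basis (Fin N) ℝ (Coord (Fin N))) (φ : OpenPartialHomeomorph B (Coord (Fin n)))
    (y : Coord (Fin n)) : Matrix (Fin N) (Fin N) ℝ :=
  fun I J => fiberInner gM e (φ.symm y) (v I) (v J)

/-- The components `A^I_α` of the connection whose horizontal spaces are the orthogonal complements
of the fibers, so that `gM = G_{IJ} (dx^I + A^I) (dx^J + A^J) + g_{αβ} db^α db^β`
and thus `gM (∂_α, ∂_J) = G_{IJ} A^I_α`. -/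
def connA (gM : Metric (Fin n ⊕ Fin N) M) (e : Trivialization 𝒢 proj)
    (v : Module.Basis (Fin N) ℝ (Coord (Fin N))) (φ : OpenPartialHomeomorph B (Coord (Fin n)))
    (I : Fin N) (α : Fin n) (y : Coord (Fin n)) : ℝ :=
  ∑ J, (matG gM e v φ y)⁻¹ I J *
    gM.inner (localSection e (φ.symm y))
      (mfderiv 𝓘(ℝ, Coord (Fin n)) 𝓘(ℝ, Coord (Fin n ⊕ Fin N)) (localSection e) (φ.symm y)
        (coordVec φ y α))
      (vertVec e (φ.symm y) (v J))

/-- The curvature `F^I_{αβ} = ∂_α A^I_β - ∂_β A^I_α`. -/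
def curvF (gM : Metric (Fin n ⊕ Fin N) M) (e : Trivialization 𝒢 proj)
    (v : Module.Basis (Fin N) ℝ (Coord (Fin N))) (φ : OpenPartialHomeomorph B (Coord (Fin n)))
    (I : Fin N) (α β : Fin n) (y : Coord (Fin n)) : ℝ :=
  pd α (connA gM e v φ I β) y - pd β (connA gM e v φ I α) y

/-- `|F|² = g^{αγ} g^{βδ} G_{IJ} F^I_{αβ} F^J_{γδ}`. -/
def normSqF (gM : Metric (Fin n ⊕ Fin N) M) (gB : Metric (Fin n) B) (e : Trivialization 𝒢 proj)
    (v : Module.Basis (Fin N) ℝ (Coord (Fin N))) (φ : OpenPartialHomeomorph B (Coord (Fin n)))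
    (y : Coord (Fin n)) : ℝ :=
  ∑ α, ∑ β, ∑ γ, ∑ δ, ∑ I, ∑ J,
    (metricCoeff gB φ y)⁻¹ α γ * (metricCoeff gB φ y)⁻¹ β δ * matG gM e v φ y I J *
      curvF gM e v φ I α β y * curvF gM e v φ J γ δ y

/-- The left-hand side `g^{αβ} G_{IJ;αβ} - g^{αβ} G^{KL} G_{IK,α} G_{LJ,β}` of the local equation
for a harmonic map to `SL(N,ℝ)/SO(N)`. -/
def harmonicG (gM : Metric (Fin n ⊕ Fin N) M) (gB : Metric (Fin n) B) (e : Trivialization 𝒢 proj)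
    (v : Module.Basis (Fin N) ℝ (Coord (Fin N))) (φ : OpenPartialHomeomorph B (Coord (Fin n)))
    (I J : Fin N) (y : Coord (Fin n)) : ℝ :=
  (∑ α, ∑ β, (metricCoeff gB φ y)⁻¹ α β *
      hess (metricCoeff gB φ) (fun z => matG gM e v φ z I J) α β y)
    - ∑ α, ∑ β, ∑ K, ∑ L, (metricCoeff gB φ y)⁻¹ α β * (matG gM e v φ y)⁻¹ K L *
        pd α (fun z => matG gM e v φ z I K) y * pd β (fun z => matG gM e v φ z L J) y

/-- The function `det G` on `B`: the determinant of the matrix of `G` in the frame of the flat vector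
bundle that is obtained from the basis `v` of the fiber over `b₀` (written in the trivialization
`e₀`) by parallel transport to `b`. When the holonomy is in `det⁻¹(±1)`, it does not depend on the
choice of the path and of the trivialization at `b`. -/
def TwistedPrincipalBundle.detG (P : TwistedPrincipalBundle (n := n) (N := N) 𝒢 proj)
    (gM : Metric (Fin n ⊕ Fin N) M) (v : Module.Basis (Fin N) ℝ (Coord (Fin N)))
    (e₀ : Trivialization 𝒢 proj) (b₀ b : B) : ℝ :=
  Classical.epsilon fun d : ℝ =>
    ∃ (e : Trivialization 𝒢 proj) (L : Coord (Fin N) →L[ℝ] Coord (Fin N)),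
      P.Transport e₀ b₀ e b L ∧
        d = Matrix.det (Matrix.of fun I J => fiberInner gM e b (L (v I)) (L (v J)))

end Bundles

end TwistedBundle

end

open TwistedBundle

/-! The theorem is a computation of the vertical Ricci curvature followed by a trace and a Liouville
argument.

Near any point of `B` there are coordinates of `M` in which the metric is `G (dx + A)(dx + A) + g db
db` with `g`, `G`, `A` functions of the base only (`metricCoeff_adaptedChart`). The fiber
coordinates are logarithmic: an abelian Lie group has a chart at the identity in which
multiplication is addition (`exists_log_chart`). It is obtained by integrating the invariant
coframe, which is closed because invariant fields commute. In such coordinates the local actions are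
translations of `x`, so an invariant metric does not depend on `x`. A linear shear of `x` makes `A`
vanish at one chosen base point, and there the vertical Ricci tensor is (`ricci_blockMetric`) `R_IJ
= -½ g^{αβ} G_{IJ;αβ} - ¼ g^{αβ} tr(G⁻¹ ∂_α G) ∂_β G_IJ + ½ g^{αβ} (∂_α G G⁻¹ ∂_β G)_IJ + ¼ g^{αγ}
g^{βδ} (G F_{αβ})_I (G F_{γδ})_J`.

Taking the trace with `G⁻¹`, the terms in `G` add up to exactly `-△√det G / √det G`
(`coordLaplacian_sqrt_det`, `trace_inv_mul_fiberRicci`), while the left side is `λN`. This is the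
first claim. It carries over to the global function `det G` because the latter is locally a positive
constant times the determinant of the matrix of `G` (`detG_eventuallyEq`): transition maps preserve
the fiber inner product, a frame change `L` scales the determinant by `(det L)²`, and the holonomy
condition makes `|det L|` independent of the path.

If `λ ≤ 0`, then `√det G` is subharmonic, nonnegative and bounded, hence constant when `B` is
parabolic. The equation becomes `¼ |F|² = λN`, whose sides have opposite signs, so both vanish. With
`F = 0`, `λ = 0` and `tr(G⁻¹ ∂_α G) = 0`, what is left of `R_IJ = 0` is the harmonic map equation.
-/

noncomputable section

namespace TwistedBundle

set_option linter.unusedSectionVars false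

/-! ### Calculus of partial derivatives of functions and of matrix entries. -/

section PartialDerivatives

variable {ι : Type} [Fintype ι] [DecidableEq ι]

lemma pd_congr {i : ι} {u v : Coord ι → ℝ} {y : Coord ι} (h : u =ᶠ[𝓝 y] v) :
    pd i u y = pd i v y := by
  unfold pd; rw [h.fderiv_eq]

@[simp] lemma pd_const (i : ι) (c : ℝ) (y : Coord ι) : pd i (fun _ => c) y = 0 := by
  simp [pd]

lemma pd_add {i : ι} {u v : Coord ι → ℝ} {y : Coord ι} (hu : DifferentiableAt ℝ u y)
    (hv : DifferentiableAt ℝ v y) :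
    pd i (fun z => u z + v z) y = pd i u y + pd i v y := by
  simp [pd, fderiv_fun_add hu hv]

lemma pd_mul {i : ι} {u v : Coord ι → ℝ} {y : Coord ι} (hu : DifferentiableAt ℝ u y)
    (hv : DifferentiableAt ℝ v y) :
    pd i (fun z => u z * v z) y = pd i u y * v y + u y * pd i v y := by
  simp [pd, fderiv_fun_mul hu hv]; ring

lemma pd_const_mul {i : ι} {u : Coord ι → ℝ} {y : Coord ι} (c : ℝ) (hu : DifferentiableAt ℝ u y) :
    pd i (fun z => c * u z) y = c * pd i u y := by
  simp [pd, fderiv_const_mul hu]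

lemma pd_sum {i : ι} {κ : Type*} {s : Finset κ} {u : κ → Coord ι → ℝ} {y : Coord ι}
    (hu : ∀ k ∈ s, DifferentiableAt ℝ (u k) y) :
    pd i (fun z => ∑ k ∈ s, u k z) y = ∑ k ∈ s, pd i (u k) y := by
  simp [pd, fderiv_fun_sum hu]

lemma contDiffAt_pd {i : ι} {u : Coord ι → ℝ} {y : Coord ι} (hu : ContDiffAt ℝ ∞ u y) :
    ContDiffAt ℝ ∞ (pd i u) y :=
  (hu.fderiv_right (m := ∞) le_rfl).clm_apply contDiffAt_const

/-- Entrywise smoothness of a matrix valued function. -/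
def SmoothMatAt {a b : Type*} (A : Coord ι → Matrix a b ℝ) (y : Coord ι) : Prop :=
  ∀ i j, ContDiffAt ℝ ∞ (fun z => A z i j) y

/-- The entrywise partial derivative of a matrix valued function. -/
def pdMat {a b : Type*} (k : ι) (A : Coord ι → Matrix a b ℝ) (y : Coord ι) : Matrix a b ℝ :=
  Matrix.of fun i j => pd k (fun z => A z i j) y

lemma SmoothMatAt.differentiableAt {a b : Type*} {A : Coord ι → Matrix a b ℝ} {y : Coord ι}
    (hA : SmoothMatAt A y) (i : a) (j : b) : DifferentiableAt ℝ (fun z => A z i j) y :=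
  (hA i j).differentiableAt (by simp)

lemma SmoothMatAt.congr {a b : Type*} {A A' : Coord ι → Matrix a b ℝ} {y : Coord ι}
    (hA : SmoothMatAt A y) (h : A' =ᶠ[𝓝 y] A) : SmoothMatAt A' y :=
  fun i j => (hA i j).congr_of_eventuallyEq (h.mono fun z hz => by simp only [hz])

lemma SmoothMatAt.mul {a b c : Type*} [Fintype b] {A : Coord ι → Matrix a b ℝ}
    {A' : Coord ι → Matrix b c ℝ} {y : Coord ι} (hA : SmoothMatAt A y) (hA' : SmoothMatAt A' y) :
    SmoothMatAt (fun z => A z * A' z) y := fun i j => by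
  simp only [Matrix.mul_apply]
  exact ContDiffAt.sum fun k _ => (hA i k).mul (hA' k j)

lemma SmoothMatAt.transpose {a b : Type*} {A : Coord ι → Matrix a b ℝ} {y : Coord ι}
    (hA : SmoothMatAt A y) : SmoothMatAt (fun z => (A z).transpose) y := fun i j => hA j i

lemma SmoothMatAt.pdMat {a b : Type*} {A : Coord ι → Matrix a b ℝ} {y : Coord ι} (k : ι)
    (hA : SmoothMatAt A y) : SmoothMatAt (pdMat k A) y := fun i j => contDiffAt_pd (hA i j)

lemma SmoothMatAt.det {a : Type*} [Fintype a] [DecidableEq a] {A : Coord ι → Matrix a a ℝ}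
    {y : Coord ι} (hA : SmoothMatAt A y) : ContDiffAt ℝ ∞ (fun z => (A z).det) y := by
  simp only [Matrix.det_apply]
  exact ContDiffAt.sum fun σ _ => (contDiffAt_prod fun i _ => hA _ _).const_smul _

lemma SmoothMatAt.inv {a : Type*} [Fintype a] [DecidableEq a] {A : Coord ι → Matrix a a ℝ}
    {y : Coord ι} (hA : SmoothMatAt A y) (h : (A y).det ≠ 0) :
    SmoothMatAt (fun z => (A z)⁻¹) y := fun i j => by
  simp only [Matrix.inv_def, Ring.inverse_eq_inv', Matrix.smul_apply, smul_eq_mul,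
    Matrix.adjugate_apply]
  refine ContDiffAt.mul (hA.det.inv h) (SmoothMatAt.det fun k l => ?_)
  by_cases hk : k = j
  · subst hk; simpa using contDiffAt_const
  · simpa [Matrix.updateRow_ne hk] using hA k l

lemma pdMat_congr {a b : Type*} {A A' : Coord ι → Matrix a b ℝ} {y : Coord ι} {k : ι}
    (h : A =ᶠ[𝓝 y] A') : pdMat k A y = pdMat k A' y := by
  ext i j
  exact pd_congr (h.mono fun z hz => by simp only [hz])

lemma pdMat_mul {a b c : Type*} [Fintype b] {A : Coord ι → Matrix a b ℝ}
    {A' : Coord ι → Matrix b c ℝ} {y : Coord ι} {k : ι} (hA : SmoothMatAt A y)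
    (hA' : SmoothMatAt A' y) :
    pdMat k (fun z => A z * A' z) y = pdMat k A y * A' y + A y * pdMat k A' y := by
  ext i j
  simp only [pdMat, Matrix.mul_apply, Matrix.of_apply, Matrix.add_apply]
  rw [pd_sum fun l _ => DifferentiableAt.fun_mul (hA.differentiableAt i l) (hA'.differentiableAt l j),
    ← Finset.sum_add_distrib]
  exact Finset.sum_congr rfl fun l _ => pd_mul (hA.differentiableAt i l) (hA'.differentiableAt l j)

/-- Obtained by differentiating `A * A⁻¹ = 1`, which holds on a neighbourhood because the
determinant stays nonzero there. -/
lemma pdMat_inv {a : Type*} [Fintype a] [DecidableEq a] {A : Coord ι → Matrix a a ℝ}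
    {y : Coord ι} {k : ι} (hA : SmoothMatAt A y) (h : (A y).det ≠ 0) :
    pdMat k (fun z => (A z)⁻¹) y = -((A y)⁻¹ * pdMat k A y * (A y)⁻¹) := by
  have hu : IsUnit (A y).det := isUnit_iff_ne_zero.2 h
  have h1 : pdMat k (fun z => A z * (A z)⁻¹) y = 0 := by
    have : (fun z => A z * (A z)⁻¹) =ᶠ[𝓝 y] fun _ => 1 := by
      filter_upwards [hA.det.continuousAt.eventually_ne h] with z hz
      exact Matrix.mul_nonsing_inv _ (isUnit_iff_ne_zero.2 hz)
    rw [pdMat_congr this]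
    ext i j
    simp [pdMat]
  rw [pdMat_mul hA (hA.inv h)] at h1
  have h2 := congrArg (fun X => (A y)⁻¹ * X) h1
  simp only [Matrix.mul_add, ← Matrix.mul_assoc, Matrix.nonsing_inv_mul _ hu, Matrix.one_mul,
    Matrix.mul_zero] at h2
  rw [eq_neg_iff_add_eq_zero, add_comm]
  exact h2

/-- Jacobi's formula. The determinant is multilinear in the rows, so its derivative is a sum of
determinants with one row replaced by its derivative; Cramer's rule turns each of them into a
pairing with a row of the adjugate. -/
lemma pd_det {a : Type*} [Fintype a] [DecidableEq a] {A : Coord ι → Matrix a a ℝ}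
    {y : Coord ι} {k : ι} (hA : SmoothMatAt A y) (h : (A y).det ≠ 0) :
    pd k (fun z => (A z).det) y = (A y).det * ((A y)⁻¹ * pdMat k A y).trace := by
  let f : ContinuousMultilinearMap ℝ (fun _ : a => a → ℝ) ℝ :=
    { toMultilinearMap := (Matrix.detRowAlternating : (a → ℝ) [⋀^a]→ₗ[ℝ] ℝ).toMultilinearMap
      cont := Continuous.matrix_det continuous_id }
  have hA' : ∀ i, HasFDerivAt (fun z => A z i) (fderiv ℝ (fun z => A z i) y) y := fun i =>
    (differentiableAt_pi.2 fun j => hA.differentiableAt i j).hasFDerivAt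
  have h1 := (HasFDerivAt.multilinear_comp f hA').fderiv
  have h2 : pd k (fun z => (A z).det) y = pd k (fun z => f fun i => A z i) y := rfl
  have h3 : (A y)⁻¹ = ((A y).det)⁻¹ • (A y).adjugate := by
    rw [Matrix.inv_def, Ring.inverse_eq_inv']
  rw [h2, pd, h1, h3, Matrix.smul_mul, Matrix.trace_smul, smul_eq_mul, mul_inv_cancel_left₀ h,
    Matrix.trace_mul_comm]
  simp only [sum_apply, ContinuousLinearMap.comp_apply, Matrix.trace,
    Matrix.diag_apply]
  refine Finset.sum_congr rfl fun i _ => ?_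
  have h4 : ∀ b : a → ℝ, f.toContinuousLinearMap (fun j => A y j) i b = ((A y).updateRow i b).det :=
    fun b => rfl
  rw [h4, ← Matrix.cramer_transpose_apply, Matrix.cramer_eq_adjugate_mulVec, Matrix.mulVec,
    dotProduct, Matrix.mul_apply]
  refine Finset.sum_congr rfl fun j _ => ?_
  rw [← Matrix.adjugate_transpose, mul_comm, Matrix.transpose_apply]
  congr 1
  simp only [pdMat, pd, Matrix.of_apply]
  have h5 := (hasFDerivAt_pi'.1 (hA' i) j).fderiv
  exact (congrArg (fun l => l (EuclideanSpace.single k (1 : ℝ))) h5).symm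

end PartialDerivatives

/-! ### The Laplacian of the square root of a determinant. -/

section Laplacian

variable {ι : Type} [Fintype ι] [DecidableEq ι]
variable {κ : Type} [Fintype κ] [DecidableEq κ]

/-- The second covariant derivatives of the entries of a matrix valued function. -/
def hessMat (g : Coord ι → Matrix ι ι ℝ) (A : Coord ι → Matrix κ κ ℝ) (i j : ι) (y : Coord ι) :
    Matrix κ κ ℝ :=
  pdMat i (pdMat j A) y - ∑ k, christoffel g k i j y • pdMat k A y

lemma hessMat_apply (g : Coord ι → Matrix ι ι ℝ) (A : Coord ι → Matrix κ κ ℝ) (i j : ι)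
    (y : Coord ι) (I J : κ) :
    hessMat g A i j y I J = hess g (fun z => A z I J) i j y := by
  simp only [hessMat, hess, Matrix.sub_apply, Matrix.sum_apply, Matrix.smul_apply, smul_eq_mul]
  rfl

lemma pd_trace {A : Coord ι → Matrix κ κ ℝ} {y : Coord ι} {k : ι} (hA : SmoothMatAt A y) :
    pd k (fun z => (A z).trace) y = (pdMat k A y).trace := by
  simp only [Matrix.trace, Matrix.diag_apply]
  rw [pd_sum fun l _ => hA.differentiableAt l l]
  rfl

lemma pd_sqrt {u : Coord ι → ℝ} {y : Coord ι} {k : ι} (hu : DifferentiableAt ℝ u y)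
    (h : u y ≠ 0) : pd k (fun z => √(u z)) y = pd k u y / (2 * √(u y)) := by
  unfold pd
  rw [fderiv_sqrt hu h]
  simp; ring

/-- The Laplacian of `√det G`. -/
lemma coordLaplacian_sqrt_det (g : Coord ι → Matrix ι ι ℝ) {G : Coord ι → Matrix κ κ ℝ}
    {f : Coord ι → ℝ} {y : Coord ι} {c : ℝ} (hc : 0 < c) (hG : ∀ᶠ z in 𝓝 y, SmoothMatAt G z)
    (hdet : 0 < (G y).det) (hf : ∀ᶠ z in 𝓝 y, f z = √(c * (G z).det)) :
    coordLaplacian g f y = f y *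
      ((1 / 4) * (∑ i, ∑ j, (g y)⁻¹ i j *
          (((G y)⁻¹ * pdMat i G y).trace * ((G y)⁻¹ * pdMat j G y).trace))
        - (1 / 2) * (∑ i, ∑ j, (g y)⁻¹ i j *
          ((G y)⁻¹ * (pdMat i G y * (G y)⁻¹ * pdMat j G y)).trace)
        + (1 / 2) * ∑ i, ∑ j, (g y)⁻¹ i j * ((G y)⁻¹ * hessMat g G i j y).trace) := by
  have hGy := hG.self_of_nhds
  have hpos : ∀ᶠ z in 𝓝 y, 0 < (G z).det := hGy.det.continuousAt.eventually_const_lt hdet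
  -- Jacobi's formula gives half the trace as logarithmic derivative of `√(c det G)`; the constant
  -- `c` drops out. The identity is needed near `y` and not only at `y`, since it is differentiated
  -- once more.
  have hf1 : ∀ᶠ z in 𝓝 y, ∀ j, pd j f z = (1 / 2) * (f z * ((G z)⁻¹ * pdMat j G z).trace) := by
    filter_upwards [hG, hpos, hf.eventually_nhds] with z h1 h2 h3 j
    rw [pd_congr (v := fun z => √(c * (G z).det)) h3, h3.self_of_nhds,
      pd_sqrt ((h1.det.differentiableAt (by simp)).const_mul c) (by positivity),
      pd_const_mul _ (h1.det.differentiableAt (by simp)), pd_det h1 h2.ne']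
    have h4 : √(c * (G z).det) * √(c * (G z).det) = c * (G z).det :=
      Real.mul_self_sqrt (by positivity)
    have h5 : 0 < √(c * (G z).det) := Real.sqrt_pos.2 (by positivity)
    rw [div_eq_iff (by positivity)]
    linear_combination -(((G z)⁻¹ * pdMat j G z).trace) * h4
  have hfd : DifferentiableAt ℝ f y := by
    refine DifferentiableAt.congr_of_eventuallyEq ?_ hf
    exact ((hGy.det.differentiableAt (by simp)).const_mul c).sqrt (by positivity)
  have hinv := hGy.inv hdet.ne'
  -- The derivative of `G⁻¹` produces the term quadratic in the first derivatives of `G`.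
  have htr : ∀ i j, pd i (fun z => ((G z)⁻¹ * pdMat j G z).trace) y =
      -((G y)⁻¹ * (pdMat i G y * (G y)⁻¹ * pdMat j G y)).trace
        + ((G y)⁻¹ * pdMat i (pdMat j G) y).trace := by
    intro i j
    rw [pd_trace (hinv.mul (hGy.pdMat j)), pdMat_mul hinv (hGy.pdMat j), pdMat_inv hGy hdet.ne',
      Matrix.trace_add, Matrix.neg_mul, Matrix.trace_neg]
    simp only [Matrix.mul_assoc]
  have hhess : ∀ i j, hess g f i j y = f y *
      ((1 / 4) * (((G y)⁻¹ * pdMat i G y).trace * ((G y)⁻¹ * pdMat j G y).trace)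
      - (1 / 2) * ((G y)⁻¹ * (pdMat i G y * (G y)⁻¹ * pdMat j G y)).trace
      + (1 / 2) * ((G y)⁻¹ * hessMat g G i j y).trace) := by
    intro i j
    have h1 : pd i (pd j f) y = pd i (fun z => (1 / 2) * (f z * ((G z)⁻¹ * pdMat j G z).trace)) y :=
      pd_congr (hf1.mono fun z hz => hz j)
    have hd : DifferentiableAt ℝ (fun z => ((G z)⁻¹ * pdMat j G z).trace) y := by
      simp only [Matrix.trace, Matrix.diag_apply]
      exact DifferentiableAt.fun_sum fun l _ => (hinv.mul (hGy.pdMat j)).differentiableAt l l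
    rw [hess, h1, pd_const_mul _ (hfd.fun_mul hd), pd_mul hfd hd, htr, hf1.self_of_nhds i]
    simp only [hessMat, Matrix.mul_sub, Matrix.mul_sum, Matrix.mul_smul, Matrix.trace_sub,
      Matrix.trace_sum, Matrix.trace_smul, smul_eq_mul, hf1.self_of_nhds]
    have h2 : ∑ k, christoffel g k i j y * (1 / 2 * (f y * ((G y)⁻¹ * pdMat k G y).trace)) =
        (1 / 2) * f y * ∑ k, christoffel g k i j y * ((G y)⁻¹ * pdMat k G y).trace := by
      rw [Finset.mul_sum]
      exact Finset.sum_congr rfl fun k _ => by ring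
    rw [h2]
    ring
  simp only [coordLaplacian, hhess]
  simp only [Finset.mul_sum, ← Finset.sum_add_distrib, ← Finset.sum_sub_distrib]
  exact Finset.sum_congr rfl fun i _ => Finset.sum_congr rfl fun j _ => by ring

end Laplacian

/-! ### Functions of all coordinates that depend only on the base coordinates. -/

section BaseProjection

variable {ι : Type} [Fintype ι] [DecidableEq ι]
variable {κ : Type} [Fintype κ] [DecidableEq κ]

variable (ι κ) in
/-- The projection to the coordinates of the base. -/
def baseProj : Coord (ι ⊕ κ) →L[ℝ] Coord ι :=
  LinearMap.toContinuousLinearMap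
    { toFun := fun z => WithLp.toLp 2 fun α => z (Sum.inl α)
      map_add' := fun _ _ => rfl
      map_smul' := fun _ _ => rfl }

variable (ι κ) in
/-- The inclusion of the coordinates of the base. -/
def baseIncl : Coord ι →L[ℝ] Coord (ι ⊕ κ) :=
  LinearMap.toContinuousLinearMap
    { toFun := fun y => WithLp.toLp 2 (Sum.elim (fun α => y α) fun _ => 0)
      map_add' := fun _ _ => by ext k; cases k <;> simp
      map_smul' := fun _ _ => by ext k; cases k <;> simp }

@[simp] lemma baseProj_apply (z : Coord (ι ⊕ κ)) (α : ι) : baseProj ι κ z α = z (Sum.inl α) := rfl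

@[simp] lemma baseProj_baseIncl (y : Coord ι) : baseProj ι κ (baseIncl ι κ y) = y := rfl

lemma baseProj_single_inl (α : ι) :
    baseProj ι κ (EuclideanSpace.single (Sum.inl α) (1 : ℝ)) = EuclideanSpace.single α 1 := by
  ext β; simp

lemma baseProj_single_inr (I : κ) :
    baseProj ι κ (EuclideanSpace.single (Sum.inr I) (1 : ℝ)) = 0 := by
  ext β; simp

/-- Partial derivatives of a function of the base, with respect to all coordinates. -/
def pdBase (k : ι ⊕ κ) (U : Coord ι → ℝ) (y : Coord ι) : ℝ :=
  Sum.elim (fun α => pd α U y) (fun _ => 0) k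

lemma pd_comp_baseProj (k : ι ⊕ κ) (U : Coord ι → ℝ) (z : Coord (ι ⊕ κ)) :
    pd k (fun z => U (baseProj ι κ z)) z = pdBase k U (baseProj ι κ z) := by
  by_cases hU : DifferentiableAt ℝ U (baseProj ι κ z)
  · have h : fderiv ℝ (fun z => U (baseProj ι κ z)) z =
        (fderiv ℝ U (baseProj ι κ z)).comp (baseProj ι κ) :=
      (hU.hasFDerivAt.comp z (baseProj ι κ).hasFDerivAt).fderiv
    rw [pd, h, ContinuousLinearMap.comp_apply]
    cases k with
    | inl α => rw [baseProj_single_inl]; rfl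
    | inr I => rw [baseProj_single_inr, map_zero]; rfl
  -- No differentiability of `U` is assumed. If the composite were differentiable, restricting it to
  -- an affine slice through `z` parallel to the base would make `U` differentiable; so otherwise
  -- both derivatives take the default value `0`.
  · have hU' : ¬ DifferentiableAt ℝ (fun z => U (baseProj ι κ z)) z := by
      intro h
      refine hU ?_
      have h1 : DifferentiableAt ℝ (fun y => z + baseIncl ι κ (y - baseProj ι κ z))
          (baseProj ι κ z) :=
        ((baseIncl ι κ).differentiableAt.comp _ (differentiableAt_id.sub_const _)).const_add _
      have h2 : DifferentiableAt ℝ (fun z => U (baseProj ι κ z))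
          (z + baseIncl ι κ (baseProj ι κ z - baseProj ι κ z)) := by simpa using h
      have h3 := DifferentiableAt.comp (baseProj ι κ z) h2 h1
      refine h3.congr_of_eventuallyEq (Eventually.of_forall fun y => ?_)
      simp
    rw [pd, fderiv_zero_of_not_differentiableAt hU']
    cases k with
    | inl α => simp [pdBase, pd, fderiv_zero_of_not_differentiableAt hU]
    | inr I => rfl

end BaseProjection

/-! ### Christoffel symbols and Ricci tensor of a metric that is constant along the fibers. -/

section RicciOfFibers

variable {ι : Type} [Fintype ι] [DecidableEq ι]
variable {κ : Type} [Fintype κ] [DecidableEq κ]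

/-- The Christoffel symbols of a metric that only depends on the base coordinates. -/
def christoffelBase (H : Coord ι → Matrix (ι ⊕ κ) (ι ⊕ κ) ℝ) (k i j : ι ⊕ κ) (y : Coord ι) : ℝ :=
  (1 / 2) * ∑ l, (H y)⁻¹ k l *
    (pdBase i (fun z => H z j l) y + pdBase j (fun z => H z i l) y - pdBase l (fun z => H z i j) y)

/-- Equality near the point, rather than at it, is what the Ricci tensor needs, because it
differentiates the Christoffel symbols. -/
lemma christoffel_eventuallyEq {h : Coord (ι ⊕ κ) → Matrix (ι ⊕ κ) (ι ⊕ κ) ℝ}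
    {H : Coord ι → Matrix (ι ⊕ κ) (ι ⊕ κ) ℝ} {z₀ : Coord (ι ⊕ κ)}
    (hh : ∀ᶠ z in 𝓝 z₀, h z = H (baseProj ι κ z)) (k i j : ι ⊕ κ) :
    christoffel h k i j =ᶠ[𝓝 z₀] fun z => christoffelBase H k i j (baseProj ι κ z) := by
  filter_upwards [hh.eventually_nhds] with z hz
  have hpd : ∀ l a b, pd l (fun z => h z a b) z = pdBase l (fun y => H y a b) (baseProj ι κ z) := by
    intro l a b
    rw [← pd_comp_baseProj]
    exact pd_congr (hz.mono fun w hw => by simp only [hw])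
  simp only [christoffel, christoffelBase, hpd, hz.self_of_nhds]

lemma ricci_eq_base {h : Coord (ι ⊕ κ) → Matrix (ι ⊕ κ) (ι ⊕ κ) ℝ}
    {H : Coord ι → Matrix (ι ⊕ κ) (ι ⊕ κ) ℝ} {z₀ : Coord (ι ⊕ κ)} {y : Coord ι}
    (hh : ∀ᶠ z in 𝓝 z₀, h z = H (baseProj ι κ z)) (hy : baseProj ι κ z₀ = y) (i j : ι ⊕ κ) :
    ricci h i j z₀ = (∑ k, pdBase k (christoffelBase H k i j) y)
      - (∑ k, pdBase j (christoffelBase H k i k) y)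
      + (∑ k, ∑ l, christoffelBase H k k l y * christoffelBase H l i j y)
      - ∑ k, ∑ l, christoffelBase H k j l y * christoffelBase H l i k y := by
  have h1 : ∀ k i j, christoffel h k i j z₀ = christoffelBase H k i j y := fun k i j => by
    subst hy; exact (christoffel_eventuallyEq hh k i j).self_of_nhds
  have h2 : ∀ l k i j, pd l (christoffel h k i j) z₀ = pdBase l (christoffelBase H k i j) y :=
    fun l k i j => by rw [pd_congr (christoffel_eventuallyEq hh k i j), pd_comp_baseProj, hy]
  simp only [ricci, h1, h2]

/-- The matrix of the metric `G (dx + A) (dx + A) + g db db`. -/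
def blockMetric (g : Matrix ι ι ℝ) (G : Matrix κ κ ℝ) (A : Matrix κ ι ℝ) :
    Matrix (ι ⊕ κ) (ι ⊕ κ) ℝ :=
  Matrix.fromBlocks (g + A.transpose * G * A) (A.transpose * G) (G * A) G

/-- The matrix is congruent to `diag(g, G)` by the shear `dx ↦ dx + A`, which predicts the inverse;
multiplication confirms it. Its base block is `g⁻¹` whatever `A` is, a fact used at points where `A`
is not zero. -/
lemma inv_blockMetric {g : Matrix ι ι ℝ} {G : Matrix κ κ ℝ} (A : Matrix κ ι ℝ)
    (hg : g.det ≠ 0) (hG : G.det ≠ 0) :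
    (blockMetric g G A)⁻¹ = Matrix.fromBlocks g⁻¹ (-(g⁻¹ * A.transpose)) (-(A * g⁻¹))
      (G⁻¹ + A * g⁻¹ * A.transpose) := by
  have hg' := isUnit_iff_ne_zero.2 hg
  have hG' := isUnit_iff_ne_zero.2 hG
  refine Matrix.inv_eq_right_inv ?_
  rw [blockMetric, Matrix.fromBlocks_multiply, ← Matrix.fromBlocks_one]
  congr 1
  · rw [Matrix.add_mul, Matrix.mul_nonsing_inv _ hg']
    simp only [Matrix.mul_neg, Matrix.mul_assoc]
    abel
  · rw [Matrix.mul_add, Matrix.mul_neg, Matrix.add_mul, ← Matrix.mul_assoc g,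
      Matrix.mul_nonsing_inv _ hg', Matrix.mul_assoc _ G G⁻¹, Matrix.mul_nonsing_inv _ hG']
    simp only [Matrix.mul_assoc, Matrix.mul_one, Matrix.one_mul]
    abel
  · simp [Matrix.mul_assoc]
  · rw [Matrix.mul_add, Matrix.mul_nonsing_inv _ hG']
    simp only [Matrix.mul_neg, Matrix.mul_assoc]
    abel

/-- Both sides are contractions of first derivatives of `g` with `g⁻¹` and with `v = g⁻¹ u`, and
they agree by the symmetry of `g`. The identity assembles a covariant Laplacian: with `u` the
gradient of an entry of `G`, the left side is what the Ricci tensor produces and the right side is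
the Christoffel term of `g^{αβ} G_{IJ;αβ}`. -/
lemma contracted_christoffel {g : Coord ι → Matrix ι ι ℝ} {y : Coord ι} (hg : SmoothMatAt g y)
    (hsymm : ∀ᶠ z in 𝓝 y, (g z).transpose = g z) (hdet : (g y).det ≠ 0) (u : ι → ℝ) :
    (∑ γ, ∑ δ, pdMat γ (fun z => (g z)⁻¹) y γ δ * u δ)
      + (∑ δ, (∑ γ, christoffel g γ γ δ y) * ∑ ε, (g y)⁻¹ δ ε * u ε)
    = -∑ α, ∑ β, (g y)⁻¹ α β * ∑ k, christoffel g k α β y * u k := by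
  set gi := (g y)⁻¹ with hgi
  have hgis : ∀ a b, gi a b = gi b a := fun a b => by
    have : gi.transpose = gi := by
      rw [hgi, Matrix.transpose_nonsing_inv, hsymm.self_of_nhds]
    exact congrFun (congrFun this b) a
  set d : ι → ι → ι → ℝ := fun c a b => pd c (fun z => g z a b) y with hd
  have hds : ∀ c a b, d c a b = d c b a := fun c a b =>
    pd_congr (hsymm.mono fun z hz => congrFun (congrFun hz b) a)
  set v : ι → ℝ := fun b => ∑ ε, gi b ε * u ε with hv
  have h1 : (∑ γ, ∑ δ, pdMat γ (fun z => (g z)⁻¹) y γ δ * u δ) =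
      ∑ a, ∑ b, ∑ c, -(gi a b * d a b c * v c) := by
    refine Finset.sum_congr rfl fun a _ => ?_
    rw [pdMat_inv hg hdet]
    simp only [Matrix.neg_apply, Matrix.mul_apply, Finset.sum_mul, hv, neg_mul, Finset.mul_sum,
      Finset.sum_neg_distrib]
    congr 1
    rw [Finset.sum_comm]
    rw [Finset.sum_comm]
    rw [Finset.sum_congr rfl fun δ _ => Finset.sum_comm]
    rw [Finset.sum_comm]
    refine Finset.sum_congr rfl fun b _ => ?_
    rw [Finset.sum_comm]
    refine Finset.sum_congr rfl fun c _ => Finset.sum_congr rfl fun δ _ => ?_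
    simp only [pdMat, Matrix.of_apply, hd, hgi]
    ring
  have hΓ : ∀ k i j, christoffel g k i j y =
      (1 / 2) * ∑ l, gi k l * (d i j l + d j i l - d l i j) := fun k i j => rfl
  have h2 : (∑ δ, (∑ γ, christoffel g γ γ δ y) * ∑ ε, (g y)⁻¹ δ ε * u ε) =
      ∑ a, ∑ b, ∑ c, (1 / 2) * (gi a b * d c a b * v c) := by
    have h3 : ∀ δ, (∑ γ, christoffel g γ γ δ y) = ∑ a, ∑ b, (1 / 2) * (gi a b * d δ a b) := by
      intro δ
      -- Two of the three derivative terms in the trace `Γ^γ_{γδ}` cancel by symmetry.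
      have h4 : ∑ a, ∑ b, (1 / 2) * (gi a b * d a δ b) = ∑ a, ∑ b, (1 / 2) * (gi a b * d b a δ) := by
        rw [Finset.sum_comm]
        refine Finset.sum_congr rfl fun a _ => Finset.sum_congr rfl fun b _ => ?_
        rw [hgis, hds]
      calc (∑ γ, christoffel g γ γ δ y) = ∑ a, ∑ b, ((1 / 2) * (gi a b * d a δ b)
            + (1 / 2) * (gi a b * d δ a b) - (1 / 2) * (gi a b * d b a δ)) := by
            refine Finset.sum_congr rfl fun a _ => ?_
            rw [hΓ, Finset.mul_sum]
            exact Finset.sum_congr rfl fun b _ => by ring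
        _ = _ := by
            simp only [Finset.sum_add_distrib, Finset.sum_sub_distrib]
            rw [h4]; ring
    simp only [h3, Finset.sum_mul]
    rw [Finset.sum_comm]
    refine Finset.sum_congr rfl fun a _ => ?_
    rw [Finset.sum_comm]
    refine Finset.sum_congr rfl fun b _ => Finset.sum_congr rfl fun c _ => ?_
    simp only [hv, ← hgi]; ring
  have h5 : ∑ α, ∑ β, gi α β * ∑ k, christoffel g k α β y * u k =
      ∑ a, ∑ b, ∑ c, (1 / 2) * (gi a b * (d a b c + d b a c - d c a b) * v c) := by
    refine Finset.sum_congr rfl fun a _ => Finset.sum_congr rfl fun b _ => ?_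
    simp only [hΓ, hv, Finset.mul_sum, Finset.sum_mul]
    rw [Finset.sum_comm]
    refine Finset.sum_congr rfl fun c _ => Finset.sum_congr rfl fun k _ => ?_
    rw [hgis k c]; ring
  have h6 : ∑ a, ∑ b, ∑ c, gi a b * d a b c * v c = ∑ a, ∑ b, ∑ c, gi a b * d b a c * v c := by
    rw [Finset.sum_comm]
    refine Finset.sum_congr rfl fun a _ => Finset.sum_congr rfl fun b _ =>
      Finset.sum_congr rfl fun c _ => ?_
    rw [hgis]
  have h7 : ∑ a, ∑ b, ∑ c, (1 / 2) * (gi a b * (d a b c + d b a c - d c a b) * v c) =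
      (1 / 2) * ((∑ a, ∑ b, ∑ c, gi a b * d a b c * v c) + (∑ a, ∑ b, ∑ c, gi a b * d b a c * v c)
        - ∑ a, ∑ b, ∑ c, gi a b * d c a b * v c) := by
    simp only [← Finset.sum_add_distrib, ← Finset.sum_sub_distrib, Finset.mul_sum]
    refine Finset.sum_congr rfl fun a _ => Finset.sum_congr rfl fun b _ =>
      Finset.sum_congr rfl fun c _ => ?_
    ring
  rw [h1, h2, h5, h7, ← h6]
  simp only [Finset.sum_neg_distrib, ← Finset.mul_sum]
  ring

end RicciOfFibers

/-! ### The vertical Ricci tensor of the block metric. -/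

section RicciOfFibers

variable {ι : Type} [Fintype ι] [DecidableEq ι]
variable {κ : Type} [Fintype κ] [DecidableEq κ]

lemma mul_sum_mul_mul_sum {α β : Type*} [Fintype α] [Fintype β] (a b : ℝ) (f : α → ℝ)
    (g : β → ℝ) : (a * ∑ i, f i) * (b * ∑ j, g j) = ∑ j, ∑ i, a * b * (f i * g j) := by
  rw [mul_mul_mul_comm, Finset.sum_mul_sum, Finset.sum_comm]
  simp only [Finset.mul_sum]

lemma sum_comm_three {α β γ : Type*} [Fintype α] [Fintype β] [Fintype γ] (f : α → β → γ → ℝ) :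
    ∑ a, ∑ b, ∑ c, f a b c = ∑ b, ∑ c, ∑ a, f a b c := by
  rw [Finset.sum_comm]
  exact Finset.sum_congr rfl fun _ _ => Finset.sum_comm

/-- The curvature `∂_α A_β - ∂_β A_α`. -/
def curvature (A : Coord ι → Matrix κ ι ℝ) (α β : ι) (y : Coord ι) : κ → ℝ :=
  fun K => pdMat α A y K β - pdMat β A y K α

/-- The Ricci tensor of the metric `G (dx + A) (dx + A) + g db db` on the fiber directions, when
`F = dA`. -/
def fiberRicci (g : Coord ι → Matrix ι ι ℝ) (G : Coord ι → Matrix κ κ ℝ) (F : ι → ι → κ → ℝ)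
    (y : Coord ι) : Matrix κ κ ℝ :=
  -((1 / 2 : ℝ) • ∑ α, ∑ β, (g y)⁻¹ α β • hessMat g G α β y)
    - (1 / 4 : ℝ) • (∑ α, ∑ β, ((g y)⁻¹ α β * ((G y)⁻¹ * pdMat α G y).trace) • pdMat β G y)
    + (1 / 2 : ℝ) • (∑ α, ∑ β, (g y)⁻¹ α β • (pdMat α G y * (G y)⁻¹ * pdMat β G y))
    + (1 / 4 : ℝ) • ∑ α, ∑ β, ∑ γ, ∑ δ, ((g y)⁻¹ α γ * (g y)⁻¹ β δ) •
        Matrix.vecMulVec ((G y).mulVec (F α β)) ((G y).mulVec (F γ δ))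

/-- Since `A` vanishes at `y`, the inverse metric is block diagonal there and derivatives of `A`
enter the Christoffel symbols that are needed only through the curvature. Fiber derivatives are
zero, so the second term of the Ricci tensor disappears and the only symbols that get differentiated
are those with two fiber indices below and a base index above. These alone have to be known in a
neighbourhood of `y`; for the others their values at `y` suffice. -/
theorem ricci_blockMetric {h : Coord (ι ⊕ κ) → Matrix (ι ⊕ κ) (ι ⊕ κ) ℝ}
    {g : Coord ι → Matrix ι ι ℝ} {G : Coord ι → Matrix κ κ ℝ} {A : Coord ι → Matrix κ ι ℝ}
    {z₀ : Coord (ι ⊕ κ)} {y : Coord ι} (hy : baseProj ι κ z₀ = y)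
    (hh : ∀ᶠ z in 𝓝 z₀, h z =
      blockMetric (g (baseProj ι κ z)) (G (baseProj ι κ z)) (A (baseProj ι κ z)))
    (hg : SmoothMatAt g y) (hG : SmoothMatAt G y) (hA : SmoothMatAt A y)
    (hgs : ∀ᶠ z in 𝓝 y, (g z).transpose = g z) (hGs : ∀ᶠ z in 𝓝 y, (G z).transpose = G z)
    (hgd : (g y).det ≠ 0) (hGd : (G y).det ≠ 0) (hA0 : A y = 0) (I J : κ) :
    ricci h (Sum.inr I) (Sum.inr J) z₀ = fiberRicci g G (fun α β => curvature A α β y) y I J := by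
  set H : Coord ι → Matrix (ι ⊕ κ) (ι ⊕ κ) ℝ := fun z => blockMetric (g z) (G z) (A z) with hH
  set gi := (g y)⁻¹ with hgi
  set Gi := (G y)⁻¹ with hGi
  have hgis : ∀ a b, gi a b = gi b a := fun a b => by
    have : gi.transpose = gi := by
      rw [hgi, Matrix.transpose_nonsing_inv, hgs.self_of_nhds]
    exact congrFun (congrFun this b) a
  have hGis : ∀ a b, Gi a b = Gi b a := fun a b => by
    have : Gi.transpose = Gi := by
      rw [hGi, Matrix.transpose_nonsing_inv, hGs.self_of_nhds]
    exact congrFun (congrFun this b) a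
  have hdGs : ∀ α a b, pdMat α G y a b = pdMat α G y b a := fun α a b =>
    pd_congr (hGs.mono fun z hz => congrFun (congrFun hz b) a)
  have hGys : ∀ a b, G y a b = G y b a := fun a b => congrFun (congrFun hGs.self_of_nhds b) a
  have hHi : (H y)⁻¹ = Matrix.fromBlocks gi 0 0 Gi := by
    rw [hH, inv_blockMetric _ hgd hGd, hA0]; simp [hgi, hGi]
  -- derivatives of the entries
  have d_mix : ∀ γ a β, pd γ (fun z => H z (Sum.inr a) (Sum.inl β)) y
      = (G y * pdMat γ A y) a β := fun γ a β => by
    have h1 : pd γ (fun z => H z (Sum.inr a) (Sum.inl β)) y = pdMat γ (fun z => G z * A z) y a β :=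
      rfl
    rw [h1, pdMat_mul hG hA, hA0, Matrix.mul_zero, zero_add]
  have d_mix' : ∀ γ a β, pd γ (fun z => H z (Sum.inl β) (Sum.inr a)) y
      = (G y * pdMat γ A y) a β := fun γ a β => by
    rw [← d_mix]
    refine pd_congr (hGs.mono fun z hz => ?_)
    simp only [hH, blockMetric, Matrix.fromBlocks_apply₁₂, Matrix.fromBlocks_apply₂₁,
      Matrix.mul_apply, Matrix.transpose_apply]
    refine Finset.sum_congr rfl fun c _ => ?_
    rw [mul_comm]
    congr 1
    exact congrFun (congrFun hz a) c
  have d_inl : ∀ γ α β, pd γ (fun z => H z (Sum.inl α) (Sum.inl β)) y = pdMat γ g y α β :=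
    fun γ α β => by
    have h1 : pd γ (fun z => H z (Sum.inl α) (Sum.inl β)) y =
        pd γ (fun z => g z α β + ((A z).transpose * (G z * A z)) α β) y :=
      pd_congr (Eventually.of_forall fun z => by
        simp only [hH, blockMetric, Matrix.fromBlocks_apply₁₁, Matrix.add_apply, Matrix.mul_assoc])
    have h2 : pd γ (fun z => ((A z).transpose * (G z * A z)) α β) y =
        pdMat γ (fun z => (A z).transpose * (G z * A z)) y α β := rfl
    rw [h1, pd_add (hg.differentiableAt _ _)
      ((hA.transpose.mul (hG.mul hA)).differentiableAt _ _), h2,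
      pdMat_mul hA.transpose (hG.mul hA), hA0]
    simp [pdMat]
  -- Christoffel symbols
  have c1 : ∀ γ a b, christoffelBase H (Sum.inl γ) (Sum.inr a) (Sum.inr b) =ᶠ[𝓝 y]
      fun z => -(1 / 2) * ∑ δ, (g z)⁻¹ γ δ * pdMat δ G z a b := fun γ a b => by
    filter_upwards [hg.det.continuousAt.eventually_ne hgd,
      hG.det.continuousAt.eventually_ne hGd] with z h1 h2
    simp only [christoffelBase, Fintype.sum_sum_type]
    simp only [hH, inv_blockMetric _ h1 h2, Matrix.fromBlocks_apply₁₁, pdBase, Sum.elim_inl,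
      Sum.elim_inr, add_zero, zero_sub, sub_zero, mul_zero, Finset.sum_const_zero, mul_neg,
      Finset.sum_neg_distrib, neg_mul]
    rfl
  have c1y : ∀ γ a b, christoffelBase H (Sum.inl γ) (Sum.inr a) (Sum.inr b) y =
      -(1 / 2) * ∑ δ, gi γ δ * pdMat δ G y a b := fun γ a b => (c1 γ a b).self_of_nhds
  have c2 : ∀ γ a δ, christoffelBase H (Sum.inl γ) (Sum.inr a) (Sum.inl δ) y =
      (1 / 2) * ∑ ε, gi γ ε * (G y).mulVec (curvature A δ ε y) a := fun γ a δ => by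
    simp only [christoffelBase, Fintype.sum_sum_type, hHi, Matrix.fromBlocks_apply₁₁,
      Matrix.fromBlocks_apply₁₂, pdBase, Sum.elim_inl,
      Sum.elim_inr, zero_add, Matrix.zero_apply, zero_mul, Finset.sum_const_zero, add_zero, d_mix,
      Matrix.mul_apply, Matrix.mulVec, dotProduct, curvature, mul_sub, Finset.sum_sub_distrib]
  have c3 : ∀ a b δ, christoffelBase H (Sum.inr a) (Sum.inr b) (Sum.inl δ) y =
      (1 / 2) * ∑ c, Gi a c * pdMat δ G y b c := fun a b δ => by
    simp only [christoffelBase, Fintype.sum_sum_type, hHi, Matrix.fromBlocks_apply₂₁,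
      Matrix.fromBlocks_apply₂₂, pdBase, Sum.elim_inl,
      Sum.elim_inr, zero_add, Matrix.zero_apply, zero_mul, Finset.sum_const_zero, sub_zero]
    rfl
  have c4 : ∀ a b c, christoffelBase H (Sum.inr a) (Sum.inr b) (Sum.inr c) y = 0 :=
    fun a b c => by
    simp [christoffelBase, Fintype.sum_sum_type, hHi, pdBase]
  have c5 : ∀ γ α δ, christoffelBase H (Sum.inl γ) (Sum.inl α) (Sum.inl δ) y =
      christoffel g γ α δ y := fun γ α δ => by
    simp only [christoffelBase, Fintype.sum_sum_type, hHi, Matrix.fromBlocks_apply₁₁,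
      Matrix.fromBlocks_apply₁₂, pdBase, Sum.elim_inl,
      Matrix.zero_apply, zero_mul, Finset.sum_const_zero, add_zero, d_inl]
    rfl
  -- the four terms of the Ricci tensor
  have hgii := hg.inv hgd
  have t1 : ∀ γ, pd γ (christoffelBase H (Sum.inl γ) (Sum.inr I) (Sum.inr J)) y =
      -(1 / 2) * ∑ δ, (pdMat γ (fun z => (g z)⁻¹) y γ δ * pdMat δ G y I J
        + gi γ δ * pdMat γ (pdMat δ G) y I J) := fun γ => by
    have hd : ∀ δ, DifferentiableAt ℝ (fun z => (g z)⁻¹ γ δ * pdMat δ G z I J) y := fun δ =>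
      (hgii.differentiableAt γ δ).fun_mul ((hG.pdMat δ).differentiableAt I J)
    rw [pd_congr (c1 γ I J), pd_const_mul _ (DifferentiableAt.fun_sum fun δ _ => hd δ),
      pd_sum fun δ _ => hd δ]
    congr 1
    exact Finset.sum_congr rfl fun δ _ =>
      pd_mul (hgii.differentiableAt γ δ) ((hG.pdMat δ).differentiableAt I J)
  -- Only base values of `l` contribute, as symbols with three fiber indices vanish. Tracing over
  -- base and fiber indices then adds `½ tr(G⁻¹ ∂_δ G)` to the base trace `Γ^γ_{γδ}`.
  have t3 : (∑ k, ∑ l, christoffelBase H k k l y * christoffelBase H l (Sum.inr I) (Sum.inr J) y) =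
      ∑ δ, ((∑ γ, christoffel g γ γ δ y) + (1 / 2) * (Gi * pdMat δ G y).trace) *
        (-(1 / 2) * ∑ ε, gi δ ε * pdMat ε G y I J) := by
    rw [Finset.sum_comm]
    simp only [Fintype.sum_sum_type, c4, c5, mul_zero, Finset.sum_const_zero, add_zero, c1y, c3]
    refine Finset.sum_congr rfl fun δ _ => ?_
    rw [← Finset.sum_mul, ← Finset.sum_mul, ← add_mul, ← Finset.mul_sum]
    congr 3
    refine Finset.sum_congr rfl fun a _ => ?_
    rw [Matrix.diag_apply, Matrix.mul_apply]
    simp only [hdGs δ a]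
  -- Base-base index pairs give the curvature term, each of the two kinds of mixed pairs gives `-¼`
  -- of the `∂G G⁻¹ ∂G` term, and fiber-fiber pairs give nothing.
  have t4 : (∑ k, ∑ l, christoffelBase H k (Sum.inr J) l y *
      christoffelBase H l (Sum.inr I) k y) =
      -(1 / 4) * (∑ α, ∑ β, ∑ γ, ∑ δ, gi α γ * gi β δ *
          ((G y).mulVec (curvature A α β y) I * (G y).mulVec (curvature A γ δ y) J))
      - (1 / 2) * ∑ α, ∑ β, gi α β * (pdMat α G y * Gi * pdMat β G y) I J := by
    have s1 : ∑ γ, ∑ δ, ((1 / 2) * ∑ ε, gi γ ε * (G y).mulVec (curvature A δ ε y) J) *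
        ((1 / 2) * ∑ ζ, gi δ ζ * (G y).mulVec (curvature A γ ζ y) I) =
        -(1 / 4) * (∑ α, ∑ β, ∑ γ, ∑ δ, gi α γ * gi β δ *
          ((G y).mulVec (curvature A α β y) I * (G y).mulVec (curvature A γ δ y) J)) := by
      -- Reordering the indices of one of the two factors `F` produces the minus sign of the
      -- curvature term.
      have hanti : ∀ α β a, (G y).mulVec (curvature A α β y) a = -(G y).mulVec (curvature A β α y) a := by
        intro α β a
        have : curvature A α β y = -curvature A β α y := by
          funext K; simp [curvature]
        rw [this, Matrix.mulVec_neg]; rfl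
      rw [Finset.mul_sum]
      refine Finset.sum_congr rfl fun γ _ => ?_
      simp only [mul_sum_mul_mul_sum]
      rw [sum_comm_three]
      simp only [Finset.mul_sum]
      refine Finset.sum_congr rfl fun ζ _ => Finset.sum_congr rfl fun ε _ =>
        Finset.sum_congr rfl fun δ _ => ?_
      rw [hanti δ ε J, hgis δ ζ]
      ring
    have s2 : ∑ γ, ∑ L, (-(1 / 2) * ∑ ε, gi γ ε * pdMat ε G y J L) *
        ((1 / 2) * ∑ M, Gi L M * pdMat γ G y I M) =
        -(1 / 4) * ∑ α, ∑ β, gi α β * (pdMat α G y * Gi * pdMat β G y) I J := by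
      rw [Finset.mul_sum]
      refine Finset.sum_congr rfl fun γ _ => ?_
      simp only [mul_sum_mul_mul_sum]
      rw [← sum_comm_three]
      simp only [Matrix.mul_apply, Finset.mul_sum, Finset.sum_mul]
      refine Finset.sum_congr rfl fun ε _ => Finset.sum_congr rfl fun L _ =>
        Finset.sum_congr rfl fun M _ => ?_
      rw [hdGs ε J L, hGis L M]
      ring
    have s3 : ∑ K, ∑ δ, ((1 / 2) * ∑ L, Gi K L * pdMat δ G y J L) *
        (-(1 / 2) * ∑ ε, gi δ ε * pdMat ε G y I K) =
        -(1 / 4) * ∑ α, ∑ β, gi α β * (pdMat α G y * Gi * pdMat β G y) I J := by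
      rw [Finset.sum_comm, Finset.sum_comm (f := fun α β =>
        gi α β * (pdMat α G y * Gi * pdMat β G y) I J), Finset.mul_sum]
      refine Finset.sum_congr rfl fun δ _ => ?_
      simp only [mul_sum_mul_mul_sum]
      rw [sum_comm_three]
      simp only [Matrix.mul_apply, Finset.mul_sum, Finset.sum_mul]
      refine Finset.sum_congr rfl fun ε _ => Finset.sum_congr rfl fun L _ =>
        Finset.sum_congr rfl fun K _ => ?_
      rw [hdGs δ J L, hgis δ ε]
      ring
    simp only [Fintype.sum_sum_type, Finset.sum_add_distrib, c1y, c2, c3, c4, mul_zero,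
      Finset.sum_const_zero, add_zero]
    rw [s1, s2, s3]
    ring
  have e1 : (∑ k, pdBase k (christoffelBase H k (Sum.inr I) (Sum.inr J)) y) =
      -(1 / 2) * ((∑ γ, ∑ δ, pdMat γ (fun z => (g z)⁻¹) y γ δ * pdMat δ G y I J)
        + ∑ γ, ∑ δ, gi γ δ * pdMat γ (pdMat δ G) y I J) := by
    simp only [Fintype.sum_sum_type, pdBase, Sum.elim_inl, Sum.elim_inr, Finset.sum_const_zero,
      add_zero, t1, ← Finset.mul_sum, Finset.sum_add_distrib]
  have e2 : (∑ k, pdBase (Sum.inr J) (christoffelBase H k (Sum.inr I) k) y) = 0 := by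
    simp [pdBase]
  have e3 : ∑ δ, ((∑ γ, christoffel g γ γ δ y) + (1 / 2) * (Gi * pdMat δ G y).trace) *
        (-(1 / 2) * ∑ ε, gi δ ε * pdMat ε G y I J) =
      -(1 / 2) * (∑ δ, (∑ γ, christoffel g γ γ δ y) * ∑ ε, gi δ ε * pdMat ε G y I J)
      - (1 / 4) * ∑ α, ∑ β, gi α β * (Gi * pdMat α G y).trace * pdMat β G y I J := by
    simp only [Finset.mul_sum (s := Finset.univ) (a := -(1 / 2 : ℝ)),
      Finset.mul_sum (s := Finset.univ) (a := (1 / 4 : ℝ)), ← Finset.sum_sub_distrib]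
    refine Finset.sum_congr rfl fun δ _ => ?_
    have : ∑ β, gi δ β * (Gi * pdMat δ G y).trace * pdMat β G y I J =
        (Gi * pdMat δ G y).trace * ∑ ε, gi δ ε * pdMat ε G y I J := by
      rw [Finset.mul_sum]
      exact Finset.sum_congr rfl fun β _ => by ring
    simp only [← Finset.mul_sum]
    rw [this]
    ring
  have e4 : ∑ α, ∑ β, gi α β * hessMat g G α β y I J =
      (∑ γ, ∑ δ, gi γ δ * pdMat γ (pdMat δ G) y I J)
      - ∑ α, ∑ β, gi α β * ∑ k, christoffel g k α β y * pdMat k G y I J := by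
    simp only [hessMat, Matrix.sub_apply, Matrix.sum_apply, Matrix.smul_apply, smul_eq_mul, mul_sub,
      Finset.sum_sub_distrib]
  -- Replaces the derivatives of `g⁻¹` and the trace `Γ^γ_{γδ}` by the Christoffel part of the
  -- covariant second derivative of `G`.
  have e5 := contracted_christoffel hg hgs hgd fun δ => pdMat δ G y I J
  rw [ricci_eq_base (H := H) hh hy, t3, t4, e1, e2, e3]
  simp only [fiberRicci, Matrix.sub_apply, Matrix.add_apply, Matrix.neg_apply, Matrix.smul_apply,
    Matrix.sum_apply, smul_eq_mul, Matrix.vecMulVec_apply, ← hgi, ← hGi]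
  rw [e4]
  linear_combination -(1 / 2) * e5

end RicciOfFibers

/-! ### Consequences of the vertical Einstein equation: trace, harmonicity, positivity of `|F|²`. -/

section FiberRicci

variable {ι : Type} [Fintype ι] [DecidableEq ι]
variable {κ : Type} [Fintype κ] [DecidableEq κ]

/-- The squared norm of a 2-form on the base with values in the fiber directions. -/
def formNormSq (g : Matrix ι ι ℝ) (G : Matrix κ κ ℝ) (F : ι → ι → κ → ℝ) : ℝ :=
  ∑ α, ∑ β, ∑ γ, ∑ δ, (g⁻¹ α γ * g⁻¹ β δ) * (F α β ⬝ᵥ G.mulVec (F γ δ))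

/-- The three terms without `F` have the opposite coefficients to those in
`coordLaplacian_sqrt_det`; this is why the square root of the determinant satisfies a clean
equation. -/
lemma trace_inv_mul_fiberRicci (g : Coord ι → Matrix ι ι ℝ) {G : Coord ι → Matrix κ κ ℝ}
    (F : ι → ι → κ → ℝ) {y : Coord ι} (hG : (G y).det ≠ 0) :
    ((G y)⁻¹ * fiberRicci g G F y).trace =
      -(1 / 2) * (∑ α, ∑ β, (g y)⁻¹ α β * ((G y)⁻¹ * hessMat g G α β y).trace)
      - (1 / 4) * (∑ α, ∑ β, (g y)⁻¹ α β *
          (((G y)⁻¹ * pdMat α G y).trace * ((G y)⁻¹ * pdMat β G y).trace))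
      + (1 / 2) * (∑ α, ∑ β, (g y)⁻¹ α β *
          ((G y)⁻¹ * (pdMat α G y * (G y)⁻¹ * pdMat β G y)).trace)
      + (1 / 4) * formNormSq (g y) (G y) F := by
  have h1 : ∀ a b : κ → ℝ, ((G y)⁻¹ * Matrix.vecMulVec ((G y).mulVec a) ((G y).mulVec b)).trace =
      a ⬝ᵥ (G y).mulVec b := fun a b => by
    rw [Matrix.mul_vecMulVec, Matrix.trace_vecMulVec, Matrix.mulVec_mulVec,
      Matrix.nonsing_inv_mul _ (isUnit_iff_ne_zero.2 hG), Matrix.one_mulVec]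
  simp only [fiberRicci, Matrix.mul_add, Matrix.mul_sub, Matrix.mul_neg, Matrix.mul_smul,
    Matrix.mul_sum, Matrix.trace_add, Matrix.trace_sub, Matrix.trace_neg, Matrix.trace_smul,
    Matrix.trace_sum, h1, smul_eq_mul, formNormSq, mul_assoc]
  ring

/-- The Laplacian of `√det G` when the vertical part of the Einstein equation holds. -/
lemma coordLaplacian_sqrt_det_of_fiberRicci (g : Coord ι → Matrix ι ι ℝ)
    {G : Coord ι → Matrix κ κ ℝ} (F : ι → ι → κ → ℝ)
    {f : Coord ι → ℝ} {y : Coord ι} {c lam : ℝ} (hc : 0 < c) (hG : ∀ᶠ z in 𝓝 y, SmoothMatAt G z)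
    (hdet : 0 < (G y).det) (hf : ∀ᶠ z in 𝓝 y, f z = √(c * (G z).det))
    (hR : fiberRicci g G F y = lam • G y) :
    coordLaplacian g f y =
      ((1 / 4) * formNormSq (g y) (G y) F - lam * Fintype.card κ) * f y := by
  have h1 := trace_inv_mul_fiberRicci g F hdet.ne'
  rw [hR, Matrix.mul_smul, Matrix.nonsing_inv_mul _ (isUnit_iff_ne_zero.2 hdet.ne'),
    Matrix.trace_smul, Matrix.trace_one, smul_eq_mul] at h1
  rw [coordLaplacian_sqrt_det g hc hG hdet hf]
  linear_combination f y * h1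

/-- The harmonic map equation, when the vertical Ricci curvature vanishes, the connection is flat
and the determinant is constant. -/
lemma harmonic_of_fiberRicci_eq_zero (g : Coord ι → Matrix ι ι ℝ)
    {G : Coord ι → Matrix κ κ ℝ} {F : ι → ι → κ → ℝ} {y : Coord ι}
    (hR : fiberRicci g G F y = 0) (hF : ∀ α β, F α β = 0)
    (htr : ∀ α, ((G y)⁻¹ * pdMat α G y).trace = 0) (I J : κ) :
    (∑ α, ∑ β, (g y)⁻¹ α β * hess g (fun z => G z I J) α β y)
      - (∑ α, ∑ β, ∑ K, ∑ L, (g y)⁻¹ α β * (G y)⁻¹ K L *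
        pd α (fun z => G z I K) y * pd β (fun z => G z L J) y) = 0 := by
  have h1 := congrFun (congrFun hR I) J
  simp only [fiberRicci, hF, htr, mul_zero, zero_smul, Finset.sum_const_zero, smul_zero, sub_zero,
    Matrix.mulVec_zero, Matrix.vecMulVec_zero, add_zero, Matrix.add_apply, Matrix.neg_apply,
    Matrix.smul_apply, Matrix.sum_apply, smul_eq_mul, hessMat_apply, Matrix.zero_apply] at h1
  have h2 : ∀ α β, ∑ K, ∑ L, (g y)⁻¹ α β * (G y)⁻¹ K L *
      pd α (fun z => G z I K) y * pd β (fun z => G z L J) y =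
      (g y)⁻¹ α β * (pdMat α G y * (G y)⁻¹ * pdMat β G y) I J := fun α β => by
    rw [Finset.sum_comm]
    simp only [Matrix.mul_apply, Finset.mul_sum, Finset.sum_mul]
    refine Finset.sum_congr rfl fun L _ => Finset.sum_congr rfl fun K _ => ?_
    simp only [pdMat, Matrix.of_apply]
    ring
  simp only [h2]
  linear_combination -2 * h1

/-- The squared norm of a 2-form is nonnegative, and vanishes only if the form does. -/
lemma formNormSq_nonneg {g : Matrix ι ι ℝ} {G : Matrix κ κ ℝ} (hg : g.PosDef) (hG : G.PosDef)
    (F : ι → ι → κ → ℝ) :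
    0 ≤ formNormSq g G F ∧ (formNormSq g G F = 0 → ∀ α β, F α β = 0) := by
  -- The norm is the quadratic form of `g⁻¹ ⊗ g⁻¹ ⊗ G` at `F`, viewed as a vector indexed by
  -- triples, and Kronecker products of positive definite matrices are positive definite.
  have hK := hg.inv.kronecker (hg.inv.kronecker hG)
  set K := Matrix.kroneckerMap (fun a b => a * b) g⁻¹
    (Matrix.kroneckerMap (fun a b => a * b) g⁻¹ G) with hKdef
  set x : ι × ι × κ → ℝ := fun p => F p.1 p.2.1 p.2.2 with hx
  have h : formNormSq g G F = star x ⬝ᵥ K.mulVec x := by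
    simp only [formNormSq, dotProduct, Matrix.mulVec, Fintype.sum_prod_type, Finset.mul_sum, hx,
      hKdef, Matrix.kroneckerMap_apply, star_trivial]
    refine Finset.sum_congr rfl fun α _ => Finset.sum_congr rfl fun β _ => ?_
    rw [Finset.sum_comm_cycle]
    refine Finset.sum_congr rfl fun I _ => Finset.sum_congr rfl fun γ _ =>
      Finset.sum_congr rfl fun δ _ => Finset.sum_congr rfl fun J _ => ?_
    ring
  rw [h]
  refine ⟨hK.posSemidef.dotProduct_mulVec_nonneg x, fun h0 α β => ?_⟩
  have hx0 : x = 0 := by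
    by_contra hne
    exact (hK.dotProduct_mulVec_pos hne).ne' h0
  funext I
  exact congrFun hx0 (α, β, I)

end FiberRicci

/-! ### The invariant frame of an abelian Lie group, read in a chart. -/

section LogChart

variable {E : Type*} [NormedAddCommGroup E] [NormedSpace ℝ E]
variable {𝒢 : Type*} [CommGroup 𝒢] [TopologicalSpace 𝒢] [ChartedSpace E 𝒢]

/-- The left multiplication by `g`, read in a chart. -/
def chartMul (e : OpenPartialHomeomorph 𝒢 E) (g : 𝒢) (z : E) : E := e (g * e.symm z)

/-- The translation invariant frame of an abelian Lie group, read in a chart. -/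
def invFrame (e : OpenPartialHomeomorph 𝒢 E) (z : E) : E →L[ℝ] E :=
  fderiv ℝ (chartMul e (e.symm z)) (e 1)

variable [LieGroup 𝓘(ℝ, E) ∞ 𝒢] {e : OpenPartialHomeomorph 𝒢 E}

lemma contDiffAt_chartMul_uncurry (he : e ∈ IsManifold.maximalAtlas 𝓘(ℝ, E) ∞ 𝒢) {p : E × E}
    (h1 : p.1 ∈ e.target) (h2 : p.2 ∈ e.target) (h : e.symm p.1 * e.symm p.2 ∈ e.source) :
    ContDiffAt ℝ ∞ (fun q : E × E => chartMul e (e.symm q.1) q.2) p := by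
  rw [← contMDiffAt_iff_contDiffAt]
  have a1 : ContMDiffAt 𝓘(ℝ, E × E) 𝓘(ℝ, E) ∞ (fun q : E × E => e.symm q.1) p :=
    ContMDiffAt.comp p (contMDiffAt_symm_of_mem_maximalAtlas he h1) contDiff_fst.contMDiff.contMDiffAt
  have a2 : ContMDiffAt 𝓘(ℝ, E × E) 𝓘(ℝ, E) ∞ (fun q : E × E => e.symm q.2) p :=
    ContMDiffAt.comp p (contMDiffAt_symm_of_mem_maximalAtlas he h2) contDiff_snd.contMDiff.contMDiffAt
  exact ContMDiffAt.comp p (contMDiffAt_of_mem_maximalAtlas he h) (a1.mul a2)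

lemma contDiffAt_chartMul (he : e ∈ IsManifold.maximalAtlas 𝓘(ℝ, E) ∞ 𝒢) {g : 𝒢} {z : E}
    (hz : z ∈ e.target) (h : g * e.symm z ∈ e.source) : ContDiffAt ℝ ∞ (chartMul e g) z := by
  rw [← contMDiffAt_iff_contDiffAt]
  have a2 : ContMDiffAt 𝓘(ℝ, E) 𝓘(ℝ, E) ∞ e.symm z := contMDiffAt_symm_of_mem_maximalAtlas he hz
  exact ContMDiffAt.comp z (contMDiffAt_of_mem_maximalAtlas he h) (contMDiffAt_const.mul a2)

lemma eventually_mul_symm_mem (he : e ∈ IsManifold.maximalAtlas 𝓘(ℝ, E) ∞ 𝒢) {g : 𝒢} {z : E}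
    (hz : z ∈ e.target) (h : g * e.symm z ∈ e.source) :
    ∀ᶠ w in 𝓝 z, w ∈ e.target ∧ g * e.symm w ∈ e.source := by
  have a2 : ContMDiffAt 𝓘(ℝ, E) 𝓘(ℝ, E) ∞ e.symm z := contMDiffAt_symm_of_mem_maximalAtlas he hz
  have a3 : ContMDiffAt 𝓘(ℝ, E) 𝓘(ℝ, E) ∞ (fun w => g * e.symm w) z := contMDiffAt_const.mul a2
  exact Filter.Eventually.and (e.open_target.mem_nhds hz)
    (a3.continuousAt.preimage_mem_nhds (e.open_source.mem_nhds h))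

/-- The invariant frame is preserved by translations. -/
lemma fderiv_chartMul_comp_invFrame (he : e ∈ IsManifold.maximalAtlas 𝓘(ℝ, E) ∞ 𝒢)
    (h1 : (1 : 𝒢) ∈ e.source) {g : 𝒢} {z : E}
    (hz : z ∈ e.target) (h : g * e.symm z ∈ e.source) :
    (fderiv ℝ (chartMul e g) z).comp (invFrame e z) = invFrame e (chartMul e g z) := by
  have hs1 : e.symm (e 1) = 1 := e.left_inv h1
  have ht1 : e 1 ∈ e.target := e.map_source h1
  have hz1 : e.symm z * e.symm (e 1) ∈ e.source := by
    rw [hs1, mul_one]; exact e.map_target hz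
  have hzv : chartMul e (e.symm z) (e 1) = z := by
    rw [chartMul, hs1, mul_one, e.right_inv hz]
  have hd1 : DifferentiableAt ℝ (chartMul e (e.symm z)) (e 1) :=
    (contDiffAt_chartMul he ht1 hz1).differentiableAt (by simp)
  have hd2 : DifferentiableAt ℝ (chartMul e g) (chartMul e (e.symm z) (e 1)) := by
    rw [hzv]; exact (contDiffAt_chartMul he hz h).differentiableAt (by simp)
  have h2 := fderiv_comp (e 1) hd2 hd1
  rw [hzv] at h2
  rw [invFrame, ← h2, invFrame]
  refine Filter.EventuallyEq.fderiv_eq ?_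
  -- Associativity: translating by the point over `z` and then by `g` is translating by their
  -- product, and the chain rule at the identity gives the claim.
  filter_upwards [eventually_mul_symm_mem he ht1 hz1] with w hw
  simp only [Function.comp_apply, chartMul]
  rw [e.left_inv hw.2, e.left_inv h, mul_assoc]

/-- Exhibits the frame as a partial derivative of the jointly smooth multiplication, from which its
smooth dependence on the point can be read off. -/
lemma invFrame_eq_fderiv_uncurry (he : e ∈ IsManifold.maximalAtlas 𝓘(ℝ, E) ∞ 𝒢)
    (h1 : (1 : 𝒢) ∈ e.source) {z : E} (hz : z ∈ e.target) (v : E) :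
    invFrame e z v = fderiv ℝ (fun q : E × E => chartMul e (e.symm q.1) q.2) (z, e 1) (0, v) := by
  have hs1 : e.symm (e 1) = 1 := e.left_inv h1
  have hz1 : e.symm z * e.symm (e 1) ∈ e.source := by
    rw [hs1, mul_one]; exact e.map_target hz
  have hd := (contDiffAt_chartMul_uncurry he (p := (z, e 1)) hz (e.map_source h1) hz1).differentiableAt
    (by simp)
  have h2 : HasFDerivAt (fun w : E => (z, w)) (ContinuousLinearMap.inr ℝ E E) (e 1) :=
    hasFDerivAt_prodMk_right z (e 1)
  have h3 := (hd.hasFDerivAt.comp (e 1) h2).fderiv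
  have h4 : invFrame e z = _ := h3
  rw [h4]; rfl

lemma contDiffAt_invFrame (he : e ∈ IsManifold.maximalAtlas 𝓘(ℝ, E) ∞ 𝒢)
    (h1 : (1 : 𝒢) ∈ e.source) {z : E} (hz : z ∈ e.target) : ContDiffAt ℝ ∞ (invFrame e) z := by
  have hs1 : e.symm (e 1) = 1 := e.left_inv h1
  have hz1 : e.symm z * e.symm (e 1) ∈ e.source := by
    rw [hs1, mul_one]; exact e.map_target hz
  have hd := contDiffAt_chartMul_uncurry he (p := (z, e 1)) hz (e.map_source h1) hz1
  have h2 : ContDiffAt ℝ ∞ (fun w => (fderiv ℝ (fun q : E × E => chartMul e (e.symm q.1) q.2)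
      (w, e 1)).comp (ContinuousLinearMap.inr ℝ E E)) z := by
    refine ContDiffAt.clm_comp ?_ contDiffAt_const
    exact ContDiffAt.comp z (hd.fderiv_right (m := ∞) le_rfl)
      (contDiffAt_id.prodMk contDiffAt_const)
  refine h2.congr_of_eventuallyEq ?_
  filter_upwards [e.open_target.mem_nhds hz] with w hw
  ext v
  rw [invFrame_eq_fderiv_uncurry he h1 hw]
  rfl

lemma invFrame_one (h1 : (1 : 𝒢) ∈ e.source) : invFrame e (e 1) = ContinuousLinearMap.id ℝ E := by
  have h : chartMul e (e.symm (e 1)) =ᶠ[𝓝 (e 1)] id := by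
    filter_upwards [e.open_target.mem_nhds (e.map_source h1)] with w hw
    simp [chartMul, e.left_inv h1, e.right_inv hw]
  rw [invFrame, h.fderiv_eq, fderiv_id]

/-- The invariant vector fields of an abelian Lie group commute. -/
lemma fderiv_invFrame_comm (he : e ∈ IsManifold.maximalAtlas 𝓘(ℝ, E) ∞ 𝒢)
    (h1 : (1 : 𝒢) ∈ e.source) {z : E} (hz : z ∈ e.target) (u v : E) :
    fderiv ℝ (invFrame e) z (invFrame e z v) u = fderiv ℝ (invFrame e) z (invFrame e z u) v := by
  have hs1 : e.symm (e 1) = 1 := e.left_inv h1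
  have ht1 : e 1 ∈ e.target := e.map_source h1
  have hz1 : e.symm z * e.symm (e 1) ∈ e.source := by
    rw [hs1, mul_one]; exact e.map_target hz
  have hzv : chartMul e (e.symm z) (e 1) = z := by
    rw [chartMul, hs1, mul_one, e.right_inv hz]
  set m : E × E → E := fun q => chartMul e (e.symm q.1) q.2 with hm
  -- In the chart, `K` is `(x, y) ↦ z x y`. Its mixed second derivative at the identity is the
  -- derivative of one invariant field along another.
  set K : E × E → E := fun p => m (m (z, p.1), p.2) with hK
  have hm1 : ContDiffAt ℝ ∞ m (z, e 1) :=
    contDiffAt_chartMul_uncurry he (p := (z, e 1)) hz ht1 hz1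
  have hmz : m (z, e 1) = z := hzv
  have hin : ContDiffAt ℝ ∞ (fun p : E × E => m (z, p.1)) (e 1, e 1) :=
    ContDiffAt.comp (e 1, e 1) (g := m) (f := fun p : E × E => (z, p.1)) hm1
      (contDiffAt_const.prodMk contDiffAt_fst)
  have hKs : ContDiffAt ℝ ∞ K (e 1, e 1) := by
    refine ContDiffAt.comp (e 1, e 1) (g := m) (f := fun p : E × E => (m (z, p.1), p.2)) ?_
      (hin.prodMk contDiffAt_snd)
    simpa only [hmz] using hm1
  have hKev : ∀ᶠ p in 𝓝 (e 1, e 1), DifferentiableAt ℝ K p :=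
    ((hKs.of_le (m := 1) (by norm_num)).eventually (by simp)).mono fun p hp =>
      hp.differentiableAt (by simp)
  have hev : ∀ᶠ w in 𝓝 (e 1), w ∈ e.target ∧ e.symm z * e.symm w ∈ e.source :=
    eventually_mul_symm_mem he ht1 hz1
  -- Commutativity of the group enters here.
  have hsymm : (fun p : E × E => K p.swap) =ᶠ[𝓝 (e 1, e 1)] K := by
    filter_upwards [hev.prod_nhds hev] with p hp
    simp only [hK, hm, chartMul, Prod.fst_swap, Prod.snd_swap]
    rw [e.left_inv hp.1.2, e.left_inv hp.2.2, mul_right_comm]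
  have hD : ∀ a b, fderiv ℝ (invFrame e) z (invFrame e z a) b =
      fderiv ℝ (fderiv ℝ K) (e 1, e 1) (a, 0) (0, b) := by
    intro a b
    have hmw : HasFDerivAt (fun w => m (z, w)) (invFrame e z) (e 1) :=
      ((contDiffAt_chartMul he ht1 hz1).differentiableAt (by simp)).hasFDerivAt
    have h3 : HasFDerivAt (fun w => invFrame e (m (z, w)))
        ((fderiv ℝ (invFrame e) z).comp (invFrame e z)) (e 1) := by
      refine HasFDerivAt.comp (e 1) (g := invFrame e) ?_ hmw
      rw [hmz]
      exact ((contDiffAt_invFrame he h1 hz).differentiableAt (by simp)).hasFDerivAt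
    have h4 : (fun w => invFrame e (m (z, w))) =ᶠ[𝓝 (e 1)] fun w =>
        (fderiv ℝ K (w, e 1)).comp (ContinuousLinearMap.inr ℝ E E) := by
      filter_upwards [hev, (Continuous.prodMk_left (e 1)).continuousAt.eventually
        hKev] with w hw hKw
      have h5 : HasFDerivAt (fun w' : E => (w, w')) (ContinuousLinearMap.inr ℝ E E) (e 1) :=
        hasFDerivAt_prodMk_right w (e 1)
      have h6 := (hKw.hasFDerivAt.comp (e 1) h5).fderiv
      rw [← h6]
      rfl
    have h6 : HasFDerivAt (fun w => fderiv ℝ K (w, e 1))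
        ((fderiv ℝ (fderiv ℝ K) (e 1, e 1)).comp (ContinuousLinearMap.inl ℝ E E)) (e 1) :=
      HasFDerivAt.comp (e 1) (g := fderiv ℝ K)
        ((hKs.fderiv_right (m := ∞) le_rfl).differentiableAt (by simp)).hasFDerivAt
        (hasFDerivAt_prodMk_left (e 1) (e 1))
    have h7 := h6.clm_comp (hasFDerivAt_const (ContinuousLinearMap.inr ℝ E E) (e 1))
    have h8 := HasFDerivAt.unique (𝕜 := ℝ) (h3.congr_of_eventuallyEq h4.symm) h7
    have h9 := congrArg (fun L : E →L[ℝ] E →L[ℝ] E => L a b) h8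
    simpa using h9
  have hsnd : IsSymmSndFDerivAt ℝ K (e 1, e 1) := hKs.isSymmSndFDerivAt (by simp; norm_cast)
  have hswap : ∀ a b c d, fderiv ℝ (fderiv ℝ K) (e 1, e 1) (a, b) (c, d) =
      fderiv ℝ (fderiv ℝ K) (e 1, e 1) (b, a) (d, c) := by
    intro a b c d
    set S : E × E →L[ℝ] E × E := (ContinuousLinearEquiv.prodComm ℝ E E : E × E →L[ℝ] E × E) with hS
    have hSapp : ∀ p : E × E, S p = p.swap := fun p => rfl
    have h2 : fderiv ℝ K =ᶠ[𝓝 (e 1, e 1)] fun p => (fderiv ℝ K (S p)).comp S := by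
      have hKd : ∀ᶠ p in 𝓝 (e 1, e 1), DifferentiableAt ℝ K (S p) := by
        refine (S.continuous.continuousAt (x := (e 1, e 1))).eventually ?_
        exact hKev
      filter_upwards [hsymm.eventually_nhds, hKd] with p hp hp2
      rw [← Filter.EventuallyEq.fderiv_eq hp]
      exact (hp2.hasFDerivAt.comp p S.hasFDerivAt).fderiv
    have h6 : HasFDerivAt (fun p => fderiv ℝ K (S p))
        ((fderiv ℝ (fderiv ℝ K) (e 1, e 1)).comp S) (e 1, e 1) :=
      HasFDerivAt.comp (e 1, e 1) (g := fderiv ℝ K) (f := S)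
        (g' := fderiv ℝ (fderiv ℝ K) (e 1, e 1))
        ((hKs.fderiv_right (m := ∞) le_rfl).differentiableAt (by simp)).hasFDerivAt
        S.hasFDerivAt
    have h3 := h6.clm_comp (hasFDerivAt_const S (e 1, e 1))
    have h4 := h2.fderiv_eq.trans h3.fderiv
    have h5 := congrArg (fun L : E × E →L[ℝ] E × E →L[ℝ] E => L (a, b) (c, d)) h4
    simpa [hSapp] using h5
  -- Symmetry of second derivatives exchanges the two arguments; the swap invariance of `K` then
  -- exchanges the two factors.
  rw [hD, hD, hsnd.eq, hswap]

end LogChart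

/-! ### Integration of the invariant coframe to a logarithmic chart. -/

section LogChart

variable {E : Type*} [NormedAddCommGroup E] [NormedSpace ℝ E] [CompleteSpace E]
variable {𝒢 : Type*} [CommGroup 𝒢] [TopologicalSpace 𝒢] [ChartedSpace E 𝒢]
variable [LieGroup 𝓘(ℝ, E) ∞ 𝒢] {e : OpenPartialHomeomorph 𝒢 E}

/-- The invariant coframe has a primitive near the identity. -/
lemma exists_primitive_invCoframe (he : e ∈ IsManifold.maximalAtlas 𝓘(ℝ, E) ∞ 𝒢)
    (h1 : (1 : 𝒢) ∈ e.source) :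
    ∃ (s : Set E) (f : E → E), IsOpen s ∧ e 1 ∈ s ∧ s ⊆ e.target ∧ f (e 1) = 0 ∧
      (∀ z ∈ s, IsUnit (invFrame e z)) ∧ ContDiffOn ℝ ∞ f s ∧
      ∀ z ∈ s, HasFDerivAt f (Ring.inverse (invFrame e z)) z := by
  have ht1 : e 1 ∈ e.target := e.map_source h1
  have hu : ∀ᶠ z in 𝓝 (e 1), IsUnit (invFrame e z) := by
    refine (contDiffAt_invFrame he h1 ht1).continuousAt.eventually
      (Units.isOpen.mem_nhds (x := invFrame e (e 1)) ?_)
    rw [invFrame_one h1]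
    exact isUnit_one
  obtain ⟨r, hr, hball⟩ := Metric.eventually_nhds_iff_ball.1
    (hu.and (e.open_target.mem_nhds ht1))
  set s := Metric.ball (e 1) r with hs
  set coframe : E → E →L[ℝ] E := fun z => Ring.inverse (invFrame e z)
  have coframe_smooth : ContDiffOn ℝ ∞ coframe s := by
    intro z hz
    obtain ⟨u, hu⟩ := (hball z hz).1
    refine ContDiffAt.contDiffWithinAt (ContDiffAt.comp z (g := Ring.inverse) ?_
      (contDiffAt_invFrame he h1 (hball z hz).2))
    rw [← hu]
    exact contDiffAt_ringInverse ℝ u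
  -- Differentiating the inverse of the frame `X` gives `-X⁻¹ (DX(a)) (X⁻¹ b)`. Writing `a` as `X`
  -- applied to `X⁻¹ a` reduces closedness to the commutation of invariant fields.
  have hclosed : ∀ z ∈ s, ∀ x y, fderiv ℝ coframe z x y = fderiv ℝ coframe z y x := by
    intro z hz x y
    obtain ⟨u, hu⟩ := (hball z hz).1
    have h2 : HasFDerivAt (invFrame e) (fderiv ℝ (invFrame e) z) z :=
      ((contDiffAt_invFrame he h1 (hball z hz).2).differentiableAt (by simp)).hasFDerivAt
    have h3 := hasFDerivAt_ringInverse (𝕜 := ℝ) u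
    rw [hu] at h3
    have h4 := (h3.comp z h2).fderiv
    have h5 : ∀ a b, fderiv ℝ coframe z a b =
        -((↑u⁻¹ : E →L[ℝ] E) (fderiv ℝ (invFrame e) z a ((↑u⁻¹ : E →L[ℝ] E) b))) := by
      intro a b
      have : fderiv ℝ coframe z = _ := h4
      rw [this]
      rfl
    have h6 : ∀ a, a = invFrame e z ((↑u⁻¹ : E →L[ℝ] E) a) := fun a => by
      rw [← hu]
      have := congrArg (fun L : E →L[ℝ] E => L a) u.mul_inv
      exact this.symm
    rw [h5, h5]
    congr 2
    conv_lhs => rw [h6 x]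
    conv_rhs => rw [h6 y]
    exact fderiv_invFrame_comm he h1 (hball z hz).2 _ _
  -- Poincaré lemma on a ball.
  obtain ⟨f, hf⟩ := (convex_ball (e 1) r).exists_forall_hasFDerivAt_of_fderiv_symmetric
    Metric.isOpen_ball (coframe_smooth.differentiableOn (by simp)) hclosed
  have hf' : ∀ z ∈ s, HasFDerivAt (fun w => f w - f (e 1)) (coframe z) z := fun z hz =>
    (hf z hz).sub_const _
  refine ⟨s, fun w => f w - f (e 1), Metric.isOpen_ball, Metric.mem_ball_self hr,
    fun z hz => (hball z hz).2, sub_self _, fun z hz => (hball z hz).1, ?_, hf'⟩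
  rw [contDiffOn_infty_iff_fderiv_of_isOpen Metric.isOpen_ball]
  exact ⟨fun z hz => (hf' z hz).differentiableAt.differentiableWithinAt,
    coframe_smooth.congr fun z hz => (hf' z hz).fderiv⟩

/-- An abelian Lie group has a chart at the identity that is locally a homomorphism. -/
theorem exists_log_chart (he : e ∈ IsManifold.maximalAtlas 𝓘(ℝ, E) ∞ 𝒢)
    (h1 : (1 : 𝒢) ∈ e.source) :
    ∃ ψ : OpenPartialHomeomorph 𝒢 E, ψ ∈ IsManifold.maximalAtlas 𝓘(ℝ, E) ∞ 𝒢 ∧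
      (1 : 𝒢) ∈ ψ.source ∧ ψ 1 = 0 ∧ ψ.source ⊆ e.source ∧
      HasFDerivAt (e ∘ ψ.symm) (ContinuousLinearMap.id ℝ E) 0 ∧
      ∀ w ∈ ψ.target, ∀ᶠ w' in 𝓝 w, ψ.symm w' = ψ.symm w * ψ.symm (w' - w) := by
  obtain ⟨s, f, hso, hs1, hst, hf1, hu, hfs, hf⟩ := exists_primitive_invCoframe he h1
  have heq : ∀ z ∈ s, ∃ L : E ≃L[ℝ] E, (L : E →L[ℝ] E) = Ring.inverse (invFrame e z) ∧
      ((L.symm : E ≃L[ℝ] E) : E →L[ℝ] E) = invFrame e z := by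
    intro z hz
    obtain ⟨u, hu⟩ := hu z hz
    refine ⟨ContinuousLinearEquiv.unitsEquiv ℝ E u⁻¹, ?_, ?_⟩
    · rw [← hu, Ring.inverse_unit]; rfl
    · rw [← hu]; rfl
  have hfa : ∀ z ∈ s, ContDiffAt ℝ ∞ f z := fun z hz => hfs.contDiffAt (hso.mem_nhds hz)
  obtain ⟨L1, hL1, -⟩ := heq _ hs1
  have hf1' : HasFDerivAt f (L1 : E →L[ℝ] E) (e 1) := by rw [hL1]; exact hf _ hs1
  -- The inverse function theorem makes the primitive a local coordinate. Restricting to `s` keeps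
  -- its derivative equal to the invariant coframe on the whole source.
  set φ : OpenPartialHomeomorph E E :=
    ((hfa _ hs1).toOpenPartialHomeomorph f hf1' (by simp)).restrOpen s hso with hφ
  have hφf : ∀ z, φ z = f z := fun z => rfl
  have hφs : φ.source ⊆ s := fun z hz => by
    rw [hφ, OpenPartialHomeomorph.restrOpen_source] at hz; exact hz.2
  have hφ1 : e 1 ∈ φ.source := by
    rw [hφ, OpenPartialHomeomorph.restrOpen_source]
    exact ⟨ContDiffAt.mem_toOpenPartialHomeomorph_source _ _ _, hs1⟩
  have hφsymm : ∀ w ∈ φ.target, ContDiffAt ℝ ∞ φ.symm w ∧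
      HasFDerivAt φ.symm (invFrame e (φ.symm w)) w := by
    intro w hw
    have hz := hφs (φ.map_target hw)
    obtain ⟨L, hL, hL'⟩ := heq _ hz
    have hd : HasFDerivAt φ (L : E →L[ℝ] E) (φ.symm w) := by rw [hL]; exact hf _ hz
    refine ⟨φ.contDiffAt_symm hw hd (hfa _ hz), ?_⟩
    rw [← hL']
    exact φ.hasFDerivAt_symm hw hd
  set ψ := e.trans φ with hψ
  have hψs : ψ.source ⊆ e.source := by
    rw [hψ, OpenPartialHomeomorph.trans_source]; exact inter_subset_left
  have hψt : ψ.target ⊆ φ.target := by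
    rw [hψ, OpenPartialHomeomorph.trans_target]; exact inter_subset_left
  have hψ1 : (1 : 𝒢) ∈ ψ.source := by
    rw [hψ, OpenPartialHomeomorph.trans_source]; exact ⟨h1, hφ1⟩
  have hψ0 : ψ 1 = 0 := hf1
  have h0t : (0 : E) ∈ ψ.target := hψ0 ▸ ψ.map_source hψ1
  have hsymm0 : φ.symm 0 = e 1 := by
    rw [← hf1, ← hφf]; exact φ.left_inv hφ1
  refine ⟨ψ, ?_, hψ1, hψ0, hψs, ?_, ?_⟩
  · refine OpenPartialHomeomorph.mem_maximalAtlas_of_contMDiffOn _ ?_ ?_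
    · intro x hx
      have hx2 : e x ∈ φ.source := by
        rw [hψ, OpenPartialHomeomorph.trans_source] at hx; exact hx.2
      exact (ContMDiffAt.comp x (g := f) (hfa _ (hφs hx2)).contMDiffAt
        (contMDiffAt_of_mem_maximalAtlas he (hψs hx))).contMDiffWithinAt
    · intro w hw
      have hw2 : φ.symm w ∈ e.target := hst (hφs (φ.map_target (hψt hw)))
      exact (ContMDiffAt.comp w (g := e.symm) (contMDiffAt_symm_of_mem_maximalAtlas he hw2)
        (hφsymm w (hψt hw)).1.contMDiffAt).contMDiffWithinAt
  · have h2 := (hφsymm 0 (hψt h0t)).2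
    rw [hsymm0, invFrame_one h1] at h2
    refine h2.congr_of_eventuallyEq ?_
    filter_upwards [ψ.open_target.mem_nhds h0t] with w hw
    exact e.right_inv (hst (hφs (φ.map_target (hψt hw))))
  · intro w hw
    set x := ψ.symm w with hx
    have hxs : x ∈ ψ.source := ψ.map_target hw
    have hx' : e.symm (φ.symm w) = x := rfl
    have hev : ∀ᶠ w' in 𝓝 w, w' ∈ ψ.target ∧ x⁻¹ * ψ.symm w' ∈ ψ.source := by
      refine Filter.Eventually.and (ψ.open_target.mem_nhds hw) ?_
      have hc : ContinuousAt (fun w' => x⁻¹ * ψ.symm w') w := by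
        have : ContinuousMul 𝒢 := continuousMul_of_contMDiffMul 𝓘(ℝ, E) ∞
        exact continuousAt_const.mul (ψ.continuousAt_symm hw)
      refine hc.preimage_mem_nhds (ψ.open_source.mem_nhds ?_)
      rw [← hx, inv_mul_cancel]; exact hψ1
    obtain ⟨r, hr, hball⟩ := Metric.eventually_nhds_iff_ball.1 hev
    -- Left translation by `x⁻¹` in the new coordinates. Translations preserve the invariant frame
    -- and the new coordinates have the dual coframe as differential, so `θ` has derivative the
    -- identity; with `θ w = 0` it is `w' ↦ w' - w` on the ball.
    set θ : E → E := fun w' => ψ (x⁻¹ * ψ.symm w') with hθ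
    have hθd : ∀ w' ∈ Metric.ball w r, HasFDerivAt θ (ContinuousLinearMap.id ℝ E) w' := by
      intro w' hw'
      obtain ⟨ht', hs'⟩ := hball w' hw'
      have hz' : φ.symm w' ∈ e.target := hst (hφs (φ.map_target (hψt ht')))
      have hzs : x⁻¹ * e.symm (φ.symm w') ∈ e.source := hψs hs'
      have d1 := (hφsymm w' (hψt ht')).2
      have d2 : HasFDerivAt (chartMul e x⁻¹) _ (φ.symm w') :=
        ((contDiffAt_chartMul he hz' hzs).differentiableAt (by simp)).hasFDerivAt
      have hz'' : chartMul e x⁻¹ (φ.symm w') ∈ s := by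
        have : x⁻¹ * ψ.symm w' ∈ ψ.source := hs'
        rw [hψ, OpenPartialHomeomorph.trans_source] at this
        exact hφs this.2
      have d3 := hf _ hz''
      have d4 := d3.comp w' (d2.comp w' d1)
      have hcomp : (Ring.inverse (invFrame e (chartMul e x⁻¹ (φ.symm w')))).comp
          ((fderiv ℝ (chartMul e x⁻¹) (φ.symm w')).comp (invFrame e (φ.symm w'))) =
          ContinuousLinearMap.id ℝ E := by
        rw [fderiv_chartMul_comp_invFrame he h1 hz' hzs]
        exact Ring.inverse_mul_cancel _ (hu _ hz'')
      rw [hcomp] at d4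
      exact d4
    have hconst : ∀ w' ∈ Metric.ball w r, θ w' = w' - w := by
      intro w' hw'
      have h3 := Metric.isOpen_ball.is_const_of_fderiv_eq_zero (𝕜 := ℝ)
        (f := fun v => θ v - v) (convex_ball w r).isPreconnected
        (fun v hv => ((hθd v hv).sub (hasFDerivAt_id v)).differentiableAt.differentiableWithinAt)
        (fun v hv => by
          have h4 : HasFDerivAt (fun v => θ v - v) _ v := (hθd v hv).sub (hasFDerivAt_id v)
          rw [h4.fderiv, sub_self]; rfl)
        hw' (Metric.mem_ball_self hr)
      have h4 : θ w = 0 := by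
        rw [hθ]; simp only; rw [← hx, inv_mul_cancel, hψ0]
      simp only [h4, zero_sub] at h3
      rw [sub_eq_iff_eq_add.1 h3]; abel
    filter_upwards [Metric.ball_mem_nhds w hr] with w' hw'
    rw [← hconst w' hw', hθ]
    simp only
    rw [ψ.left_inv (hball w' hw').2, mul_inv_cancel_left]

end LogChart

/-! ### Pullbacks of metrics, and smoothness and positivity of metric coefficients. -/

section PullbackForm

variable {ι : Type} [Fintype ι] [DecidableEq ι]
variable {X : Type*} [TopologicalSpace X] [ChartedSpace (Coord ι) X]
  [IsManifold 𝓘(ℝ, Coord ι) ∞ X]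
variable {F : Type*} [NormedAddCommGroup F] [NormedSpace ℝ F]

/-- Every tangent space is definitionally the model space, so the base point can be exchanged while
the vectors are kept as elements of the model space. -/
lemma metric_inner_congr (g : Metric ι X) {p q : X} (h : p = q) (u w : Coord ι) :
    g.inner p u w = g.inner q u w := by
  subst h; rfl

/-- The inner product on a tangent space, identified with the model space. -/
def innerCoord (g : Metric ι X) (p : X) : Coord ι →L[ℝ] Coord ι →L[ℝ] ℝ := g.inner p

variable (ι) in
/-- The differential of a map on a vector space, with tangent spaces identified with the model. -/
def derivCoord (f : F → X) (z : F) : F →L[ℝ] Coord ι := mfderiv 𝓘(ℝ, F) 𝓘(ℝ, Coord ι) f z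

/-- The pullback of a metric by a map from a vector space. -/
def pullForm (g : Metric ι X) (f : F → X) (z : F) : LinearMap.BilinForm ℝ F :=
  LinearMap.mk₂ ℝ (fun u w => innerCoord g (f z) (derivCoord ι f z u) (derivCoord ι f z w))
    (fun u u' w => by rw [map_add, map_add]; rfl)
    (fun c u w => by rw [map_smul, map_smul]; rfl)
    (fun u w w' => by rw [map_add, map_add])
    (fun c u w => by rw [map_smul, map_smul])

lemma pullForm_apply (g : Metric ι X) (f : F → X) (z u w : F) :
    pullForm g f z u w = g.inner (f z) (mfderiv 𝓘(ℝ, F) 𝓘(ℝ, Coord ι) f z u)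
      (mfderiv 𝓘(ℝ, F) 𝓘(ℝ, Coord ι) f z w) := rfl

lemma pullForm_symm (g : Metric ι X) (f : F → X) (z u w : F) :
    pullForm g f z u w = pullForm g f z w u := g.symm _ _ _

lemma pullForm_congr (g : Metric ι X) {f f' : F → X} {z : F} (h : f =ᶠ[𝓝 z] f') :
    pullForm g f z = pullForm g f' z := by
  ext u w
  rw [pullForm_apply, pullForm_apply]
  have h1 : (mfderiv 𝓘(ℝ, F) 𝓘(ℝ, Coord ι) f z : F →L[ℝ] Coord ι) =
    mfderiv 𝓘(ℝ, F) 𝓘(ℝ, Coord ι) f' z := h.mfderiv_eq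
  have h2 := metric_inner_congr g h.self_of_nhds
    ((mfderiv 𝓘(ℝ, F) 𝓘(ℝ, Coord ι) f z : F →L[ℝ] Coord ι) u)
    ((mfderiv 𝓘(ℝ, F) 𝓘(ℝ, Coord ι) f z : F →L[ℝ] Coord ι) w)
  refine h2.trans ?_
  rw [h1]
  rfl

lemma pullForm_comp_sub (g : Metric ι X) {f : F → X} {z c : F}
    (hf : MDifferentiableAt 𝓘(ℝ, F) 𝓘(ℝ, Coord ι) f (z - c)) :
    pullForm g (fun z' => f (z' - c)) z = pullForm g f (z - c) := by
  ext u w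
  have h1 : HasMFDerivAt 𝓘(ℝ, F) 𝓘(ℝ, F) (fun z' : F => z' - c) z (ContinuousLinearMap.id ℝ F) :=
    ((hasFDerivAt_id z).sub_const c).hasMFDerivAt
  have h2 : HasMFDerivAt 𝓘(ℝ, F) 𝓘(ℝ, Coord ι) (fun z' => f (z' - c)) z _ :=
    HasMFDerivAt.comp z (f := fun z' : F => z' - c) hf.hasMFDerivAt h1
  rw [pullForm_apply, pullForm_apply, h2.mfderiv]
  rfl

lemma metricCoeff_transpose (g : Metric ι X) (φ : OpenPartialHomeomorph X (Coord ι))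
    (y : Coord ι) : (metricCoeff g φ y).transpose = metricCoeff g φ y := by
  ext i j
  exact pullForm_symm _ _ _ _ _

lemma mfderiv_symm_injective {φ : OpenPartialHomeomorph X (Coord ι)} (hφ : φ ∈ charts ι X)
    {y : Coord ι} (hy : y ∈ φ.target) :
    Function.Injective (mfderiv 𝓘(ℝ, Coord ι) 𝓘(ℝ, Coord ι) φ.symm y) := by
  have h : φ.MDifferentiable 𝓘(ℝ, Coord ι) 𝓘(ℝ, Coord ι) :=
    ⟨(contMDiffOn_of_mem_maximalAtlas hφ).mdifferentiableOn (by simp),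
      (contMDiffOn_symm_of_mem_maximalAtlas hφ).mdifferentiableOn (by simp)⟩
  exact h.symm.mfderiv_injective hy

lemma mfderiv_symm_surjective {φ : OpenPartialHomeomorph X (Coord ι)} (hφ : φ ∈ charts ι X)
    {y : Coord ι} (hy : y ∈ φ.target) :
    Function.Surjective (mfderiv 𝓘(ℝ, Coord ι) 𝓘(ℝ, Coord ι) φ.symm y) := by
  have h : φ.MDifferentiable 𝓘(ℝ, Coord ι) 𝓘(ℝ, Coord ι) :=
    ⟨(contMDiffOn_of_mem_maximalAtlas hφ).mdifferentiableOn (by simp),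
      (contMDiffOn_symm_of_mem_maximalAtlas hφ).mdifferentiableOn (by simp)⟩
  exact h.symm.mfderiv_surjective hy

lemma pullForm_pos (g : Metric ι X) {f : F → X} {z u : F}
    (hu : mfderiv 𝓘(ℝ, F) 𝓘(ℝ, Coord ι) f z u ≠ 0) : 0 < pullForm g f z u u :=
  g.pos _ _ hu

lemma posDef_of_bilinForm {κ : Type*} [Fintype κ] [DecidableEq κ] {V : Type*} [AddCommGroup V]
    [Module ℝ V] (Q : LinearMap.BilinForm ℝ V) (hs : ∀ u w, Q u w = Q w u)
    (hpos : ∀ u, u ≠ 0 → 0 < Q u u) {v : κ → V} (hv : LinearIndependent ℝ v) :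
    (Matrix.of fun i j => Q (v i) (v j)).PosDef := by
  refine Matrix.PosDef.of_dotProduct_mulVec_pos (Matrix.IsHermitian.ext fun i j => hs _ _) ?_
  intro x hx
  have h1 : star x ⬝ᵥ (Matrix.of fun i j => Q (v i) (v j)).mulVec x =
      Q (∑ i, x i • v i) (∑ i, x i • v i) := by
    simp only [dotProduct, Matrix.mulVec, Matrix.of_apply, map_sum, map_smul, LinearMap.sum_apply,
      LinearMap.smul_apply, smul_eq_mul, Pi.star_apply, star_trivial, Finset.mul_sum]
    rw [Finset.sum_comm]
    exact Finset.sum_congr rfl fun i _ => Finset.sum_congr rfl fun j _ => by ring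
  rw [h1]
  refine hpos _ fun h0 => hx ?_
  funext i
  exact Fintype.linearIndependent_iff.1 hv x h0 i

lemma metricCoeff_posDef (g : Metric ι X) {φ : OpenPartialHomeomorph X (Coord ι)}
    (hφ : φ ∈ charts ι X) {y : Coord ι} (hy : y ∈ φ.target) : (metricCoeff g φ y).PosDef := by
  refine posDef_of_bilinForm (pullForm g φ.symm y) (pullForm_symm g φ.symm y)
    (fun u hu => pullForm_pos g fun h0 => hu ?_)
    (v := fun i => (EuclideanSpace.single i 1 : Coord ι)) ?_
  · exact mfderiv_symm_injective hφ hy (h0.trans (map_zero _).symm)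
  · have := (EuclideanSpace.basisFun ι ℝ).toBasis.linearIndependent
    have h2 : (⇑(EuclideanSpace.basisFun ι ℝ).toBasis : ι → Coord ι) =
        fun i => EuclideanSpace.single i 1 := by
      funext i; simp
    rw [h2] at this
    exact this

/-- Coordinate fields are the tangent map of `φ.symm` applied to constant vectors, hence smooth in
the tangent bundle along `φ.symm`; the metric, a smooth section of a bundle of bilinear maps, is
then applied to two of them. -/
lemma smoothMatAt_metricCoeff (g : Metric ι X) {φ : OpenPartialHomeomorph X (Coord ι)}
    (hφ : φ ∈ charts ι X) {y : Coord ι} (hy : y ∈ φ.target) : SmoothMatAt (metricCoeff g φ) y := by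
  intro i j
  have hsec : ∀ i : ι, ContMDiffAt 𝓘(ℝ, Coord ι) (𝓘(ℝ, Coord ι).prod 𝓘(ℝ, Coord ι)) ∞
      (fun z => (TotalSpace.mk' (Coord ι) (φ.symm z) (coordVec φ z i) :
        TangentBundle 𝓘(ℝ, Coord ι) X)) y := by
    intro i
    have h1 := (contMDiffOn_symm_of_mem_maximalAtlas hφ).contMDiffOn_tangentMapWithin (m := ∞)
      le_rfl φ.open_target.uniqueMDiffOn
    have h2 : ContMDiffAt 𝓘(ℝ, Coord ι) 𝓘(ℝ, Coord ι).tangent ∞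
        (fun z : Coord ι => (TotalSpace.mk' (Coord ι) z (EuclideanSpace.single i (1 : ℝ)) :
          TangentBundle 𝓘(ℝ, Coord ι) (Coord ι))) y :=
      contMDiffAt_vectorSpace_iff_contDiffAt.2 contDiffAt_const
    have h3 := (h1 ⟨y, EuclideanSpace.single i (1 : ℝ)⟩ hy).contMDiffAt
      ((φ.open_target.preimage (FiberBundle.continuous_proj (Coord ι) _)).mem_nhds hy)
    have h4 := h3.comp y h2
    refine h4.congr_of_eventuallyEq ?_
    filter_upwards [φ.open_target.mem_nhds hy] with z hz
    simp only [Function.comp_apply, tangentMapWithin, coordVec]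
    rw [mfderivWithin_of_isOpen φ.open_target hz]
  have h5 : ContMDiffAt 𝓘(ℝ, Coord ι) (𝓘(ℝ, Coord ι).prod 𝓘(ℝ)) ∞
      (fun z => TotalSpace.mk' ℝ (E := Bundle.Trivial X ℝ) (φ.symm z)
        (g.inner (φ.symm z) (coordVec φ z i) (coordVec φ z j))) y := by
    apply ContMDiffAt.clm_bundle_apply₂ (F₁ := Coord ι) (F₂ := Coord ι)
    · exact ContMDiffAt.comp y g.contMDiff.contMDiffAt (contMDiffAt_symm_of_mem_maximalAtlas hφ hy)
    · exact hsec i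
    · exact hsec j
  simp only [contMDiffAt_totalSpace] at h5
  exact contMDiffAt_iff_contDiffAt.1 h5.2

end PullbackForm

/-! ### Linear coordinates on base times Lie algebra, with a shear. -/

section ShearCoordinates

variable {n N : ℕ}

/-- The linear coordinates on `Coord (Fin n) × Coord (Fin N)` given by a basis of the second factor
and sheared by a linear map. -/
def shearEquiv (v : Module.Basis (Fin N) ℝ (Coord (Fin N))) (a : Matrix (Fin N) (Fin n) ℝ) :
    (Coord (Fin n) × Coord (Fin N)) ≃L[ℝ] Coord (Fin n ⊕ Fin N) :=
  LinearEquiv.toContinuousLinearEquiv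
    { toFun := fun p => WithLp.toLp 2 (Sum.elim (fun α => p.1 α)
        fun I => v.repr p.2 I + ∑ α, a I α * p.1 α)
      map_add' := fun p q => by
        ext k; cases k
        · simp
        · simp [mul_add, Finset.sum_add_distrib]; ring
      map_smul' := fun c p => by
        ext k; cases k
        · simp
        · simp [mul_add, Finset.mul_sum, mul_left_comm]
      invFun := fun z => (baseProj _ _ z,
        ∑ I, (z (Sum.inr I) - ∑ α, a I α * z (Sum.inl α)) • v I)
      left_inv := fun p => by
        ext α
        · simp
        · simp [v.sum_repr]
      right_inv := fun z => by
        ext k; cases k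
        · simp
        · simp [Finsupp.single_apply] }

variable (v : Module.Basis (Fin N) ℝ (Coord (Fin N))) (a : Matrix (Fin N) (Fin n) ℝ)

@[simp] lemma baseProj_shearEquiv (p : Coord (Fin n) × Coord (Fin N)) :
    baseProj (Fin n) (Fin N) (shearEquiv v a p) = p.1 := rfl

@[simp] lemma shearEquiv_symm_fst (z : Coord (Fin n ⊕ Fin N)) :
    ((shearEquiv v a).symm z).1 = baseProj (Fin n) (Fin N) z := rfl

lemma shearEquiv_zero_basis (I : Fin N) :
    shearEquiv v a (0, v I) = EuclideanSpace.single (Sum.inr I) (1 : ℝ) := by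
  ext k
  cases k with
  | inl α => simp [shearEquiv]
  | inr J => simp [shearEquiv, Finsupp.single_apply, eq_comm]

/-- The fiber components acquired by base vectors are what changes the connection matrix from `A` to
`A - a` in the sheared coordinates. -/
lemma shearEquiv_single_zero (α : Fin n) :
    shearEquiv v a (EuclideanSpace.single α 1, 0) = EuclideanSpace.single (Sum.inl α) (1 : ℝ)
      + ∑ I, a I α • EuclideanSpace.single (Sum.inr I) (1 : ℝ) := by
  ext k
  cases k with
  | inl β => simp [shearEquiv]
  | inr J => simp [shearEquiv, Pi.single_apply]

end ShearCoordinates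

/-! ### Charts of the total space built from a trivialization. -/

section AdaptedChart

variable {n N : ℕ}
variable {B : Type*} [TopologicalSpace B] [ChartedSpace (Coord (Fin n)) B]
  [IsManifold 𝓘(ℝ, Coord (Fin n)) ∞ B]
variable {M : Type*} [TopologicalSpace M] [ChartedSpace (Coord (Fin n ⊕ Fin N)) M]
  [IsManifold 𝓘(ℝ, Coord (Fin n ⊕ Fin N)) ∞ M]
variable {𝒢 : Type*} [CommGroup 𝒢] [TopologicalSpace 𝒢] [ChartedSpace (Coord (Fin N)) 𝒢]
variable {proj : M → B}

/-- The chart of `M` given by a local trivialization, charts of the base and of the fiber, and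
linear coordinates. -/
def adaptedChart (e : Trivialization 𝒢 proj) (φ : OpenPartialHomeomorph B (Coord (Fin n)))
    (ψ : OpenPartialHomeomorph 𝒢 (Coord (Fin N))) (v : Module.Basis (Fin N) ℝ (Coord (Fin N)))
    (a : Matrix (Fin N) (Fin n) ℝ) : OpenPartialHomeomorph M (Coord (Fin n ⊕ Fin N)) :=
  (e.toOpenPartialHomeomorph.trans (φ.prod ψ)).trans
    (shearEquiv v a).toHomeomorph.toOpenPartialHomeomorph

section

variable (e : Trivialization 𝒢 proj) (φ : OpenPartialHomeomorph B (Coord (Fin n)))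
    (ψ : OpenPartialHomeomorph 𝒢 (Coord (Fin N))) (v : Module.Basis (Fin N) ℝ (Coord (Fin N)))
    (a : Matrix (Fin N) (Fin n) ℝ)

lemma adaptedChart_symm_apply (z : Coord (Fin n ⊕ Fin N)) :
    (adaptedChart e φ ψ v a).symm z = e.toOpenPartialHomeomorph.symm
      (φ.symm ((shearEquiv v a).symm z).1, ψ.symm ((shearEquiv v a).symm z).2) := rfl

lemma mem_adaptedChart_target (z : Coord (Fin n ⊕ Fin N)) :
    z ∈ (adaptedChart e φ ψ v a).target ↔ ((shearEquiv v a).symm z).1 ∈ φ.target ∧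
      φ.symm ((shearEquiv v a).symm z).1 ∈ e.baseSet ∧ ((shearEquiv v a).symm z).2 ∈ ψ.target := by
  have h : (φ.symm ((shearEquiv v a).symm z).1, ψ.symm ((shearEquiv v a).symm z).2) ∈ e.target ↔
      φ.symm ((shearEquiv v a).symm z).1 ∈ e.baseSet := e.mem_target
  simp only [adaptedChart, OpenPartialHomeomorph.trans_target, mem_inter_iff, mem_preimage,
    OpenPartialHomeomorph.prod_target]
  constructor
  · rintro ⟨-, ⟨h1, h2⟩, h3⟩
    exact ⟨h1, h.1 h3, h2⟩
  · rintro ⟨h1, h2, h3⟩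
    exact ⟨trivial, ⟨h1, h3⟩, h.2 h2⟩

lemma mem_adaptedChart_source (p : M) :
    p ∈ (adaptedChart e φ ψ v a).source ↔ p ∈ e.source ∧ (e p).1 ∈ φ.source ∧ (e p).2 ∈ ψ.source := by
  simp only [adaptedChart, OpenPartialHomeomorph.trans_source, mem_inter_iff, mem_preimage,
    OpenPartialHomeomorph.prod_source]
  constructor
  · rintro ⟨⟨h1, h2, h3⟩, -⟩
    exact ⟨h1, h2, h3⟩
  · rintro ⟨h1, h2, h3⟩
    exact ⟨⟨h1, h2, h3⟩, trivial⟩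

end

variable [LieGroup 𝓘(ℝ, Coord (Fin N)) ∞ 𝒢]

/-- Membership in the maximal atlas allows the Einstein equation, assumed in all smooth charts, to
be evaluated in these coordinates. -/
lemma adaptedChart_mem_charts (P : TwistedPrincipalBundle (n := n) (N := N) 𝒢 proj)
    {e : Trivialization 𝒢 proj} (he : e ∈ P.atlas) {φ : OpenPartialHomeomorph B (Coord (Fin n))}
    (hφ : φ ∈ charts (Fin n) B) {ψ : OpenPartialHomeomorph 𝒢 (Coord (Fin N))}
    (hψ : ψ ∈ charts (Fin N) 𝒢) (v : Module.Basis (Fin N) ℝ (Coord (Fin N)))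
    (a : Matrix (Fin N) (Fin n) ℝ) : adaptedChart e φ ψ v a ∈ charts (Fin n ⊕ Fin N) M := by
  refine OpenPartialHomeomorph.mem_maximalAtlas_of_contMDiffOn _ ?_ ?_
  · intro p hp
    obtain ⟨h1, h2, h3⟩ := (mem_adaptedChart_source e φ ψ v a p).1 hp
    have he' : ContMDiffAt 𝓘(ℝ, Coord (Fin n ⊕ Fin N))
        (𝓘(ℝ, Coord (Fin n)).prod 𝓘(ℝ, Coord (Fin N))) ∞ e p :=
      (P.contMDiffOn e he).contMDiffAt (e.open_source.mem_nhds h1)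
    have h4 : ContMDiffAt 𝓘(ℝ, Coord (Fin n ⊕ Fin N)) 𝓘(ℝ, Coord (Fin n)) ∞
        (fun q => φ (e q).1) p :=
      ContMDiffAt.comp p (g := φ) (f := fun q => (e q).1) (contMDiffAt_of_mem_maximalAtlas hφ h2)
        he'.fst
    have h5 : ContMDiffAt 𝓘(ℝ, Coord (Fin n ⊕ Fin N)) 𝓘(ℝ, Coord (Fin N)) ∞
        (fun q => ψ (e q).2) p :=
      ContMDiffAt.comp p (g := ψ) (f := fun q => (e q).2) (contMDiffAt_of_mem_maximalAtlas hψ h3)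
        he'.snd
    exact (ContMDiffAt.comp p (g := shearEquiv v a) (f := fun q => (φ (e q).1, ψ (e q).2))
      (shearEquiv v a).contDiff.contMDiff.contMDiffAt (h4.prodMk_space h5)).contMDiffWithinAt
  · intro z hz
    obtain ⟨h1, h2, h3⟩ := (mem_adaptedChart_target e φ ψ v a z).1 hz
    have h4 : ContMDiffAt 𝓘(ℝ, Coord (Fin n ⊕ Fin N)) 𝓘(ℝ, Coord (Fin n)) ∞
        (fun q => φ.symm ((shearEquiv v a).symm q).1) z :=
      ContMDiffAt.comp z (g := φ.symm) (f := fun q => ((shearEquiv v a).symm q).1)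
        (contMDiffAt_symm_of_mem_maximalAtlas hφ h1)
        (contDiff_fst.comp (shearEquiv v a).symm.contDiff).contMDiff.contMDiffAt
    have h5 : ContMDiffAt 𝓘(ℝ, Coord (Fin n ⊕ Fin N)) 𝓘(ℝ, Coord (Fin N)) ∞
        (fun q => ψ.symm ((shearEquiv v a).symm q).2) z :=
      ContMDiffAt.comp z (g := ψ.symm) (f := fun q => ((shearEquiv v a).symm q).2)
        (contMDiffAt_symm_of_mem_maximalAtlas hψ h3)
        (contDiff_snd.comp (shearEquiv v a).symm.contDiff).contMDiff.contMDiffAt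
    have h6 := (P.contMDiffOn_symm e he).contMDiffAt (e.open_target.mem_nhds
      (x := (φ.symm ((shearEquiv v a).symm z).1, ψ.symm ((shearEquiv v a).symm z).2))
      (e.mem_target.2 h2))
    exact (ContMDiffAt.comp z (g := e.toOpenPartialHomeomorph.symm) h6
      (h4.prodMk h5)).contMDiffWithinAt

end AdaptedChart

/-! ### Translation invariance of the metric in logarithmic fiber coordinates. -/

section AdaptedMetric

variable {n N : ℕ}
variable {B : Type*} [TopologicalSpace B] [ChartedSpace (Coord (Fin n)) B]
  [IsManifold 𝓘(ℝ, Coord (Fin n)) ∞ B]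
variable {M : Type*} [TopologicalSpace M] [ChartedSpace (Coord (Fin n ⊕ Fin N)) M]
  [IsManifold 𝓘(ℝ, Coord (Fin n ⊕ Fin N)) ∞ M]
variable {𝒢 : Type*} [CommGroup 𝒢] [TopologicalSpace 𝒢] [ChartedSpace (Coord (Fin N)) 𝒢]
variable {proj : M → B}

/-- A chart at the identity that is locally a homomorphism to the Lie algebra. -/
structure IsLogChart (ψ : OpenPartialHomeomorph 𝒢 (Coord (Fin N))) : Prop where
  mem_charts : ψ ∈ charts (Fin N) 𝒢
  symm_zero : ψ.symm 0 = 1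
  zero_mem : (0 : Coord (Fin N)) ∈ ψ.target
  deriv_symm : derivCoord (Fin N) ψ.symm 0 = ContinuousLinearMap.id ℝ (Coord (Fin N))
  symm_sub : ∀ w ∈ ψ.target, ∀ᶠ w' in 𝓝 w, ψ.symm w' = ψ.symm w * ψ.symm (w' - w)

variable [LieGroup 𝓘(ℝ, Coord (Fin N)) ∞ 𝒢]

variable (N 𝒢) in
-- The manifold derivative at `0` is computed in the preferred chart at the identity. The
-- logarithmic chart is built from that same chart with normalized differential, so this derivative
-- is the identity.
lemma exists_isLogChart : ∃ ψ : OpenPartialHomeomorph 𝒢 (Coord (Fin N)), IsLogChart ψ := by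
  obtain ⟨ψ, h1, h2, h3, -, h5, h6⟩ := exists_log_chart (𝒢 := 𝒢) (E := Coord (Fin N))
    (IsManifold.chart_mem_maximalAtlas (1 : 𝒢)) (mem_chart_source _ (1 : 𝒢))
  have h0 : (0 : Coord (Fin N)) ∈ ψ.target := h3 ▸ ψ.map_source h2
  have h7 : ψ.symm 0 = 1 := by rw [← h3, ψ.left_inv h2]
  refine ⟨ψ, h1, h7, h0, ?_, h6⟩
  have h8 : HasMFDerivAt 𝓘(ℝ, Coord (Fin N)) 𝓘(ℝ, Coord (Fin N)) ψ.symm 0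
      (ContinuousLinearMap.id ℝ (Coord (Fin N))) := by
    refine ⟨ψ.continuousAt_symm h0, ?_⟩
    rw [writtenInExtChartAt, h7]
    exact h5.hasFDerivWithinAt
  exact h8.mfderiv

lemma contMDiffAt_localAct (P : TwistedPrincipalBundle (n := n) (N := N) 𝒢 proj)
    {e : Trivialization 𝒢 proj} (he : e ∈ P.atlas) (h : 𝒢) {p : M} (hp : p ∈ e.source) :
    ContMDiffAt 𝓘(ℝ, Coord (Fin n ⊕ Fin N)) 𝓘(ℝ, Coord (Fin n ⊕ Fin N)) ∞ (localAct e h) p := by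
  have he' : ContMDiffAt 𝓘(ℝ, Coord (Fin n ⊕ Fin N))
      (𝓘(ℝ, Coord (Fin n)).prod 𝓘(ℝ, Coord (Fin N))) ∞ e p :=
    (P.contMDiffOn e he).contMDiffAt (e.open_source.mem_nhds hp)
  have h6 := (P.contMDiffOn_symm e he).contMDiffAt (e.open_target.mem_nhds
    (x := ((e p).1, h * (e p).2)) (e.mem_target.2 ((e.mem_target (x := e p)).1 (e.map_source hp))))
  have h7 := ContMDiffAt.comp p (g := e.toOpenPartialHomeomorph.symm)
    (f := fun q => ((e q).1, h * (e q).2)) h6 (he'.fst.prodMk (contMDiffAt_const.mul he'.snd))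
  refine h7.congr_of_eventuallyEq ?_
  filter_upwards [e.open_source.mem_nhds hp] with q hq
  simp only [localAct, Function.comp_apply, e.coe_fst hq]

lemma pullForm_localAct {P : TwistedPrincipalBundle (n := n) (N := N) 𝒢 proj}
    {gM : Metric (Fin n ⊕ Fin N) M} (hinv : P.IsInvariantMetric gM)
    {e : Trivialization 𝒢 proj} (he : e ∈ P.atlas) (h : 𝒢) {F : Type*} [NormedAddCommGroup F]
    [NormedSpace ℝ F] {f : F → M} {z : F}
    (hf : MDifferentiableAt 𝓘(ℝ, F) 𝓘(ℝ, Coord (Fin n ⊕ Fin N)) f z) (hz : f z ∈ e.source) :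
    pullForm gM (fun z' => localAct e h (f z')) z = pullForm gM f z := by
  ext u w
  have h1 := (contMDiffAt_localAct P he h hz).mdifferentiableAt (by simp)
  have h2 := mfderiv_comp_apply z h1 hf u
  have h3 := mfderiv_comp_apply z h1 hf w
  have h4 := hinv e he h (f z) hz (mfderiv 𝓘(ℝ, F) 𝓘(ℝ, Coord (Fin n ⊕ Fin N)) f z u)
    (mfderiv 𝓘(ℝ, F) 𝓘(ℝ, Coord (Fin n ⊕ Fin N)) f z w)
  rw [← h2, ← h3] at h4
  exact h4

lemma localAct_symm {e : Trivialization 𝒢 proj} (h : 𝒢) {b : B} (hb : b ∈ e.baseSet) (x : 𝒢) :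
    localAct e h (e.toOpenPartialHomeomorph.symm (b, x)) =
      e.toOpenPartialHomeomorph.symm (b, h * x) := by
  have hmem : (b, x) ∈ e.target := e.mem_target.2 hb
  rw [localAct, e.proj_symm_apply hmem, e.apply_symm_apply hmem]

variable {e : Trivialization 𝒢 proj} {φ : OpenPartialHomeomorph B (Coord (Fin n))}
    {ψ : OpenPartialHomeomorph 𝒢 (Coord (Fin N))} (v : Module.Basis (Fin N) ℝ (Coord (Fin N)))
    (a : Matrix (Fin N) (Fin n) ℝ) {P : TwistedPrincipalBundle (n := n) (N := N) 𝒢 proj}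

lemma mdifferentiableAt_adaptedChart_symm (he : e ∈ P.atlas) (hφ : φ ∈ charts (Fin n) B)
    (hψ : IsLogChart ψ) {z : Coord (Fin n ⊕ Fin N)} (hz : z ∈ (adaptedChart e φ ψ v a).target) :
    MDifferentiableAt 𝓘(ℝ, Coord (Fin n ⊕ Fin N)) 𝓘(ℝ, Coord (Fin n ⊕ Fin N))
      (adaptedChart e φ ψ v a).symm z :=
  (contMDiffAt_symm_of_mem_maximalAtlas
    (adaptedChart_mem_charts P he hφ hψ.mem_charts v a) hz).mdifferentiableAt (by simp)

/-- The metric does not depend on the fiber coordinates. -/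
lemma pullForm_adaptedChart (he : e ∈ P.atlas) (hφ : φ ∈ charts (Fin n) B) (hψ : IsLogChart ψ)
    {gM : Metric (Fin n ⊕ Fin N) M} (hinv : P.IsInvariantMetric gM)
    {z : Coord (Fin n ⊕ Fin N)} (hz : z ∈ (adaptedChart e φ ψ v a).target) :
    pullForm gM (adaptedChart e φ ψ v a).symm z =
      pullForm gM (adaptedChart e φ ψ v a).symm
        (shearEquiv v a (baseProj (Fin n) (Fin N) z, 0)) := by
  obtain ⟨h1, h2, h3⟩ := (mem_adaptedChart_target e φ ψ v a z).1 hz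
  set w := ((shearEquiv v a).symm z).2 with hw
  -- The group element that moves the given point of the fiber onto the section `x = 1`.
  set h := (ψ.symm w)⁻¹ with hh
  set c := shearEquiv v a (0, w) with hc
  have hzc : shearEquiv v a (baseProj (Fin n) (Fin N) z, 0) = z - c := by
    rw [eq_sub_iff_add_eq, hc, ← map_add, Prod.mk_add_mk, add_zero, zero_add]
    exact (shearEquiv v a).apply_symm_apply z
  have hzc' : z - c ∈ (adaptedChart e φ ψ v a).target := by
    rw [← hzc, mem_adaptedChart_target, ContinuousLinearEquiv.symm_apply_apply]
    exact ⟨h1, h2, hψ.zero_mem⟩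
  -- Because the logarithmic chart is a local homomorphism, the action of `h` reads as translation
  -- by `-c` near `z`.
  have hloc : (fun z' => localAct e h ((adaptedChart e φ ψ v a).symm z')) =ᶠ[𝓝 z]
      fun z' => (adaptedChart e φ ψ v a).symm (z' - c) := by
    have hcont : ContinuousAt (fun z' => ((shearEquiv v a).symm z').2) z :=
      (continuous_snd.comp (shearEquiv v a).symm.continuous).continuousAt
    filter_upwards [(adaptedChart e φ ψ v a).open_target.mem_nhds hz,
      hcont.eventually (hψ.symm_sub w h3)] with z' hz' hz2
    obtain ⟨-, h2', -⟩ := (mem_adaptedChart_target e φ ψ v a z').1 hz'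
    rw [adaptedChart_symm_apply, adaptedChart_symm_apply, localAct_symm h h2', map_sub, hc,
      ContinuousLinearEquiv.symm_apply_apply, hz2, hh, inv_mul_cancel_left, Prod.fst_sub,
      Prod.snd_sub, sub_zero]
  have hsrc : (adaptedChart e φ ψ v a).symm z ∈ e.source :=
    ((mem_adaptedChart_source e φ ψ v a _).1 ((adaptedChart e φ ψ v a).map_target hz)).1
  rw [hzc, ← pullForm_comp_sub gM (mdifferentiableAt_adaptedChart_symm v a he hφ hψ hzc'),
    ← pullForm_congr gM hloc,
    pullForm_localAct hinv he h (mdifferentiableAt_adaptedChart_symm v a he hφ hψ hz) hsrc]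

lemma adaptedChart_symm_zeroSection (hψ : IsLogChart ψ) (y : Coord (Fin n)) :
    (adaptedChart e φ ψ v a).symm (shearEquiv v a (y, 0)) = localSection e (φ.symm y) := by
  rw [adaptedChart_symm_apply, ContinuousLinearEquiv.symm_apply_apply]
  simp only [hψ.symm_zero, localSection]

lemma zeroSection_mem_target (hψ : IsLogChart ψ) {y : Coord (Fin n)} (hy : y ∈ φ.target)
    (hb : φ.symm y ∈ e.baseSet) :
    shearEquiv v a (y, 0) ∈ (adaptedChart e φ ψ v a).target := by
  rw [mem_adaptedChart_target, ContinuousLinearEquiv.symm_apply_apply]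
  exact ⟨hy, hb, hψ.zero_mem⟩

/-- Identifies the vector induced by the Lie algebra with a derivative in the adapted chart; the
normalization of the differential of `ψ.symm` at `0` ensures that no linear factor appears. -/
lemma vertVec_eq (he : e ∈ P.atlas) (hφ : φ ∈ charts (Fin n) B) (hψ : IsLogChart ψ)
    {y : Coord (Fin n)} (hy : y ∈ φ.target) (hb : φ.symm y ∈ e.baseSet) (w : Coord (Fin N)) :
    (vertVec e (φ.symm y) w : Coord (Fin n ⊕ Fin N)) =
      derivCoord (Fin n ⊕ Fin N) (adaptedChart e φ ψ v a).symm (shearEquiv v a (y, 0))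
        (shearEquiv v a (0, w)) := by
  have h1 : MDifferentiableAt 𝓘(ℝ, Coord (Fin N)) 𝓘(ℝ, Coord (Fin n ⊕ Fin N))
      (fun h : 𝒢 => e.toOpenPartialHomeomorph.symm (φ.symm y, h)) 1 := by
    have h2 := (P.contMDiffOn_symm e he).contMDiffAt (e.open_target.mem_nhds
      (x := (φ.symm y, (1 : 𝒢))) (e.mem_target.2 hb))
    exact (ContMDiffAt.comp (1 : 𝒢) (g := e.toOpenPartialHomeomorph.symm)
      (f := fun h : 𝒢 => (φ.symm y, h)) h2
      (contMDiffAt_const.prodMk contMDiffAt_id)).mdifferentiableAt (by simp)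
  have h3 : MDifferentiableAt 𝓘(ℝ, Coord (Fin N)) 𝓘(ℝ, Coord (Fin N)) ψ.symm 0 :=
    (contMDiffAt_symm_of_mem_maximalAtlas hψ.mem_charts hψ.zero_mem).mdifferentiableAt (by simp)
  have h4 := mfderiv_comp_apply_of_eq 0 h1 h3 hψ.symm_zero w
  have h5 : (mfderiv 𝓘(ℝ, Coord (Fin N)) 𝓘(ℝ, Coord (Fin N)) ψ.symm 0 w : Coord (Fin N)) = w :=
    congrArg (fun L : Coord (Fin N) →L[ℝ] Coord (Fin N) => L w) hψ.deriv_symm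
  have h6 := mdifferentiableAt_adaptedChart_symm v a he hφ hψ
    (zeroSection_mem_target v a hψ hy hb)
  have h7 : HasFDerivAt (fun w' : Coord (Fin N) => shearEquiv v a (y, w'))
      ((shearEquiv v a : _ →L[ℝ] _).comp (ContinuousLinearMap.inr ℝ _ _)) 0 :=
    HasFDerivAt.comp (0 : Coord (Fin N)) (g := shearEquiv v a) (shearEquiv v a).hasFDerivAt
      (hasFDerivAt_prodMk_right y 0)
  have h8 := (HasMFDerivAt.comp (0 : Coord (Fin N)) (g := (adaptedChart e φ ψ v a).symm)
    h6.hasMFDerivAt h7.hasMFDerivAt).mfderiv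
  have h9 : (adaptedChart e φ ψ v a).symm ∘ (fun w' : Coord (Fin N) => shearEquiv v a (y, w')) =
      (fun h : 𝒢 => e.toOpenPartialHomeomorph.symm (φ.symm y, h)) ∘ ψ.symm := by
    funext w'
    simp only [Function.comp_apply, adaptedChart_symm_apply,
      ContinuousLinearEquiv.symm_apply_apply]
  rw [h9] at h8
  have h10 := congrArg (fun L : Coord (Fin N) →L[ℝ] Coord (Fin n ⊕ Fin N) => L w) h8
  have h11 : (vertVec e (φ.symm y) w : Coord (Fin n ⊕ Fin N)) =
      mfderiv 𝓘(ℝ, Coord (Fin N)) 𝓘(ℝ, Coord (Fin n ⊕ Fin N))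
        (fun h : 𝒢 => e.toOpenPartialHomeomorph.symm (φ.symm y, h)) 1
        (mfderiv 𝓘(ℝ, Coord (Fin N)) 𝓘(ℝ, Coord (Fin N)) ψ.symm 0 w) := by
    rw [h5]; rfl
  rw [h11]
  exact h4.symm.trans h10

lemma mfderiv_localSection_eq (he : e ∈ P.atlas) (hφ : φ ∈ charts (Fin n) B) (hψ : IsLogChart ψ)
    {y : Coord (Fin n)} (hy : y ∈ φ.target) (hb : φ.symm y ∈ e.baseSet) (α : Fin n) :
    (mfderiv 𝓘(ℝ, Coord (Fin n)) 𝓘(ℝ, Coord (Fin n ⊕ Fin N)) (localSection e) (φ.symm y)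
        (coordVec φ y α) : Coord (Fin n ⊕ Fin N)) =
      derivCoord (Fin n ⊕ Fin N) (adaptedChart e φ ψ v a).symm (shearEquiv v a (y, 0))
        (shearEquiv v a (EuclideanSpace.single α 1, 0)) := by
  have h1 : MDifferentiableAt 𝓘(ℝ, Coord (Fin n)) 𝓘(ℝ, Coord (Fin n ⊕ Fin N))
      (localSection e) (φ.symm y) := by
    have h2 := (P.contMDiffOn_symm e he).contMDiffAt (e.open_target.mem_nhds
      (x := (φ.symm y, (1 : 𝒢))) (e.mem_target.2 hb))
    exact (ContMDiffAt.comp (φ.symm y) (g := e.toOpenPartialHomeomorph.symm)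
      (f := fun b : B => (b, (1 : 𝒢))) h2
      (contMDiffAt_id.prodMk contMDiffAt_const)).mdifferentiableAt (by simp)
  have h3 : MDifferentiableAt 𝓘(ℝ, Coord (Fin n)) 𝓘(ℝ, Coord (Fin n)) φ.symm y :=
    (contMDiffAt_symm_of_mem_maximalAtlas hφ hy).mdifferentiableAt (by simp)
  have h4 := mfderiv_comp_apply y h1 h3 (EuclideanSpace.single α (1 : ℝ) : Coord (Fin n))
  have h6 := mdifferentiableAt_adaptedChart_symm v a he hφ hψ
    (zeroSection_mem_target v a hψ hy hb)
  have h7 : HasFDerivAt (fun y' : Coord (Fin n) => shearEquiv v a (y', 0))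
      ((shearEquiv v a : _ →L[ℝ] _).comp (ContinuousLinearMap.inl ℝ _ _)) y :=
    HasFDerivAt.comp y (g := shearEquiv v a) (shearEquiv v a).hasFDerivAt
      (hasFDerivAt_prodMk_left y 0)
  have h8 := (HasMFDerivAt.comp y (g := (adaptedChart e φ ψ v a).symm)
    h6.hasMFDerivAt h7.hasMFDerivAt).mfderiv
  have h9 : (adaptedChart e φ ψ v a).symm ∘ (fun y' : Coord (Fin n) => shearEquiv v a (y', 0)) =
      localSection e ∘ φ.symm := by
    funext y'
    exact adaptedChart_symm_zeroSection v a hψ y'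
  rw [h9] at h8
  have h10 := congrArg (fun L : Coord (Fin n) →L[ℝ] Coord (Fin n ⊕ Fin N) =>
    L (EuclideanSpace.single α (1 : ℝ))) h8
  exact h4.symm.trans h10

end AdaptedMetric

/-! ### Linear algebra of horizontal lifts and of the block form. -/

section BlockForm

variable {ι : Type} [Fintype ι] [DecidableEq ι]
variable {κ : Type} [Fintype κ] [DecidableEq κ]

/-- The horizontal lift of a coordinate vector, for the connection with components `A`. -/
def horizVec (A : Matrix κ ι ℝ) (α : ι) : Coord (ι ⊕ κ) :=
  EuclideanSpace.single (Sum.inl α) (1 : ℝ)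
    - ∑ I, A I α • EuclideanSpace.single (Sum.inr I) (1 : ℝ)

lemma baseProj_horizVec (A : Matrix κ ι ℝ) (α : ι) :
    baseProj ι κ (horizVec A α) = EuclideanSpace.single α (1 : ℝ) := by
  simp [horizVec, map_sub, map_sum, baseProj_single_inl, baseProj_single_inr]

lemma eq_sum_single_inr {ζ : Coord (ι ⊕ κ)} (h : baseProj ι κ ζ = 0) :
    ζ = ∑ I, ζ (Sum.inr I) • EuclideanSpace.single (Sum.inr I) (1 : ℝ) := by
  ext k
  cases k with
  | inl α =>
    have h1 : ζ (Sum.inl α) = 0 := congrArg (fun y : Coord ι => y α) h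
    simp [h1]
  | inr J => simp [Pi.single_apply]

variable {Q : LinearMap.BilinForm ℝ (Coord (ι ⊕ κ))} {G : Matrix κ κ ℝ} {A : Matrix κ ι ℝ}

lemma bilinForm_horizVec_single (hG : ∀ I J, Q (EuclideanSpace.single (Sum.inr I) 1)
      (EuclideanSpace.single (Sum.inr J) 1) = G I J)
    (hA : ∀ J α, Q (EuclideanSpace.single (Sum.inl α) 1)
      (EuclideanSpace.single (Sum.inr J) 1) = ∑ I, A I α * G I J) (α : ι) (J : κ) :
    Q (horizVec A α) (EuclideanSpace.single (Sum.inr J) 1) = 0 := by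
  simp only [horizVec, map_sub, map_sum, map_smul, LinearMap.sub_apply, LinearMap.sum_apply,
    LinearMap.smul_apply, hG, hA, smul_eq_mul, sub_self]

/-- Each base vector is split into its horizontal lift and a vertical part. The two are orthogonal,
so the base block is the form on lifts plus `Aᵀ G A`. -/
lemma bilinForm_eq_blockMetric {g : Matrix ι ι ℝ} (hs : ∀ u w, Q u w = Q w u)
    (hG : ∀ I J, Q (EuclideanSpace.single (Sum.inr I) 1)
      (EuclideanSpace.single (Sum.inr J) 1) = G I J)
    (hA : ∀ J α, Q (EuclideanSpace.single (Sum.inl α) 1)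
      (EuclideanSpace.single (Sum.inr J) 1) = ∑ I, A I α * G I J)
    (hg : ∀ α β, Q (horizVec A α) (horizVec A β) = g α β) :
    (Matrix.of fun k l : ι ⊕ κ => Q (EuclideanSpace.single k 1) (EuclideanSpace.single l 1)) =
      blockMetric g G A := by
  have hsym : ∀ I J, G I J = G J I := fun I J => by rw [← hG, ← hG, hs]
  have hl : ∀ α, (EuclideanSpace.single (Sum.inl α) (1 : ℝ) : Coord (ι ⊕ κ)) =
      horizVec A α + ∑ I, A I α • EuclideanSpace.single (Sum.inr I) (1 : ℝ) := fun α => by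
    simp [horizVec]
  ext k l
  rw [Matrix.of_apply]
  rcases k with α | I <;> rcases l with β | J
  · have h1 := bilinForm_horizVec_single hG hA
    have h2 : ∀ α J, Q (EuclideanSpace.single (Sum.inr J) 1) (horizVec A α) = 0 :=
      fun α J => by rw [hs, h1]
    rw [hl α, hl β]
    simp only [map_add, map_sum, map_smul, LinearMap.add_apply, LinearMap.sum_apply,
      LinearMap.smul_apply, hG, h1, h2, hg, smul_eq_mul, mul_zero, Finset.sum_const_zero,
      add_zero, zero_add, blockMetric, Matrix.fromBlocks_apply₁₁, Matrix.add_apply,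
      Matrix.mul_apply, Matrix.transpose_apply, Finset.sum_mul]
    congr 1
    exact Finset.sum_congr rfl fun J _ => by
      rw [Finset.mul_sum]; exact Finset.sum_congr rfl fun I _ => by ring
  · simp only [hA, blockMetric, Matrix.fromBlocks_apply₁₂, Matrix.mul_apply,
      Matrix.transpose_apply]
  · rw [hs]
    simp only [hA, blockMetric, Matrix.fromBlocks_apply₂₁, Matrix.mul_apply]
    exact Finset.sum_congr rfl fun J _ => by rw [hsym J I, mul_comm]
  · simp only [hG, blockMetric, Matrix.fromBlocks_apply₂₂]

end BlockForm

/-! ### The metric in adapted coordinates. -/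

section AdaptedMetric

variable {n N : ℕ}
variable {B : Type*} [TopologicalSpace B] [ChartedSpace (Coord (Fin n)) B]
  [IsManifold 𝓘(ℝ, Coord (Fin n)) ∞ B]
variable {M : Type*} [TopologicalSpace M] [ChartedSpace (Coord (Fin n ⊕ Fin N)) M]
  [IsManifold 𝓘(ℝ, Coord (Fin n ⊕ Fin N)) ∞ M]
variable {𝒢 : Type*} [CommGroup 𝒢] [TopologicalSpace 𝒢] [ChartedSpace (Coord (Fin N)) 𝒢]
  [LieGroup 𝓘(ℝ, Coord (Fin N)) ∞ 𝒢]
variable {proj : M → B}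
variable {e : Trivialization 𝒢 proj} {φ : OpenPartialHomeomorph B (Coord (Fin n))}
    {ψ : OpenPartialHomeomorph 𝒢 (Coord (Fin N))} (v : Module.Basis (Fin N) ℝ (Coord (Fin N)))
    (a : Matrix (Fin N) (Fin n) ℝ) {P : TwistedPrincipalBundle (n := n) (N := N) 𝒢 proj}
    (gM : Metric (Fin n ⊕ Fin N) M)

/-- The components of the connection as a matrix. -/
def connMat (gM : Metric (Fin n ⊕ Fin N) M) (e : Trivialization 𝒢 proj)
    (v : Module.Basis (Fin N) ℝ (Coord (Fin N))) (φ : OpenPartialHomeomorph B (Coord (Fin n)))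
    (y : Coord (Fin n)) : Matrix (Fin N) (Fin n) ℝ :=
  Matrix.of fun I α => connA gM e v φ I α y

/-- In adapted coordinates the bundle projection is the linear projection to the base coordinates.
-/
lemma mfderiv_proj_adaptedChart (he : e ∈ P.atlas) (hφ : φ ∈ charts (Fin n) B)
    (hψ : IsLogChart ψ) {z : Coord (Fin n ⊕ Fin N)} (hz : z ∈ (adaptedChart e φ ψ v a).target)
    (ζ : Coord (Fin n ⊕ Fin N)) :
    (mfderiv 𝓘(ℝ, Coord (Fin n ⊕ Fin N)) 𝓘(ℝ, Coord (Fin n)) proj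
      ((adaptedChart e φ ψ v a).symm z)
      (derivCoord (Fin n ⊕ Fin N) (adaptedChart e φ ψ v a).symm z ζ) : Coord (Fin n)) =
    derivCoord (Fin n) φ.symm (baseProj (Fin n) (Fin N) z) (baseProj (Fin n) (Fin N) ζ) := by
  have hsrc : (adaptedChart e φ ψ v a).symm z ∈ e.source :=
    ((mem_adaptedChart_source e φ ψ v a _).1 ((adaptedChart e φ ψ v a).map_target hz)).1
  have h1 : MDifferentiableAt 𝓘(ℝ, Coord (Fin n ⊕ Fin N)) 𝓘(ℝ, Coord (Fin n)) proj
      ((adaptedChart e φ ψ v a).symm z) := by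
    have he' : ContMDiffAt 𝓘(ℝ, Coord (Fin n ⊕ Fin N))
        (𝓘(ℝ, Coord (Fin n)).prod 𝓘(ℝ, Coord (Fin N))) ∞ e ((adaptedChart e φ ψ v a).symm z) :=
      (P.contMDiffOn e he).contMDiffAt (e.open_source.mem_nhds hsrc)
    refine (he'.fst.congr_of_eventuallyEq ?_).mdifferentiableAt (by simp)
    filter_upwards [e.open_source.mem_nhds hsrc] with q hq
    exact (e.coe_fst hq).symm
  have h2 := mdifferentiableAt_adaptedChart_symm v a he hφ hψ hz
  have h3 := mfderiv_comp_apply z h1 h2 ζ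
  have hy := ((mem_adaptedChart_target e φ ψ v a z).1 hz).1
  rw [shearEquiv_symm_fst] at hy
  have h4 : MDifferentiableAt 𝓘(ℝ, Coord (Fin n)) 𝓘(ℝ, Coord (Fin n)) φ.symm
      (baseProj (Fin n) (Fin N) z) :=
    (contMDiffAt_symm_of_mem_maximalAtlas hφ hy).mdifferentiableAt (by simp)
  have h5 := (HasMFDerivAt.comp z (g := φ.symm) h4.hasMFDerivAt
    (baseProj (Fin n) (Fin N)).hasFDerivAt.hasMFDerivAt).mfderiv
  have h6 : proj ∘ (adaptedChart e φ ψ v a).symm =ᶠ[𝓝 z] φ.symm ∘ baseProj (Fin n) (Fin N) := by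
    filter_upwards [(adaptedChart e φ ψ v a).open_target.mem_nhds hz] with z' hz'
    obtain ⟨-, h2', -⟩ := (mem_adaptedChart_target e φ ψ v a z').1 hz'
    rw [Function.comp_apply, adaptedChart_symm_apply, e.proj_symm_apply (e.mem_target.2 h2')]
    rfl
  have h7 : (mfderiv 𝓘(ℝ, Coord (Fin n ⊕ Fin N)) 𝓘(ℝ, Coord (Fin n))
      (proj ∘ (adaptedChart e φ ψ v a).symm) z : Coord (Fin n ⊕ Fin N) →L[ℝ] Coord (Fin n)) =
      mfderiv 𝓘(ℝ, Coord (Fin n ⊕ Fin N)) 𝓘(ℝ, Coord (Fin n))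
        (φ.symm ∘ baseProj (Fin n) (Fin N)) z := h6.mfderiv_eq
  have h8 := congrArg (fun L : Coord (Fin n ⊕ Fin N) →L[ℝ] Coord (Fin n) => L ζ) (h7.trans h5)
  exact h3.symm.trans h8

lemma matG_eq (he : e ∈ P.atlas) (hφ : φ ∈ charts (Fin n) B) (hψ : IsLogChart ψ)
    {y : Coord (Fin n)} (hy : y ∈ φ.target) (hb : φ.symm y ∈ e.baseSet) (I J : Fin N) :
    matG gM e v φ y I J = pullForm gM (adaptedChart e φ ψ v a).symm (shearEquiv v a (y, 0))
      (EuclideanSpace.single (Sum.inr I) 1) (EuclideanSpace.single (Sum.inr J) 1) := by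
  have h1 := vertVec_eq v a he hφ hψ hy hb (v I)
  have h2 := vertVec_eq v a he hφ hψ hy hb (v J)
  rw [shearEquiv_zero_basis] at h1 h2
  have h3 : matG gM e v φ y I J = innerCoord gM (localSection e (φ.symm y))
      (vertVec e (φ.symm y) (v I)) (vertVec e (φ.symm y) (v J)) := rfl
  rw [h1, h2, ← adaptedChart_symm_zeroSection (e := e) v a hψ y] at h3
  exact h3

/-- This matrix is a principal submatrix of the coefficient matrix of the metric of `M`. -/
lemma matG_posDef (he : e ∈ P.atlas) (hφ : φ ∈ charts (Fin n) B)
    {y : Coord (Fin n)} (hy : y ∈ φ.target) (hb : φ.symm y ∈ e.baseSet) :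
    (matG gM e v φ y).PosDef := by
  obtain ⟨ψ, hψ⟩ := exists_isLogChart N 𝒢
  have h1 := (metricCoeff_posDef gM (adaptedChart_mem_charts P he hφ hψ.mem_charts v 0)
    (zeroSection_mem_target v 0 hψ hy hb)).submatrix (e := (Sum.inr : Fin N → Fin n ⊕ Fin N))
    Sum.inr_injective
  have h2 : matG gM e v φ y = (metricCoeff gM (adaptedChart e φ ψ v 0)
      (shearEquiv v 0 (y, 0))).submatrix Sum.inr Sum.inr := by
    ext I J
    exact matG_eq v 0 gM he hφ hψ hy hb I J
  rw [h2]
  exact h1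

/-- Undoes the inverse of `G` in the definition of the connection components. -/
lemma connMat_mul_matG (he : e ∈ P.atlas) (hφ : φ ∈ charts (Fin n) B) (hψ : IsLogChart ψ)
    {y : Coord (Fin n)} (hy : y ∈ φ.target) (hb : φ.symm y ∈ e.baseSet) (α : Fin n) (J : Fin N) :
    ∑ I, connMat gM e v φ y I α * matG gM e v φ y I J =
      pullForm gM (adaptedChart e φ ψ v a).symm (shearEquiv v a (y, 0))
      (shearEquiv v a (EuclideanSpace.single α 1, 0)) (EuclideanSpace.single (Sum.inr J) 1) := by
  set q : Fin N → ℝ := fun J => gM.inner (localSection e (φ.symm y))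
      (mfderiv 𝓘(ℝ, Coord (Fin n)) 𝓘(ℝ, Coord (Fin n ⊕ Fin N)) (localSection e) (φ.symm y)
        (coordVec φ y α)) (vertVec e (φ.symm y) (v J)) with hq
  have hpd := matG_posDef v gM he hφ hy hb
  have hsym : (matG gM e v φ y).transpose = matG gM e v φ y := by
    simpa using hpd.isHermitian.eq
  have h1 : (fun I => connMat gM e v φ y I α) = (matG gM e v φ y)⁻¹.mulVec q := rfl
  have h2 : ∑ I, connMat gM e v φ y I α * matG gM e v φ y I J = q J := by
    have h3 : ∑ I, connMat gM e v φ y I α * matG gM e v φ y I J =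
        (matG gM e v φ y).transpose.mulVec (fun I => connMat gM e v φ y I α) J := by
      simp only [Matrix.mulVec, dotProduct, Matrix.transpose_apply]
      exact Finset.sum_congr rfl fun I _ => mul_comm _ _
    rw [h3, h1, hsym, Matrix.mulVec_mulVec, Matrix.mul_nonsing_inv _
      (isUnit_iff_ne_zero.2 hpd.det_pos.ne'), Matrix.one_mulVec]
  rw [h2]
  have h4 := mfderiv_localSection_eq v a he hφ hψ hy hb α
  have h5 := vertVec_eq v a he hφ hψ hy hb (v J)
  rw [shearEquiv_zero_basis] at h5
  have h6 : q J = innerCoord gM (localSection e (φ.symm y))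
      (mfderiv 𝓘(ℝ, Coord (Fin n)) 𝓘(ℝ, Coord (Fin n ⊕ Fin N)) (localSection e) (φ.symm y)
        (coordVec φ y α)) (vertVec e (φ.symm y) (v J)) := rfl
  rw [h4, h5, ← adaptedChart_symm_zeroSection (e := e) v a hψ y] at h6
  exact h6

/-- Invariance reduces the claim to the zero section. There the fiber and mixed entries hold by the
definitions of `G` and `A`, and the horizontal lifts are orthogonal to the fibers, so the submersion
property evaluates the form on them as the base metric. -/
lemma metricCoeff_adaptedChart (he : e ∈ P.atlas) (hφ : φ ∈ charts (Fin n) B)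
    (hψ : IsLogChart ψ) (hinv : P.IsInvariantMetric gM) {gB : Metric (Fin n) B}
    (hsub : IsRiemannianSubmersion proj gM gB)
    {z : Coord (Fin n ⊕ Fin N)} (hz : z ∈ (adaptedChart e φ ψ v a).target) :
    metricCoeff gM (adaptedChart e φ ψ v a) z =
      blockMetric (metricCoeff gB φ (baseProj (Fin n) (Fin N) z))
        (matG gM e v φ (baseProj (Fin n) (Fin N) z))
        (connMat gM e v φ (baseProj (Fin n) (Fin N) z) - a) := by
  obtain ⟨hy, hb, -⟩ := (mem_adaptedChart_target e φ ψ v a z).1 hz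
  rw [shearEquiv_symm_fst] at hy hb
  have h0 : metricCoeff gM (adaptedChart e φ ψ v a) z = Matrix.of fun k l =>
      pullForm gM (adaptedChart e φ ψ v a).symm z (EuclideanSpace.single k 1)
        (EuclideanSpace.single l 1) := rfl
  rw [h0, pullForm_adaptedChart v a he hφ hψ hinv hz]
  set y := baseProj (Fin n) (Fin N) z with hydef
  set Φ := adaptedChart e φ ψ v a with hΦ
  set z₀ := shearEquiv v a (y, 0) with hz₀
  have hz₀' : z₀ ∈ Φ.target := zeroSection_mem_target v a hψ hy hb
  have hG : ∀ I J, pullForm gM Φ.symm z₀ (EuclideanSpace.single (Sum.inr I) 1)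
      (EuclideanSpace.single (Sum.inr J) 1) = matG gM e v φ y I J := fun I J =>
    (matG_eq v a gM he hφ hψ hy hb I J).symm
  have hA : ∀ J α, pullForm gM Φ.symm z₀ (EuclideanSpace.single (Sum.inl α) 1)
      (EuclideanSpace.single (Sum.inr J) 1) =
      ∑ I, (connMat gM e v φ y - a) I α * matG gM e v φ y I J := fun J α => by
    have h1 := connMat_mul_matG v a gM he hφ hψ hy hb α J
    rw [shearEquiv_single_zero, map_add, map_sum, LinearMap.add_apply, LinearMap.sum_apply] at h1
    simp only [map_smul, LinearMap.smul_apply, smul_eq_mul] at h1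
    simp only [Matrix.sub_apply, sub_mul, Finset.sum_sub_distrib]
    simp only [← hΦ, ← hz₀, hG] at h1
    rw [h1]
    ring
  refine bilinForm_eq_blockMetric (pullForm_symm gM Φ.symm z₀) hG hA fun α β => ?_
  set A := connMat gM e v φ y - a
  -- Every vector killed by the differential of the projection comes from a combination of fiber
  -- coordinate vectors, to which the lift is orthogonal by construction.
  have horth : ∀ α (t : TangentSpace 𝓘(ℝ, Coord (Fin n ⊕ Fin N)) (Φ.symm z₀)),
      mfderiv 𝓘(ℝ, Coord (Fin n ⊕ Fin N)) 𝓘(ℝ, Coord (Fin n)) proj (Φ.symm z₀) t = 0 →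
      gM.inner (Φ.symm z₀) (derivCoord (Fin n ⊕ Fin N) Φ.symm z₀ (horizVec A α)) t = 0 := by
    intro α t ht
    obtain ⟨ζ, rfl⟩ := mfderiv_symm_surjective
      (adaptedChart_mem_charts P he hφ hψ.mem_charts v a) hz₀' t
    have h1 := (mfderiv_proj_adaptedChart v a he hφ hψ hz₀' ζ).symm.trans ht
    have h2 : baseProj (Fin n) (Fin N) ζ = 0 :=
      mfderiv_symm_injective hφ hy (h1.trans (map_zero _).symm)
    have h3 : pullForm gM Φ.symm z₀ (horizVec A α) ζ = 0 := by
      rw [eq_sum_single_inr h2, map_sum]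
      refine Finset.sum_eq_zero fun J _ => ?_
      rw [map_smul, bilinForm_horizVec_single hG hA, smul_zero]
    exact h3
  have h4 := hsub (Φ.symm z₀) (derivCoord (Fin n ⊕ Fin N) Φ.symm z₀ (horizVec A α))
    (derivCoord (Fin n ⊕ Fin N) Φ.symm z₀ (horizVec A β))
    fun t ht => ⟨horth α t ht, horth β t ht⟩
  have h5 := mfderiv_proj_adaptedChart v a he hφ hψ hz₀' (horizVec A α)
  have h6 := mfderiv_proj_adaptedChart v a he hφ hψ hz₀' (horizVec A β)
  rw [baseProj_horizVec] at h5 h6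
  have h7 : proj (Φ.symm z₀) = φ.symm y := by
    rw [hΦ, hz₀, adaptedChart_symm_zeroSection v a hψ y, localSection,
      e.proj_symm_apply (e.mem_target.2 hb)]
  have h8 : pullForm gM Φ.symm z₀ (horizVec A α) (horizVec A β) =
      innerCoord gB (proj (Φ.symm z₀)) _ _ := h4
  rw [h5, h6, h7] at h8
  exact h8

end AdaptedMetric

/-! ### The vertical Einstein equation on the base. -/

section Einstein

variable {n N : ℕ}
variable {B : Type*} [TopologicalSpace B] [ChartedSpace (Coord (Fin n)) B]
  [IsManifold 𝓘(ℝ, Coord (Fin n)) ∞ B]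
variable {M : Type*} [TopologicalSpace M] [ChartedSpace (Coord (Fin n ⊕ Fin N)) M]
  [IsManifold 𝓘(ℝ, Coord (Fin n ⊕ Fin N)) ∞ M]
variable {𝒢 : Type*} [CommGroup 𝒢] [TopologicalSpace 𝒢] [ChartedSpace (Coord (Fin N)) 𝒢]
variable {proj : M → B}
variable {e : Trivialization 𝒢 proj} {φ : OpenPartialHomeomorph B (Coord (Fin n))}
    (v : Module.Basis (Fin N) ℝ (Coord (Fin N)))
    {P : TwistedPrincipalBundle (n := n) (N := N) 𝒢 proj}
    (gM : Metric (Fin n ⊕ Fin N) M) {gB : Metric (Fin n) B}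

lemma eventually_mem_target_baseSet {y : Coord (Fin n)} (hy : y ∈ φ.target)
    (hb : φ.symm y ∈ e.baseSet) : ∀ᶠ z in 𝓝 y, z ∈ φ.target ∧ φ.symm z ∈ e.baseSet :=
  (φ.open_target.eventually_mem hy).and
    ((φ.continuousAt_symm hy).eventually (e.open_baseSet.mem_nhds hb))

lemma normSqF_eq (y : Coord (Fin n)) : normSqF gM gB e v φ y =
    formNormSq (metricCoeff gB φ y) (matG gM e v φ y) fun α β I => curvF gM e v φ I α β y := by
  simp only [normSqF, formNormSq, dotProduct, Matrix.mulVec, Finset.mul_sum]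
  refine Finset.sum_congr rfl fun α _ => Finset.sum_congr rfl fun β _ =>
    Finset.sum_congr rfl fun γ _ => Finset.sum_congr rfl fun δ _ =>
    Finset.sum_congr rfl fun I _ => Finset.sum_congr rfl fun J _ => ?_
  ring

variable [LieGroup 𝓘(ℝ, Coord (Fin N)) ∞ 𝒢]

lemma contDiffAt_metricCoeff_zeroSection (he : e ∈ P.atlas) (hφ : φ ∈ charts (Fin n) B)
    {ψ : OpenPartialHomeomorph 𝒢 (Coord (Fin N))} (hψ : IsLogChart ψ) {y : Coord (Fin n)}
    (hy : y ∈ φ.target) (hb : φ.symm y ∈ e.baseSet) (k l : Fin n ⊕ Fin N) :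
    ContDiffAt ℝ ∞ (fun z => metricCoeff gM (adaptedChart e φ ψ v 0)
      (shearEquiv v 0 (z, 0)) k l) y := by
  have h1 := smoothMatAt_metricCoeff gM (adaptedChart_mem_charts P he hφ hψ.mem_charts v 0)
    (zeroSection_mem_target v 0 hψ hy hb) k l
  exact ContDiffAt.comp y (f := fun z => shearEquiv v 0 (z, 0)) h1
    ((shearEquiv v 0).contDiff.comp (contDiff_prodMk_left 0)).contDiffAt

lemma smoothMatAt_matG (he : e ∈ P.atlas) (hφ : φ ∈ charts (Fin n) B) {y : Coord (Fin n)}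
    (hy : y ∈ φ.target) (hb : φ.symm y ∈ e.baseSet) : SmoothMatAt (matG gM e v φ) y := by
  obtain ⟨ψ, hψ⟩ := exists_isLogChart N 𝒢
  intro I J
  refine (contDiffAt_metricCoeff_zeroSection v gM he hφ hψ hy hb
    (Sum.inr I) (Sum.inr J)).congr_of_eventuallyEq ?_
  filter_upwards [eventually_mem_target_baseSet hy hb] with z hz
  exact matG_eq v 0 gM he hφ hψ hz.1 hz.2 I J

/-- In the unsheared chart the mixed block of the smooth metric matrix is `G A`, and `G` is
invertible. -/
lemma smoothMatAt_connMat (he : e ∈ P.atlas) (hφ : φ ∈ charts (Fin n) B)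
    (hinv : P.IsInvariantMetric gM) (hsub : IsRiemannianSubmersion proj gM gB)
    {y : Coord (Fin n)} (hy : y ∈ φ.target) (hb : φ.symm y ∈ e.baseSet) :
    SmoothMatAt (connMat gM e v φ) y := by
  obtain ⟨ψ, hψ⟩ := exists_isLogChart N 𝒢
  have h1 : SmoothMatAt (fun z => Matrix.of fun (I : Fin N) (α : Fin n) =>
      metricCoeff gM (adaptedChart e φ ψ v 0) (shearEquiv v 0 (z, 0)) (Sum.inr I) (Sum.inl α)) y :=
    fun I α => contDiffAt_metricCoeff_zeroSection v gM he hφ hψ hy hb (Sum.inr I) (Sum.inl α)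
  have h2 := (smoothMatAt_matG v gM he hφ hy hb).inv (matG_posDef v gM he hφ hy hb).det_pos.ne'
  refine (h2.mul h1).congr ?_
  filter_upwards [eventually_mem_target_baseSet hy hb] with z hz
  have h3 := metricCoeff_adaptedChart v 0 gM he hφ hψ hinv hsub
    (zeroSection_mem_target v 0 hψ hz.1 hz.2)
  have h4 : (Matrix.of fun (I : Fin N) (α : Fin n) => metricCoeff gM (adaptedChart e φ ψ v 0)
      (shearEquiv v 0 (z, 0)) (Sum.inr I) (Sum.inl α)) =
      matG gM e v φ z * connMat gM e v φ z := by
    ext I α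
    rw [Matrix.of_apply, h3, blockMetric, Matrix.fromBlocks_apply₂₁, sub_zero,
      baseProj_shearEquiv]
  rw [h4, Matrix.nonsing_inv_mul_cancel_left _ _
    (isUnit_iff_ne_zero.2 (matG_posDef v gM he hφ hz.1 hz.2).det_pos.ne')]

/-- The vertical part of the Einstein equation. -/
theorem fiberRicci_of_isEinstein (he : e ∈ P.atlas) (hφ : φ ∈ charts (Fin n) B)
    (hinv : P.IsInvariantMetric gM) (hsub : IsRiemannianSubmersion proj gM gB)
    {lam : ℝ} (hE : IsEinstein gM lam)
    {y : Coord (Fin n)} (hy : y ∈ φ.target) (hb : φ.symm y ∈ e.baseSet) :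
    fiberRicci (metricCoeff gB φ) (matG gM e v φ) (fun α β I => curvF gM e v φ I α β y) y =
      lam • matG gM e v φ y := by
  obtain ⟨ψ, hψ⟩ := exists_isLogChart N 𝒢
  -- Shearing by the value of the connection at `y` makes it vanish at that point, as
  -- `ricci_blockMetric` requires.
  set a := connMat gM e v φ y with ha
  have hz := zeroSection_mem_target v a hψ hy hb
  have hA : SmoothMatAt (fun z => connMat gM e v φ z - a) y := fun I α =>
    (smoothMatAt_connMat v gM he hφ hinv hsub hy hb I α).sub contDiffAt_const
  -- The shear subtracts a constant matrix and leaves the curvature unchanged.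
  have hcurv : (fun α β => curvature (fun z => connMat gM e v φ z - a) α β y) =
      fun α β I => curvF gM e v φ I α β y := by
    funext α β I
    simp only [curvature, pdMat, Matrix.of_apply, Matrix.sub_apply, pd, fderiv_sub_const]
    rfl
  ext I J
  have h1 := ricci_blockMetric (y := y) (z₀ := shearEquiv v a (y, 0))
    (h := metricCoeff gM (adaptedChart e φ ψ v a)) (g := metricCoeff gB φ)
    (G := matG gM e v φ) (A := fun z => connMat gM e v φ z - a) rfl
    (by
      filter_upwards [(adaptedChart e φ ψ v a).open_target.mem_nhds hz] with z' hz'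
      exact metricCoeff_adaptedChart v a gM he hφ hψ hinv hsub hz')
    (smoothMatAt_metricCoeff gB hφ hy) (smoothMatAt_matG v gM he hφ hy hb) hA
    (Eventually.of_forall fun z => metricCoeff_transpose gB φ z)
    ((eventually_mem_target_baseSet hy hb).mono fun z hz' => by
      simpa using (matG_posDef v gM he hφ hz'.1 hz'.2).isHermitian.eq)
    (metricCoeff_posDef gB hφ hy).det_pos.ne' (matG_posDef v gM he hφ hy hb).det_pos.ne'
    (sub_self _) I J
  have h2 := hE _ (adaptedChart_mem_charts P he hφ hψ.mem_charts v a) _ hz (Sum.inr I) (Sum.inr J)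
  rw [h1, metricCoeff_adaptedChart v a gM he hφ hψ hinv hsub hz, blockMetric,
    Matrix.fromBlocks_apply₂₂, baseProj_shearEquiv, hcurv] at h2
  exact h2

end Einstein

/-! ### Parallel transport, holonomy and the global determinant. -/

section Transport

variable {n N : ℕ}
variable {B : Type*} [TopologicalSpace B] [ChartedSpace (Coord (Fin n)) B]
variable {M : Type*} [TopologicalSpace M] [ChartedSpace (Coord (Fin n ⊕ Fin N)) M]
variable {𝒢 : Type*} [CommGroup 𝒢] [TopologicalSpace 𝒢] [ChartedSpace (Coord (Fin N)) 𝒢]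
variable {proj : M → B}
variable {P : TwistedPrincipalBundle (n := n) (N := N) 𝒢 proj}
variable {e e' e'' : Trivialization 𝒢 proj} {b b' b'' : B}
  {L L' : Coord (Fin N) →L[ℝ] Coord (Fin N)}

lemma symm_transition (hb : b ∈ e.baseSet) (hb' : b ∈ e'.baseSet) (x : 𝒢) :
    e'.toOpenPartialHomeomorph.symm (b, transition e e' b x) =
      e.toOpenPartialHomeomorph.symm (b, x) := by
  have h1 : proj (e.toOpenPartialHomeomorph.symm (b, x)) = b :=
    e.proj_symm_apply (e.mem_target.2 hb)
  have h2 : e.toOpenPartialHomeomorph.symm (b, x) ∈ e'.source :=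
    e'.mem_source.2 (h1.symm ▸ hb')
  have h3 : e' (e.toOpenPartialHomeomorph.symm (b, x)) = (b, transition e e' b x) :=
    Prod.ext ((e'.coe_fst h2).trans h1) rfl
  rw [← h3]
  exact e'.toOpenPartialHomeomorph.left_inv h2

namespace TwistedPrincipalBundle

lemma Transport.mem (h : P.Transport e b e' b' L) : e' ∈ P.atlas ∧ b' ∈ e'.baseSet := by
  induction h with
  | refl he hb => exact ⟨he, hb⟩
  | move h hb ih => exact ⟨ih.1, hb.target_mem⟩
  | change h he hb ih => exact ⟨he, hb⟩

lemma Transport.trans (h : P.Transport e b e' b' L) (h' : P.Transport e' b' e'' b'' L') :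
    P.Transport e b e'' b'' (L'.comp L) := by
  induction h' with
  | refl he hb => exact h
  | move h' hb ih => exact ih.move hb
  | change h' he hb ih => exact ih.change he hb

/-- The set of points reached by transport is open and closed, because each point has a
neighbourhood whose points are joined to it inside a single trivialization. -/
lemma exists_transport [ConnectedSpace B] (he : e ∈ P.atlas) (hb : b ∈ e.baseSet)
    (he' : e' ∈ P.atlas) (hb' : b' ∈ e'.baseSet) : ∃ L, P.Transport e b e' b' L := by
  have : LocallyPathConnectedSpace B := ChartedSpace.locallyPathConnectedSpace (Coord (Fin n)) B
  set S : Set B := {b' | ∃ e' L, P.Transport e b e' b' L} with hS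
  have hnhds : ∀ b' : B, ∃ e' ∈ P.atlas, b' ∈ e'.baseSet ∧
      ∀ᶠ c in 𝓝 b', JoinedIn e'.baseSet b' c := fun b' => by
    obtain ⟨e', he', hb'⟩ := P.exists_mem_baseSet b'
    exact ⟨e', he', hb', pathComponentIn_mem_nhds (e'.open_baseSet.mem_nhds hb')⟩
  have hopen : IsOpen S := isOpen_iff_mem_nhds.2 fun b' ⟨e₁, L, hL⟩ => by
    obtain ⟨e', he', hb', h⟩ := hnhds b'
    filter_upwards [h] with c hc
    exact ⟨e', _, (hL.change he' hb').move hc⟩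
  have hclosed : IsClosed S := isOpen_compl_iff.1 <| isOpen_iff_mem_nhds.2 fun b' hb' => by
    obtain ⟨e', he', hb'', h⟩ := hnhds b'
    filter_upwards [h] with c hc
    rintro ⟨e₁, L, hL⟩
    exact hb' ⟨e', _, (hL.change he' hc.target_mem).move hc.symm⟩
  have huniv : S = univ := IsClopen.eq_univ ⟨hclosed, hopen⟩ ⟨b, e, _, .refl he hb⟩
  obtain ⟨e₁, L, hL⟩ : b' ∈ S := huniv ▸ mem_univ b'
  exact ⟨_, hL.change he' hb'⟩

/-- Composing with one and the same return transport `K` turns both maps into holonomies, of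
determinant `±1`; then `|det K|` cancels. -/
lemma HolonomyDetPmOne.abs_det_eq [ConnectedSpace B] (hol : P.HolonomyDetPmOne)
    (he : e ∈ P.atlas) (hb : b ∈ e.baseSet)
    (h : P.Transport e b e' b' L) (h' : P.Transport e b e' b' L') :
    |LinearMap.det (L : Coord (Fin N) →ₗ[ℝ] Coord (Fin N))| =
      |LinearMap.det (L' : Coord (Fin N) →ₗ[ℝ] Coord (Fin N))| ∧
    LinearMap.det (L : Coord (Fin N) →ₗ[ℝ] Coord (Fin N)) ≠ 0 := by
  obtain ⟨K, hK⟩ := exists_transport h.mem.1 h.mem.2 he hb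
  have h1 := hol e b _ (h.trans hK)
  have h2 := hol e b _ (h'.trans hK)
  rw [ContinuousLinearMap.toLinearMap_comp, LinearMap.det_comp, abs_mul] at h1 h2
  have hK0 : |LinearMap.det (K : Coord (Fin N) →ₗ[ℝ] Coord (Fin N))| ≠ 0 := fun h0 => by
    rw [h0, zero_mul] at h1; exact zero_ne_one h1
  refine ⟨mul_left_cancel₀ hK0 (h1.trans h2.symm), fun h0 => ?_⟩
  rw [h0, abs_zero, mul_zero] at h1
  exact zero_ne_one h1

end TwistedPrincipalBundle

variable [IsManifold 𝓘(ℝ, Coord (Fin n)) ∞ B] [IsManifold 𝓘(ℝ, Coord (Fin n ⊕ Fin N)) ∞ M]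

/-- The fiberwise inner product as a bilinear form. -/
def fiberForm (gM : Metric (Fin n ⊕ Fin N) M) (e : Trivialization 𝒢 proj) (b : B) :
    LinearMap.BilinForm ℝ (Coord (Fin N)) :=
  let D : Coord (Fin N) →L[ℝ] Coord (Fin n ⊕ Fin N) :=
    mfderiv 𝓘(ℝ, Coord (Fin N)) 𝓘(ℝ, Coord (Fin n ⊕ Fin N))
      (fun h : 𝒢 => e.toOpenPartialHomeomorph.symm (b, h)) (1 : 𝒢)
  LinearMap.mk₂ ℝ (fun u w => innerCoord gM (localSection e b) (D u) (D w))
    (fun u u' w => by rw [map_add, map_add]; rfl)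
    (fun c u w => by rw [map_smul, map_smul]; rfl)
    (fun u w w' => by rw [map_add, map_add])
    (fun c u w => by rw [map_smul, map_smul])

/-- The Gram matrix changes to `Lᵀ G L`. The factor is written with `|det L|`, the quantity that the
holonomy condition controls. -/
lemma det_fiberInner_comp (gM : Metric (Fin n ⊕ Fin N) M) (e : Trivialization 𝒢 proj) (b : B)
    (v : Module.Basis (Fin N) ℝ (Coord (Fin N))) (L : Coord (Fin N) →L[ℝ] Coord (Fin N)) :
    Matrix.det (Matrix.of fun I J => fiberInner gM e b (L (v I)) (L (v J))) =
      |LinearMap.det (L : Coord (Fin N) →ₗ[ℝ] Coord (Fin N))| ^ 2 *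
      Matrix.det (Matrix.of fun I J => fiberInner gM e b (v I) (v J)) := by
  have h1 := LinearMap.BilinForm.toMatrix_comp v v (fiberForm gM e b)
    (L : Coord (Fin N) →ₗ[ℝ] Coord (Fin N)) (L : Coord (Fin N) →ₗ[ℝ] Coord (Fin N))
  have h2 : (Matrix.of fun I J => fiberInner gM e b (L (v I)) (L (v J))) =
      LinearMap.BilinForm.toMatrix v ((fiberForm gM e b).comp
        (L : Coord (Fin N) →ₗ[ℝ] Coord (Fin N)) (L : Coord (Fin N) →ₗ[ℝ] Coord (Fin N))) := by
    ext I J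
    rw [LinearMap.BilinForm.toMatrix_apply]; rfl
  have h3 : (Matrix.of fun I J => fiberInner gM e b (v I) (v J)) =
      LinearMap.BilinForm.toMatrix v (fiberForm gM e b) := by
    ext I J
    rw [LinearMap.BilinForm.toMatrix_apply]; rfl
  rw [h2, h3, h1, Matrix.det_mul, Matrix.det_mul, Matrix.det_transpose, LinearMap.det_toMatrix,
    sq_abs]
  ring

variable [LieGroup 𝓘(ℝ, Coord (Fin N)) ∞ 𝒢]

lemma contMDiffAt_symm_fiber (he : e ∈ P.atlas) (hb : b ∈ e.baseSet) (x : 𝒢) :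
    ContMDiffAt 𝓘(ℝ, Coord (Fin N)) 𝓘(ℝ, Coord (Fin n ⊕ Fin N)) ∞
      (fun h : 𝒢 => e.toOpenPartialHomeomorph.symm (b, h)) x := by
  have h2 := (P.contMDiffOn_symm e he).contMDiffAt (e.open_target.mem_nhds
    (x := (b, x)) (e.mem_target.2 hb))
  exact ContMDiffAt.comp x (g := e.toOpenPartialHomeomorph.symm)
    (f := fun h : 𝒢 => (b, h)) h2 (contMDiffAt_const.prodMk contMDiffAt_id)

lemma contMDiffAt_transition (he : e ∈ P.atlas) (he' : e' ∈ P.atlas) (hb : b ∈ e.baseSet)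
    (hb' : b ∈ e'.baseSet) (x : 𝒢) :
    ContMDiffAt 𝓘(ℝ, Coord (Fin N)) 𝓘(ℝ, Coord (Fin N)) ∞ (transition e e' b) x := by
  have h1 : e.toOpenPartialHomeomorph.symm (b, x) ∈ e'.source :=
    e'.mem_source.2 ((e.proj_symm_apply (x := (b, x)) (e.mem_target.2 hb)).symm ▸ hb')
  have h2 : ContMDiffAt 𝓘(ℝ, Coord (Fin n ⊕ Fin N))
      (𝓘(ℝ, Coord (Fin n)).prod 𝓘(ℝ, Coord (Fin N))) ∞ e'
      (e.toOpenPartialHomeomorph.symm (b, x)) :=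
    (P.contMDiffOn e' he').contMDiffAt (e'.open_source.mem_nhds h1)
  exact (ContMDiffAt.comp x (g := e') h2 (contMDiffAt_symm_fiber he hb x)).snd

/-- Over `b`, one trivialization is the other precomposed with the normalized transition map `k` and
followed by the local action of the constant `c`. That action is isometric, and the differential of
`k` at the identity is the transition function of the flat bundle. -/
lemma fiberInner_transitionDeriv {gM : Metric (Fin n ⊕ Fin N) M} (hinv : P.IsInvariantMetric gM)
    (he : e ∈ P.atlas) (he' : e' ∈ P.atlas) (hb : b ∈ e.baseSet) (hb' : b ∈ e'.baseSet)
    (w w' : Coord (Fin N)) :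
    fiberInner gM e' b (transitionDeriv e e' b w) (transitionDeriv e e' b w') =
      fiberInner gM e b w w' := by
  set c := transition e e' b 1 with hc
  set k : 𝒢 → 𝒢 := fun x => c⁻¹ * transition e e' b x with hk
  have hk1 : k 1 = 1 := inv_mul_cancel c
  have h1 : MDifferentiableAt 𝓘(ℝ, Coord (Fin N)) 𝓘(ℝ, Coord (Fin N)) k 1 :=
    (contMDiffAt_const.mul (contMDiffAt_transition he he' hb hb' 1)).mdifferentiableAt (by simp)
  have h2 : MDifferentiableAt 𝓘(ℝ, Coord (Fin N)) 𝓘(ℝ, Coord (Fin n ⊕ Fin N))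
      (fun h : 𝒢 => e'.toOpenPartialHomeomorph.symm (b, h)) 1 :=
    (contMDiffAt_symm_fiber he' hb' 1).mdifferentiableAt (by simp)
  have hsrc : localSection e' b ∈ e'.source := e'.mem_source.2
    ((e'.proj_symm_apply (x := (b, 1)) (e'.mem_target.2 hb')).symm ▸ hb')
  have h3 : MDifferentiableAt 𝓘(ℝ, Coord (Fin n ⊕ Fin N)) 𝓘(ℝ, Coord (Fin n ⊕ Fin N))
      (localAct e' c) (localSection e' b) :=
    (contMDiffAt_localAct P he' c hsrc).mdifferentiableAt (by simp)
  have h4 : (fun x : 𝒢 => e.toOpenPartialHomeomorph.symm (b, x)) =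
      localAct e' c ∘ (fun h : 𝒢 => e'.toOpenPartialHomeomorph.symm (b, h)) ∘ k := by
    funext x
    rw [Function.comp_apply, Function.comp_apply, localAct_symm c hb', hk, mul_inv_cancel_left,
      symm_transition hb hb']
  have hk2 : ((fun h : 𝒢 => e'.toOpenPartialHomeomorph.symm (b, h)) ∘ k) 1 = localSection e' b := by
    rw [Function.comp_apply, hk1, localSection]
  let D : Coord (Fin N) →L[ℝ] Coord (Fin n ⊕ Fin N) :=
    mfderiv 𝓘(ℝ, Coord (Fin N)) 𝓘(ℝ, Coord (Fin n ⊕ Fin N))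
      (fun h : 𝒢 => e'.toOpenPartialHomeomorph.symm (b, h)) 1
  let D' : Coord (Fin n ⊕ Fin N) →L[ℝ] Coord (Fin n ⊕ Fin N) :=
    mfderiv 𝓘(ℝ, Coord (Fin n ⊕ Fin N)) 𝓘(ℝ, Coord (Fin n ⊕ Fin N)) (localAct e' c)
      (localSection e' b)
  have hD : HasMFDerivAt 𝓘(ℝ, Coord (Fin N)) 𝓘(ℝ, Coord (Fin n ⊕ Fin N))
      (fun h : 𝒢 => e'.toOpenPartialHomeomorph.symm (b, h)) (k 1) D := by
    rw [hk1]; exact h2.hasMFDerivAt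
  have h5 := HasMFDerivAt.comp (1 : 𝒢) hD h1.hasMFDerivAt
  have hD' : HasMFDerivAt 𝓘(ℝ, Coord (Fin n ⊕ Fin N)) 𝓘(ℝ, Coord (Fin n ⊕ Fin N))
      (localAct e' c) (((fun h : 𝒢 => e'.toOpenPartialHomeomorph.symm (b, h)) ∘ k) 1) D' := by
    rw [hk2]; exact h3.hasMFDerivAt
  have h6 := (HasMFDerivAt.comp (1 : 𝒢) hD' h5).mfderiv
  rw [← h4] at h6
  have h7 : ∀ u : Coord (Fin N), (vertVec e b u : Coord (Fin n ⊕ Fin N)) =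
      mfderiv 𝓘(ℝ, Coord (Fin n ⊕ Fin N)) 𝓘(ℝ, Coord (Fin n ⊕ Fin N)) (localAct e' c)
        (localSection e' b) (vertVec e' b (transitionDeriv e e' b u)) := fun u =>
    congrArg (fun D : Coord (Fin N) →L[ℝ] Coord (Fin n ⊕ Fin N) => D u) h6
  have h8 : fiberInner gM e b w w' = innerCoord gM (localSection e b) (vertVec e b w)
    (vertVec e b w') := rfl
  have h9 : localSection e b = localAct e' c (localSection e' b) := by
    have := congrFun h4 1
    rw [Function.comp_apply, hk2] at this
    exact this
  rw [h7, h7, h9] at h8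
  rw [h8]
  exact (hinv e' he' c _ hsrc _ _).symm

/-- `det G` in terms of an arbitrary parallel transport. -/
lemma detG_eq [ConnectedSpace B] (hol : P.HolonomyDetPmOne) {gM : Metric (Fin n ⊕ Fin N) M}
    (hinv : P.IsInvariantMetric gM) (v : Module.Basis (Fin N) ℝ (Coord (Fin N)))
    {e₀ : Trivialization 𝒢 proj} {b₀ : B} (h : P.Transport e₀ b₀ e b L)
    (he₀ : e₀ ∈ P.atlas) (hb₀ : b₀ ∈ e₀.baseSet) :
    P.detG gM v e₀ b₀ b = |LinearMap.det (L : Coord (Fin N) →ₗ[ℝ] Coord (Fin N))| ^ 2 *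
      Matrix.det (Matrix.of fun I J => fiberInner gM e b (v I) (v J)) := by
  have hex : ∃ d : ℝ, ∃ (e : Trivialization 𝒢 proj) (L : Coord (Fin N) →L[ℝ] Coord (Fin N)),
      P.Transport e₀ b₀ e b L ∧
        d = Matrix.det (Matrix.of fun I J => fiberInner gM e b (L (v I)) (L (v J))) :=
    ⟨_, e, L, h, rfl⟩
  -- The choice operator returns the determinant for some unknown trivialization and path; extending
  -- that path by a change to `e` makes it comparable with the given one.
  obtain ⟨e', L', h', hd⟩ := Classical.epsilon_spec hex
  refine Eq.trans (b := Matrix.det (Matrix.of fun I J =>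
    fiberInner gM e' b (L' (v I)) (L' (v J)))) hd ?_
  have h1 := fun w w' => fiberInner_transitionDeriv hinv h'.mem.1 h.mem.1 h'.mem.2 h.mem.2 w w'
  have h2 := h'.change h.mem.1 h.mem.2
  simp only [← h1]
  have h3 := det_fiberInner_comp gM e b v ((transitionDeriv e' e b).comp L')
  simp only [ContinuousLinearMap.comp_apply] at h3
  rw [h3, (hol.abs_det_eq he₀ hb₀ h2 h).1]

/-- Moving inside one trivialization leaves the transport map unchanged, so `c = |det L|²` serves
for all nearby points. -/
lemma detG_eventuallyEq [ConnectedSpace B] (hol : P.HolonomyDetPmOne)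
    {gM : Metric (Fin n ⊕ Fin N) M}
    (hinv : P.IsInvariantMetric gM) (v : Module.Basis (Fin N) ℝ (Coord (Fin N)))
    {e₀ : Trivialization 𝒢 proj} {b₀ : B} (he₀ : e₀ ∈ P.atlas) (hb₀ : b₀ ∈ e₀.baseSet)
    (he : e ∈ P.atlas) {φ : OpenPartialHomeomorph B (Coord (Fin n))} {y : Coord (Fin n)}
    (hy : y ∈ φ.target) (hb : φ.symm y ∈ e.baseSet) :
    ∃ c : ℝ, 0 < c ∧ ∀ᶠ z in 𝓝 y, P.detG gM v e₀ b₀ (φ.symm z) = c * (matG gM e v φ z).det := by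
  obtain ⟨L, hL⟩ := TwistedPrincipalBundle.exists_transport he₀ hb₀ he hb
  have h0 := (hol.abs_det_eq he₀ hb₀ hL hL).2
  refine ⟨|LinearMap.det (L : Coord (Fin N) →ₗ[ℝ] Coord (Fin N))| ^ 2, by positivity, ?_⟩
  have : LocallyPathConnectedSpace B := ChartedSpace.locallyPathConnectedSpace (Coord (Fin n)) B
  have h1 : ∀ᶠ c in 𝓝 (φ.symm y), JoinedIn e.baseSet (φ.symm y) c :=
    pathComponentIn_mem_nhds (e.open_baseSet.mem_nhds hb)
  filter_upwards [(φ.continuousAt_symm hy).eventually h1] with z hz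
  exact detG_eq hol hinv v (hL.move hz) he₀ hb₀

end Transport

end TwistedBundle

end

/-! ### The theorem. -/

theorem proposition2p10 {n N : ℕ} (hN : 1 ≤ N)
    {B : Type*} [TopologicalSpace B] [T2Space B] [SecondCountableTopology B] [ConnectedSpace B]
    [ChartedSpace (Coord (Fin n)) B] [IsManifold 𝓘(ℝ, Coord (Fin n)) ∞ B]
    {M : Type*} [TopologicalSpace M] [T2Space M] [SecondCountableTopology M]
    [ChartedSpace (Coord (Fin n ⊕ Fin N)) M] [IsManifold 𝓘(ℝ, Coord (Fin n ⊕ Fin N)) ∞ M]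
    {𝒢 : Type*} [CommGroup 𝒢] [TopologicalSpace 𝒢] [T2Space 𝒢] [SecondCountableTopology 𝒢]
    [ConnectedSpace 𝒢] [ChartedSpace (Coord (Fin N)) 𝒢] [LieGroup 𝓘(ℝ, Coord (Fin N)) ∞ 𝒢]
    (proj : M → B) (P : TwistedPrincipalBundle (n := n) (N := N) 𝒢 proj)
    (hol : P.HolonomyDetPmOne)
    (gM : Metric (Fin n ⊕ Fin N) M) (hinv : P.IsInvariantMetric gM)
    (gB : Metric (Fin n) B) (hsub : IsRiemannianSubmersion proj gM gB)
    (lam : ℝ) (hE : IsEinstein gM lam)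
    (v : Module.Basis (Fin N) ℝ (Coord (Fin N)))
    (e₀ : Trivialization 𝒢 proj) (he₀ : e₀ ∈ P.atlas) (b₀ : B) (hb₀ : b₀ ∈ e₀.baseSet) :
    (∀ φ ∈ charts (Fin n) B, ∀ e ∈ P.atlas, ∀ y ∈ φ.target, φ.symm y ∈ e.baseSet →
      coordLaplacian (metricCoeff gB φ) (fun z => √(P.detG gM v e₀ b₀ (φ.symm z))) y =
        ((1 / 4) * normSqF gM gB e v φ y - lam * N) * √(P.detG gM v e₀ b₀ (φ.symm y))) ∧
    (IsParabolic gB → lam ≤ 0 → BddAbove (range (P.detG gM v e₀ b₀)) →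
      (∃ c : ℝ, ∀ b, P.detG gM v e₀ b₀ b = c) ∧
      (∀ φ ∈ charts (Fin n) B, ∀ e ∈ P.atlas, ∀ y ∈ φ.target, φ.symm y ∈ e.baseSet →
        ∀ I α β, curvF gM e v φ I α β y = 0) ∧
      lam = 0 ∧
      (∀ φ ∈ charts (Fin n) B, ∀ e ∈ P.atlas, ∀ y ∈ φ.target, φ.symm y ∈ e.baseSet →
        ∀ I J, harmonicG gM gB e v φ I J y = 0)) := by
  have hloc := fun {φ : OpenPartialHomeomorph B (Coord (Fin n))} {e : Trivialization 𝒢 proj}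
    {y : Coord (Fin n)} (he : e ∈ P.atlas) (hy : y ∈ φ.target) (hb : φ.symm y ∈ e.baseSet) =>
    detG_eventuallyEq hol hinv v he₀ hb₀ he hy hb
  have hlap : ∀ φ ∈ charts (Fin n) B, ∀ e ∈ P.atlas, ∀ y ∈ φ.target, φ.symm y ∈ e.baseSet →
      coordLaplacian (metricCoeff gB φ) (fun z => √(P.detG gM v e₀ b₀ (φ.symm z))) y =
        ((1 / 4) * normSqF gM gB e v φ y - lam * N) * √(P.detG gM v e₀ b₀ (φ.symm y)) := by
    intro φ hφ e he y hy hb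
    obtain ⟨c, hc, hev⟩ := hloc he hy hb
    have h1 := coordLaplacian_sqrt_det_of_fiberRicci (metricCoeff gB φ)
      (fun α β I => curvF gM e v φ I α β y) (f := fun z => √(P.detG gM v e₀ b₀ (φ.symm z))) hc
      ((eventually_mem_target_baseSet hy hb).mono fun z hz =>
        smoothMatAt_matG v gM he hφ hz.1 hz.2)
      (matG_posDef v gM he hφ hy hb).det_pos (hev.mono fun z hz => congrArg Real.sqrt hz)
      (fiberRicci_of_isEinstein v gM he hφ hinv hsub hE hy hb)
    rw [h1, normSqF_eq, Fintype.card_fin]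
  refine ⟨hlap, fun hpar hlam hbdd => ?_⟩
  have hnn : ∀ φ ∈ charts (Fin n) B, ∀ e ∈ P.atlas, ∀ y ∈ φ.target, φ.symm y ∈ e.baseSet →
      0 ≤ normSqF gM gB e v φ y ∧
        (normSqF gM gB e v φ y = 0 → ∀ I α β, curvF gM e v φ I α β y = 0) := by
    intro φ hφ e he y hy hb
    have h1 := formNormSq_nonneg (metricCoeff_posDef gB hφ hy) (matG_posDef v gM he hφ hy hb)
      fun α β I => curvF gM e v φ I α β y
    rw [normSqF_eq]
    exact ⟨h1.1, fun h0 I α β => congrFun (h1.2 h0 α β) I⟩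
  have hpos : ∀ b, 0 < P.detG gM v e₀ b₀ b := by
    intro b
    obtain ⟨e, he, hb⟩ := P.exists_mem_baseSet b
    have hφ : chartAt (Coord (Fin n)) b ∈ charts (Fin n) B := IsManifold.chart_mem_maximalAtlas b
    have hy := mem_chart_target (Coord (Fin n)) b
    have hs : (chartAt (Coord (Fin n)) b).symm (chartAt (Coord (Fin n)) b b) = b :=
      (chartAt (Coord (Fin n)) b).left_inv (mem_chart_source _ b)
    obtain ⟨c, hc, hev⟩ := hloc he hy (hs.symm ▸ hb)
    have h1 := hev.self_of_nhds
    rw [hs] at h1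
    rw [h1]
    exact mul_pos hc (matG_posDef v gM he hφ hy (hs.symm ▸ hb)).det_pos
  have hN' : (1 : ℝ) ≤ N := by exact_mod_cast hN
  have hsmooth : ContMDiff 𝓘(ℝ, Coord (Fin n)) 𝓘(ℝ, ℝ) 2
      fun b => √(P.detG gM v e₀ b₀ b) := by
    intro b
    obtain ⟨e, he, hb⟩ := P.exists_mem_baseSet b
    have hφ : chartAt (Coord (Fin n)) b ∈ charts (Fin n) B := IsManifold.chart_mem_maximalAtlas b
    set φ := chartAt (Coord (Fin n)) b with hφdef
    have hy : φ b ∈ φ.target := mem_chart_target (Coord (Fin n)) b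
    have hs : φ.symm (φ b) = b := φ.left_inv (mem_chart_source _ b)
    have hb' : φ.symm (φ b) ∈ e.baseSet := hs.symm ▸ hb
    obtain ⟨c, hc, hev⟩ := hloc he hy hb'
    have h1 : ContDiffAt ℝ ∞ (fun z => √(P.detG gM v e₀ b₀ (φ.symm z))) (φ b) := by
      have h2 : ContDiffAt ℝ ∞ (fun z => √(c * (matG gM e v φ z).det)) (φ b) :=
        (contDiffAt_const.mul (smoothMatAt_matG v gM he hφ hy hb').det).sqrt
          (mul_pos hc (matG_posDef v gM he hφ hy hb').det_pos).ne'
      exact h2.congr_of_eventuallyEq (hev.mono fun z hz => congrArg Real.sqrt hz)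
    have h3 : ContMDiffAt 𝓘(ℝ, Coord (Fin n)) 𝓘(ℝ, ℝ) ∞
        ((fun z => √(P.detG gM v e₀ b₀ (φ.symm z))) ∘ φ) b :=
      ContMDiffAt.comp b h1.contMDiffAt
        (contMDiffAt_of_mem_maximalAtlas hφ (mem_chart_source _ b))
    refine (h3.congr_of_eventuallyEq ?_).of_le (by norm_cast)
    filter_upwards [φ.open_source.mem_nhds (mem_chart_source _ b)] with b' hb''
    rw [Function.comp_apply, φ.left_inv hb'']
  have hsubh : IsSubharmonic gB fun b => √(P.detG gM v e₀ b₀ b) := by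
    intro φ hφ y hy
    obtain ⟨e, he, hb⟩ := P.exists_mem_baseSet (φ.symm y)
    rw [hlap φ hφ e he y hy hb]
    have h1 := (hnn φ hφ e he y hy hb).1
    refine mul_nonneg ?_ (Real.sqrt_nonneg _)
    -- Uses `|F|² ≥ 0` and `-λN ≥ 0`.
    nlinarith
  obtain ⟨C, hC⟩ := hpar _ hsmooth (fun b => Real.sqrt_nonneg _) (by
    obtain ⟨K, hK⟩ := hbdd
    refine ⟨√K, ?_⟩
    rintro _ ⟨b, rfl⟩
    exact Real.sqrt_le_sqrt (hK ⟨b, rfl⟩)) hsubh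
  have hconst : ∀ b, P.detG gM v e₀ b₀ b = C ^ 2 := fun b => by
    rw [← hC b, Real.sq_sqrt (hpos b).le]
  have hzero : ∀ φ ∈ charts (Fin n) B, ∀ e ∈ P.atlas, ∀ y ∈ φ.target, φ.symm y ∈ e.baseSet →
      normSqF gM gB e v φ y = 0 ∧ lam = 0 := by
    intro φ hφ e he y hy hb
    have h1 := hlap φ hφ e he y hy hb
    have h2 : coordLaplacian (metricCoeff gB φ)
        (fun z => √(P.detG gM v e₀ b₀ (φ.symm z))) y = 0 := by
      have h3 : ∀ j : Fin n, pd j (fun _ : Coord (Fin n) => C) = fun _ => 0 := fun j =>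
        funext fun z => pd_const j C z
      simp only [hC, coordLaplacian, hess, h3, pd_const, mul_zero, Finset.sum_const_zero, sub_zero]
    rw [h2] at h1
    -- As `√det G` is positive and its Laplacian is zero, `¼ |F|² = λN`. The left side is
    -- nonnegative and the right side is nonpositive, so both vanish; `N ≥ 1` then gives `λ = 0`.
    have h4 := (mul_eq_zero.1 h1.symm).resolve_right (Real.sqrt_pos.2 (hpos _)).ne'
    have h5 := (hnn φ hφ e he y hy hb).1
    constructor <;> nlinarith
  have hb₀' : (chartAt (Coord (Fin n)) b₀).symm (chartAt (Coord (Fin n)) b₀ b₀) ∈ e₀.baseSet := by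
    rwa [(chartAt (Coord (Fin n)) b₀).left_inv (mem_chart_source _ b₀)]
  have hlam0 : lam = 0 := (hzero _ (IsManifold.chart_mem_maximalAtlas b₀) e₀ he₀ _
    (mem_chart_target (Coord (Fin n)) b₀) hb₀').2
  refine ⟨⟨C ^ 2, hconst⟩, fun φ hφ e he y hy hb =>
    (hnn φ hφ e he y hy hb).2 (hzero φ hφ e he y hy hb).1, hlam0, fun φ hφ e he y hy hb => ?_⟩
  have hR := fiberRicci_of_isEinstein v gM he hφ hinv hsub hE hy hb
  rw [hlam0, zero_smul] at hR
  refine harmonic_of_fiberRicci_eq_zero _ hR (fun α β => funext fun I =>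
    (hnn φ hφ e he y hy hb).2 (hzero φ hφ e he y hy hb).1 I α β) fun α => ?_
  have hd := (matG_posDef v gM he hφ hy hb).det_pos
  -- Locally `det G` in the frame `v` is constant, so Jacobi's formula gives `tr(G⁻¹ ∂_α G) = 0`,
  -- the last input to the harmonic map equation.
  obtain ⟨c, hc, hev⟩ := hloc he hy hb
  have h1 := pd_det (k := α) (smoothMatAt_matG v gM he hφ hy hb) hd.ne'
  have h2 : (fun z => (matG gM e v φ z).det) =ᶠ[𝓝 y] fun _ => C ^ 2 / c := by
    filter_upwards [hev] with z hz
    rw [eq_div_iff hc.ne', mul_comm, ← hz, hconst]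
  rw [pd_congr h2, pd_const] at h1
  exact (mul_eq_zero.1 h1.symm).resolve_left hd.ne'
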